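/- All graphs are finite and simple. A *pyramid* is a graph consisting of a cycle $C$ and one further vertex $w$ joined to $C$ by at least three edges. A *trihedron* is the union of three paths of length at least $2$ between two distinct vertices $x,y$, pairwise disjoint except at $x$ and $y$. A *stamp* is the union of a triangle $T$ and three paths of length at least $1$ from the three different vertices of $T$ to a common vertex $x$, pairwise disjoint except at $x$. A *prism* is the union of two vertex-disjoint triangles $x_1x_2x_3$ and $y_1y_2y_3$ and three pairwise vertex-disjoint paths $P_i$ from $x_i$ to $y_i$ ($i=1,2,3$). A *solid* in a graph $G$ is an induced subgraph of $G$ that is isomorphic to a pyramid, a trihedron, a stamp or a prism; $S(G)$ is the set of all solids in $G$. Let $\chi(G)$ be the chromatic number of $G$ and $h(G)$ its Hadwiger number, the largest $t$ such that $G$ has a $K^t$ minor. **Theorem.** Let $G$ be a connected graph and let $n$ be a natural number. If $|S(G)|<\binom{n}{4}$, then $\max(\chi(G),h(G))<n$. -/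

import Mathlib

/-- A pyramid: a cycle together with one further vertex `w` (the apex) that is joined to the
cycle by at least three edges; there are no other vertices or edges. -/
def IsPyramid {W : Type*} (H : SimpleGraph W) : Prop :=
  ∃ (w u : W) (c : H.Walk u u), c.IsCycle ∧ w ∉ c.support ∧
    (∀ v, v = w ∨ v ∈ c.support) ∧
    3 ≤ (H.neighborSet w).encard ∧
    ∀ v v', v ≠ w → v' ≠ w → H.Adj v v' → s(v, v') ∈ c.edges

/-- A trihedron: the union of three internally disjoint paths of length at least two
between two distinct vertices `x` and `y`. -/
def IsTrihedron {W : Type*} (H : SimpleGraph W) : Prop :=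
  ∃ (x y : W) (P : Fin 3 → H.Walk x y), x ≠ y ∧
    (∀ i, (P i).IsPath ∧ 2 ≤ (P i).length) ∧
    (∀ i j, i ≠ j → ∀ v, v ∈ (P i).support → v ∈ (P j).support → v = x ∨ v = y) ∧
    (∀ v, ∃ i, v ∈ (P i).support) ∧
    ∀ e ∈ H.edgeSet, ∃ i, e ∈ (P i).edges

/-- A stamp: the union of a triangle `t 0, t 1, t 2` and three paths of length at least one
from the three vertices of the triangle to a common vertex `x`, pairwise disjoint except at `x`. -/
def IsStamp {W : Type*} (H : SimpleGraph W) : Prop :=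
  ∃ (t : Fin 3 → W) (x : W) (P : ∀ i, H.Walk (t i) x),
    (∀ i j, i ≠ j → H.Adj (t i) (t j)) ∧
    (∀ i, (P i).IsPath ∧ 1 ≤ (P i).length) ∧
    (∀ i j, i ≠ j → ∀ v, v ∈ (P i).support → v ∈ (P j).support → v = x) ∧
    (∀ v, ∃ i, v ∈ (P i).support) ∧
    ∀ e ∈ H.edgeSet, (∃ i j, e = s(t i, t j)) ∨ ∃ i, e ∈ (P i).edges

/-- A prism: the union of two disjoint triangles `a 0, a 1, a 2` and `b 0, b 1, b 2` and three
pairwise disjoint paths, the `i`-th one from `a i` to `b i`. -/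
def IsPrism {W : Type*} (H : SimpleGraph W) : Prop :=
  ∃ (a b : Fin 3 → W) (P : ∀ i, H.Walk (a i) (b i)),
    (∀ i j, i ≠ j → H.Adj (a i) (a j)) ∧
    (∀ i j, i ≠ j → H.Adj (b i) (b j)) ∧
    (∀ i j, a i ≠ b j) ∧
    (∀ i, (P i).IsPath) ∧
    (∀ i j, i ≠ j → ∀ v, v ∈ (P i).support → v ∉ (P j).support) ∧
    (∀ v, ∃ i, v ∈ (P i).support) ∧
    ∀ e ∈ H.edgeSet,
      (∃ i j, e = s(a i, a j)) ∨ (∃ i j, e = s(b i, b j)) ∨ ∃ i, e ∈ (P i).edges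

/-- The solid graphs. -/
def IsSolidGraph {W : Type*} (H : SimpleGraph W) : Prop :=
  IsPyramid H ∨ IsTrihedron H ∨ IsStamp H ∨ IsPrism H

/-- The set `S(G)` of solids in `G`: the induced subgraphs of `G` that are solid graphs, each
given by its vertex set (an induced subgraph is determined by its vertex set). -/
def solids {V : Type*} (G : SimpleGraph V) : Set (Set V) :=
  {s | IsSolidGraph (G.induce s)}

/-- `G` has a `K^t` minor: `G` has `t` pairwise disjoint connected (in particular nonempty)
vertex sets, any two of them joined by an edge; contracting each set to a point (and deleting the
other vertices) gives `K^t`. -/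
def HasCompleteMinor {V : Type*} (G : SimpleGraph V) (t : ℕ) : Prop :=
  ∃ B : Fin t → Set V,
    (∀ i, (G.induce (B i)).Connected) ∧
    (∀ i j, i ≠ j → Disjoint (B i) (B j)) ∧
    ∀ i j, i ≠ j → ∃ u ∈ B i, ∃ v ∈ B j, G.Adj u v

/-- The Hadwiger number `h(G)`: the largest `t` such that `G` has a `K^t` minor. -/
noncomputable def hadwigerNumber {V : Type*} (G : SimpleGraph V) : ℕ∞ :=
  ⨆ (t : ℕ) (_ : HasCompleteMinor G t), (t : ℕ∞)

/-! ### Induced paths, as vertex sets -/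

/-! Both bounds count solids from below. A $K^t$ minor forces $\binom t4$ solids
(`HasCompleteMinor.choose_le_encard_solids`), and a graph that is not $m$-colourable has at least
$\binom{m+1}4$ of them (`choose_le_ncard_solids`); the theorem follows with $t\ge n$ and $m=n-1$.

Solids are produced by one local principle. Let three vertices see a connected set. Inside the set
there is a connected part forming with the three vertices a fan, a claw or a net
(`exists_link_structure`). If the three vertices form a triangle, these yield a pyramid, a stamp or
a prism; if they are independent neighbours of a further vertex with no neighbour in the set, they
yield a pyramid, a trihedron or a stamp. Similarly, an induced cycle and a disjoint connected set
seen by two nonadjacent vertices of the cycle contain a solid that includes the whole cycle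
(`exists_solid_of_seesPair`).

For the minor, every four branch sets contain in their union a solid meeting all four, so different
quadruples give different solids. Contract the branch sets one at a time: after all contractions
there is a $K^4$, which is a solid. To undo the contraction of $B$ to $z$, present the solid as a
rigid part avoiding $z$ (an induced cycle, or a vertex with three independent neighbours) and a
connected set $D\ni z$ that is minimal for its attachment to the rigid part
(`presented_of_mem_solids`). Replacing $z$ by $B$ in $D$ leaves a connected attaching set, which
contains the variable part $F$ of a solid of the larger graph. The image of $F$ under the
contraction still attaches, so by minimality it is all of $D$: the new solid loses no vertex other
than $z$ and meets $B$ (`IsContraction.exists_solid`).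

For the colouring, every nonempty vertex set $U$ has a vertex $v$ such that any three neighbours of
$v$ in $U$ are exactly the neighbours of $v$ in some solid inside $U$ (`exists_isGoodVertex`). Thus
$v$ lies in at least $\binom d3$ solids, where $d$ is its degree in $U$. Now delete $v$. If $d<m$,
non-$m$-colourability survives. If $d\ge m$, non-$(m-1)$-colourability survives, and $\binom
m3+\binom m4=\binom{m+1}4$. -/

/-- `IndPath G a S b`: the set `S` induces in `G` a path from `a` to `b`. -/
inductive IndPath {V : Type*} (G : SimpleGraph V) : V → Set V → V → Prop
  | single (a : V) : IndPath G a {a} a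
  | cons {a b c : V} {S : Set V} (hab : G.Adj a b) (h : IndPath G b S c) (ha : a ∉ S)
      (hu : ∀ w ∈ S, G.Adj a w → w = b) : IndPath G a (insert a S) c

/-- No nonempty proper subset of `D` is closed under adjacency in `D`. -/
def SetConn {V : Type*} (G : SimpleGraph V) (D : Set V) : Prop :=
  ∀ A ⊆ D, A.Nonempty → (∀ u ∈ A, ∀ v ∈ D, G.Adj u v → v ∈ A) → A = D

section
variable {V : Type*} {G : SimpleGraph V} {a b c d : V} {S T D E : Set V}

namespace IndPath

theorem left_mem (h : IndPath G a S b) : a ∈ S := by cases h <;> simp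

theorem right_mem (h : IndPath G a S b) : b ∈ S := by
  induction h with
  | single a => simp
  | cons _ _ _ _ ih => exact Or.inr ih

theorem of_eq (h : IndPath G a S b) (e : S = T) : IndPath G a T b := e ▸ h

/-- Two induced paths joined by an edge. -/
theorem join (h : IndPath G a S b) (hbc : G.Adj b c) (h' : IndPath G c T d)
    (hd : ∀ w ∈ S, w ∉ T) (hx : ∀ u ∈ S, ∀ v ∈ T, G.Adj u v → u = b ∧ v = c) :
    IndPath G a (S ∪ T) d := by
  induction h with
  | single a =>
    rw [Set.singleton_union]
    exact cons hbc h' (hd a rfl) fun w hw e => (hx a rfl w hw e).2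
  | @cons a e f S hae h ha hu ih =>
    rw [Set.insert_union]
    refine cons hae (ih hbc (fun w hw => hd w (Or.inr hw)) fun u hu' v hv e =>
      hx u (Or.inr hu') v hv e) ?_ ?_
    · rintro (h1 | h1)
      · exact ha h1
      · exact hd a (Or.inl rfl) h1
    · rintro w (hw | hw) e
      · exact hu w hw e
      · have := (hx a (Or.inl rfl) w hw e).1
        subst this
        exact absurd h.right_mem ha

theorem reverse (h : IndPath G a S b) : IndPath G b S a := by
  induction h with
  | single a => exact single a
  | @cons a e f S hae h ha hu ih =>
    have := ih.join hae.symm (single a) (fun w hw hw' => ha (by rwa [← show w = a from hw']))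
      (fun u hu' v hv e => by
        have hv : v = a := hv
        subst hv
        exact ⟨hu u hu' e.symm, rfl⟩)
    exact this.of_eq (by simp)

/-- The first step of an induced path with distinct ends. -/
theorem uncons (h : IndPath G a S b) (hab : a ≠ b) :
    ∃ a' S', IndPath G a' S' b ∧ G.Adj a a' ∧ a ∉ S' ∧ (∀ w ∈ S', G.Adj a w → w = a') ∧
      S = insert a S' := by
  cases h with
  | single => exact absurd rfl hab
  | @cons _ e _ S' hae h ha hu => exact ⟨e, S', h, hae, ha, hu, rfl⟩

theorem eq_singleton (h : IndPath G a S a) : S = {a} := by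
  cases h with
  | single => rfl
  | cons hab h ha hu => exact absurd h.right_mem ha

theorem split (h : IndPath G a S b) {w : V} (hw : w ∈ S) :
    ∃ S₁ S₂, IndPath G a S₁ w ∧ IndPath G w S₂ b ∧ S = S₁ ∪ S₂ ∧
      (∀ u ∈ S₁, u ∈ S₂ → u = w) ∧
      ∀ u ∈ S₁, ∀ v ∈ S₂, G.Adj u v → u = w ∨ v = w := by
  induction h with
  | single a =>
    have hw : w = a := hw
    subst hw
    exact ⟨{w}, {w}, single w, single w, by simp, by simp, by simp⟩
  | @cons a e f S hae h ha hu ih =>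
    by_cases hwa : w = a
    · subst hwa
      refine ⟨{w}, insert w S, single w, cons hae h ha hu, ?_, ?_, ?_⟩
      · ext; simp
      · simp
      · simp
    · obtain ⟨S₁, S₂, h1, h2, h3, h4, h5⟩ := ih (hw.resolve_left hwa)
      refine ⟨insert a S₁, S₂, cons hae h1 (fun h => ha (h3 ▸ Or.inl h))
        (fun v hv => hu v (h3 ▸ Or.inl hv)), h2, ?_, ?_, ?_⟩
      · rw [h3, Set.insert_union]
      · rintro u (rfl | hu') hu2
        · exact absurd (h3 ▸ Or.inr hu2) ha
        · exact h4 u hu' hu2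
      · rintro u (rfl | hu') v hv huv
        · have := hu v (h3 ▸ Or.inr hv) huv
          subst this
          exact Or.inr (h4 v h1.left_mem hv)
        · exact h5 u hu' v hv huv

theorem setConn (h : IndPath G a S b) : SetConn G S := by
  induction h with
  | single a =>
    intro A hA hne _
    exact (Set.subset_singleton_iff_eq.mp hA).resolve_left hne.ne_empty
  | @cons a e f S hae h ha hu ih =>
    intro A hA hne hcl
    have key : (A ∩ S).Nonempty := by
      obtain ⟨u, hu'⟩ := hne
      rcases hA hu' with rfl | h1
      · exact ⟨e, hcl u hu' e (Or.inr h.left_mem) hae, h.left_mem⟩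
      · exact ⟨u, hu', h1⟩
    have h2 := ih (A ∩ S) Set.inter_subset_right key
      (fun u hu v hv huv => ⟨hcl u hu.1 v (Or.inr hv) huv, hv⟩)
    have h3 : S ⊆ A := fun v hv => (h2.symm ▸ hv : v ∈ A ∩ S).1
    refine hA.antisymm ?_
    rintro v (rfl | hv)
    · exact hcl e (h3 h.left_mem) v (Or.inl rfl) hae.symm
    · exact h3 hv

/-- A connected subset of an induced path that contains both ends is the whole path. -/
theorem subset_of_ends (h : IndPath G a S b) (hD : D ⊆ S) (hc : SetConn G D) (ha : a ∈ D)
    (hb : b ∈ D) : S ⊆ D := by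
  intro w hw
  by_contra hwD
  obtain ⟨S₁, S₂, h1, h2, h3, h4, h5⟩ := h.split hw
  -- The missing vertex `w` separates the two halves of the path, so the part of `D` in the first
  -- half is closed in `D`.
  have := hc (D ∩ S₁) Set.inter_subset_left ⟨a, ha, h1.left_mem⟩ (fun u hu v hv huv => by
    refine ⟨hv, ?_⟩
    rcases (h3 ▸ hD hv : v ∈ S₁ ∪ S₂) with h6 | h6
    · exact h6
    · rcases h5 u hu.2 v h6 huv with rfl | rfl
      · exact absurd hu.1 hwD
      · exact absurd hv hwD)
  have hb1 : b ∈ S₁ := (this.symm ▸ hb : b ∈ D ∩ S₁).2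
  exact hwD (h4 b hb1 h2.right_mem ▸ hb)

/-- The first vertex of an induced path with a given property. -/
theorem exists_first (h : IndPath G a S b) (A : V → Prop) (hA : ∃ w ∈ S, A w) :
    ∃ x S₁ S₂, A x ∧ IndPath G a S₁ x ∧ IndPath G x S₂ b ∧ S = S₁ ∪ S₂ ∧
      (∀ u ∈ S₁, u ∈ S₂ → u = x) ∧
      (∀ u ∈ S₁, ∀ v ∈ S₂, G.Adj u v → u = x ∨ v = x) ∧ ∀ u ∈ S₁, A u → u = x := by
  induction h with
  | single a =>
    obtain ⟨w, rfl, hw⟩ := hA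
    exact ⟨w, {w}, {w}, hw, single w, single w, by simp, by simp, by simp, by simp⟩
  | @cons a e f S hae h ha hu ih =>
    by_cases haA : A a
    · refine ⟨a, {a}, insert a S, haA, single a, cons hae h ha hu, ?_, ?_, ?_, ?_⟩
      · ext; simp
      · simp
      · simp
      · simp
    · obtain ⟨x, S₁, S₂, h0, h1, h2, h3, h4, h5, h6⟩ := ih (by
        obtain ⟨w, rfl | hw, hwA⟩ := hA
        · exact absurd hwA haA
        · exact ⟨w, hw, hwA⟩)
      refine ⟨x, insert a S₁, S₂, h0, cons hae h1 (fun h => ha (h3 ▸ Or.inl h))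
        (fun v hv => hu v (h3 ▸ Or.inl hv)), h2, ?_, ?_, ?_, ?_⟩
      · rw [h3, Set.insert_union]
      · rintro u (rfl | hu') hu2
        · exact absurd (h3 ▸ Or.inr hu2) ha
        · exact h4 u hu' hu2
      · rintro u (rfl | hu') v hv huv
        · have := hu v (h3 ▸ Or.inr hv) huv
          subst this
          exact Or.inr (h4 v h1.left_mem hv)
        · exact h5 u hu' v hv huv
      · rintro u (rfl | hu') hA'
        · exact absurd hA' haA
        · exact h6 u hu' hA'

/-- An induced path is induced in every graph with the same adjacencies on its vertices. -/
theorem transfer {H : SimpleGraph V} (h : IndPath G a S b)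
    (e : ∀ u ∈ S, ∀ v ∈ S, G.Adj u v ↔ H.Adj u v) : IndPath H a S b := by
  induction h with
  | single a => exact single a
  | @cons a x f S hae h ha hu ih =>
    exact cons ((e a (Or.inl rfl) x (Or.inr h.left_mem)).1 hae)
      (ih fun u hu v hv => e u (Or.inr hu) v (Or.inr hv)) ha
      fun w hw h' => hu w hw ((e a (Or.inl rfl) w (Or.inr hw)).2 h')

theorem exists_walk (h : IndPath G a S b) :
    ∃ p : G.Walk a b, p.IsPath ∧ (∀ w, w ∈ p.support ↔ w ∈ S) ∧
      ∀ u ∈ S, ∀ v ∈ S, G.Adj u v → s(u, v) ∈ p.edges := by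
  induction h with
  | single a => exact ⟨.nil, by simp, by simp, by simp⟩
  | @cons a e f S hae h ha hu ih =>
    obtain ⟨p, hp, hs, hc⟩ := ih
    refine ⟨.cons hae p, ?_, ?_, ?_⟩
    · rw [SimpleGraph.Walk.cons_isPath_iff]
      exact ⟨hp, by rwa [hs]⟩
    · intro w; simp [hs]
    · rintro u (rfl | hu') v (rfl | hv') huv
      · exact absurd rfl huv.ne
      · rw [hu v hv' huv]; simp
      · rw [hu u hu' huv.symm, Sym2.eq_swap]; simp
      · simp [hc u hu' v hv' huv]

theorem of_walk (p : G.Walk a b) (hp : p.IsPath)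
    (hc : ∀ u ∈ p.support, ∀ v ∈ p.support, G.Adj u v → s(u, v) ∈ p.edges) :
    IndPath G a {w | w ∈ p.support} b := by
  induction p with
  | nil => exact (single _).of_eq (by ext; simp)
  | @cons u v w h p ih =>
    rw [SimpleGraph.Walk.cons_isPath_iff] at hp
    refine (cons h (ih hp.1 ?_) (by simpa using hp.2) ?_).of_eq (by ext; simp)
    · intro x hx y hy hxy
      have := hc x (by simp [hx]) y (by simp [hy]) hxy
      rw [SimpleGraph.Walk.edges_cons, List.mem_cons] at this
      refine this.resolve_left fun he => ?_
      rw [Sym2.eq_iff] at he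
      rcases he with ⟨rfl, -⟩ | ⟨-, rfl⟩
      · exact hp.2 hx
      · exact hp.2 hy
    · intro x hx hux
      have := hc u (by simp) x (by simpa using Or.inr hx) hux
      rw [SimpleGraph.Walk.edges_cons, List.mem_cons] at this
      rcases this with he | he
      · rw [Sym2.eq_iff] at he
        rcases he with ⟨-, h⟩ | ⟨h, h'⟩
        · exact h
        · exact h'.trans h
      · exact absurd (p.fst_mem_support_of_mem_edges he) hp.2

/-- Extending an induced path to the left by one vertex that sees it shortens it to an induced
path. -/
theorem exists_extend (h : IndPath G b S c) (haS : a ∉ S) (hw : ∃ w ∈ S, G.Adj a w) :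
    ∃ T ⊆ insert a S, IndPath G a T c := by
  obtain ⟨x, S₁, S₂, h0, h1, h2, h3, h4, h5, h6⟩ := h.reverse.exists_first (G.Adj a) hw
  refine ⟨insert a S₁, ?_, cons h0 h1.reverse (fun h => haS (h3 ▸ Or.inl h)) h6⟩
  exact Set.insert_subset_insert (h3 ▸ Set.subset_union_left)

end IndPath

/-! ### Connected sets and the induced paths they contain. -/

namespace SetConn

/-- The vertices of `E` joined to `b` by an induced path in `E` are closed under adjacency in `E`: a
neighbour of the start of such a path either lies on the path, which is then truncated, or extends a
shortcut of it. -/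
theorem exists_indPath (hE : SetConn G E) (ha : a ∈ E) (hb : b ∈ E) :
    ∃ S ⊆ E, IndPath G a S b := by
  have := hE {w | w ∈ E ∧ ∃ S ⊆ E, IndPath G w S b} (fun w hw => hw.1)
    ⟨b, hb, {b}, by simpa using hb, .single b⟩ (by
      rintro u ⟨hu, S, hS, hp⟩ v hv huv
      refine ⟨hv, ?_⟩
      by_cases hvS : v ∈ S
      · obtain ⟨S₁, S₂, h1, h2, h3, -⟩ := hp.split hvS
        exact ⟨S₂, (h3 ▸ Set.subset_union_right).trans hS, h2⟩
      · obtain ⟨T, hT, hp'⟩ := hp.exists_extend hvS ⟨u, hp.left_mem, huv.symm⟩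
        exact ⟨T, hT.trans (Set.insert_subset hv hS), hp'⟩)
  exact (this.symm ▸ ha : a ∈ {w | w ∈ E ∧ ∃ S ⊆ E, IndPath G w S b}).2

/-- In a connected set there is an induced path linking two properties, with no inner vertex
having either of them. -/
theorem exists_link (hE : SetConn G E) (A B : V → Prop) (hA : ∃ w ∈ E, A w) (hB : ∃ w ∈ E, B w) :
    ∃ u v S, S ⊆ E ∧ IndPath G u S v ∧ A u ∧ B v ∧ (∀ w ∈ S, A w → w = u) ∧
      ∀ w ∈ S, B w → w = v := by
  obtain ⟨a, ha, hAa⟩ := hA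
  obtain ⟨b, hb, hBb⟩ := hB
  obtain ⟨S, hS, hp⟩ := hE.exists_indPath ha hb
  obtain ⟨v, S₁, S₂, h0, h1, h2, h3, h4, h5, h6⟩ := hp.exists_first B ⟨b, hp.right_mem, hBb⟩
  obtain ⟨u, T₁, T₂, k0, k1, k2, k3, k4, k5, k6⟩ :=
    h1.reverse.exists_first A ⟨a, h1.left_mem, hAa⟩
  have hT : T₁ ⊆ S₁ := k3 ▸ Set.subset_union_left
  refine ⟨u, v, T₁, hT.trans ((h3 ▸ Set.subset_union_left).trans hS), k1.reverse, k0, h0,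
    k6, fun w hw => h6 w (hT hw)⟩

theorem union (hD : SetConn G D) (hE : SetConn G E) (ha : a ∈ D) (hb : b ∈ E)
    (hab : a = b ∨ G.Adj a b) : SetConn G (D ∪ E) := by
  intro A hA hne hcl
  have key : ∀ F, SetConn G F → F ⊆ D ∪ E → (A ∩ F).Nonempty → F ⊆ A := by
    intro F hF hFs hn v hv
    have := hF (A ∩ F) Set.inter_subset_right hn
      (fun u hu v hv huv => ⟨hcl u hu.1 v (hFs hv) huv, hv⟩)
    exact (this.symm ▸ hv : v ∈ A ∩ F).1
  have kD := key D hD Set.subset_union_left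
  have kE := key E hE Set.subset_union_right
  have h1 : a ∈ A → b ∈ A := fun h => by
    rcases hab with rfl | hab
    · exact h
    · exact hcl a h b (Or.inr hb) hab
  have h2 : b ∈ A → a ∈ A := fun h => by
    rcases hab with rfl | hab
    · exact h
    · exact hcl b h a (Or.inl ha) hab.symm
  obtain ⟨u, hu⟩ := hne
  refine hA.antisymm ?_
  rcases hA hu with h | h
  · have hDA := kD ⟨u, hu, h⟩
    exact Set.union_subset hDA (kE ⟨b, h1 (hDA ha), hb⟩)
  · have hEA := kE ⟨u, hu, h⟩
    exact Set.union_subset (kD ⟨a, h2 (hEA hb), ha⟩) hEA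

theorem singleton (a : V) : SetConn G {a} := (IndPath.single a).setConn

theorem insert (hD : SetConn G D) (hb : b ∈ D) (hab : G.Adj a b) : SetConn G (insert a D) := by
  rw [Set.insert_eq]
  exact (singleton a).union hD rfl hb (Or.inr hab)

end SetConn
end

/-! ### Solids in terms of vertex sets -/

/-- The set `C` induces a cycle in `G`. -/
def IsIndCycle {V : Type*} (G : SimpleGraph V) (C : Set V) : Prop :=
  ∃ z u v S, IndPath G u S v ∧ u ≠ v ∧ z ∉ S ∧ G.Adj z u ∧ G.Adj z v ∧
    (∀ w ∈ S, G.Adj z w → w = u ∨ w = v) ∧ C = insert z S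

/-- The set `S` induces a pyramid in `G`. -/
def IsPyramidSet {V : Type*} (G : SimpleGraph V) (S : Set V) : Prop :=
  ∃ (w : V) (C : Set V) (f : Fin 3 → V), IsIndCycle G C ∧ w ∉ C ∧ S = insert w C ∧
    Function.Injective f ∧ ∀ i, f i ∈ C ∧ G.Adj w (f i)

/-- The set `S` induces a trihedron in `G`. -/
def IsTrihedronSet {V : Type*} (G : SimpleGraph V) (S : Set V) : Prop :=
  ∃ (x y : V) (P : Fin 3 → Set V), x ≠ y ∧ ¬ G.Adj x y ∧ (∀ i, IndPath G x (P i) y) ∧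
    (∀ i j, i ≠ j → ∀ v ∈ P i, v ∈ P j → v = x ∨ v = y) ∧ S = ⋃ i, P i ∧
    ∀ u ∈ S, ∀ v ∈ S, G.Adj u v → ∃ i, u ∈ P i ∧ v ∈ P i

/-- The set `S` induces a stamp in `G`. -/
def IsStampSet {V : Type*} (G : SimpleGraph V) (S : Set V) : Prop :=
  ∃ (t : Fin 3 → V) (x : V) (P : Fin 3 → Set V), (∀ i j, i ≠ j → G.Adj (t i) (t j)) ∧
    (∀ i, t i ≠ x) ∧ (∀ i, IndPath G (t i) (P i) x) ∧
    (∀ i j, i ≠ j → ∀ v ∈ P i, v ∈ P j → v = x) ∧ S = ⋃ i, P i ∧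
    ∀ u ∈ S, ∀ v ∈ S, G.Adj u v → (∃ i j, u = t i ∧ v = t j) ∨ ∃ i, u ∈ P i ∧ v ∈ P i

/-- The set `S` induces a prism in `G`. -/
def IsPrismSet {V : Type*} (G : SimpleGraph V) (S : Set V) : Prop :=
  ∃ (a b : Fin 3 → V) (P : Fin 3 → Set V), (∀ i j, i ≠ j → G.Adj (a i) (a j)) ∧
    (∀ i j, i ≠ j → G.Adj (b i) (b j)) ∧ (∀ i j, a i ≠ b j) ∧
    (∀ i, IndPath G (a i) (P i) (b i)) ∧
    (∀ i j, i ≠ j → ∀ v ∈ P i, v ∉ P j) ∧ S = ⋃ i, P i ∧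
    ∀ u ∈ S, ∀ v ∈ S, G.Adj u v → (∃ i j, u = a i ∧ v = a j) ∨ (∃ i j, u = b i ∧ v = b j) ∨
      ∃ i, u ∈ P i ∧ v ∈ P i

section
variable {V W : Type*} {G : SimpleGraph V} {H : SimpleGraph W} {a b : V} {S T C : Set V}

theorem SimpleGraph.Walk.IsPath.length_eq_one {p : G.Walk a b} (hp : p.IsPath)
    (h : s(a, b) ∈ p.edges) : p.length = 1 := by
  cases p with
  | nil => simp at h
  | @cons _ v _ hv p =>
    rw [SimpleGraph.Walk.cons_isPath_iff] at hp
    rw [SimpleGraph.Walk.edges_cons, List.mem_cons] at h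
    rcases h with h | h
    · rw [Sym2.eq_iff] at h
      rcases h with ⟨-, rfl⟩ | ⟨rfl, -⟩
      · have := hp.1
        rw [SimpleGraph.Walk.isPath_iff_nil] at this
        simp [SimpleGraph.Walk.length_eq_zero_iff.2 this]
      · exact absurd p.start_mem_support hp.2
    · exact absurd (p.fst_mem_support_of_mem_edges h) hp.2

theorem SimpleGraph.Walk.IsPath.ne_of_length_pos {p : G.Walk a b} (hp : p.IsPath)
    (h : 1 ≤ p.length) : a ≠ b := by
  rintro rfl
  rw [SimpleGraph.Walk.isPath_iff_nil, ← SimpleGraph.Walk.length_eq_zero_iff] at hp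
  omega

theorem IndPath.map (f : H ↪g G) {x y : W} {T : Set W} (h : IndPath H x T y) :
    IndPath G (f x) (f '' T) (f y) := by
  induction h with
  | single a => exact (IndPath.single _).of_eq (by simp)
  | cons hab h ha hu ih =>
    refine (IndPath.cons (f.map_rel_iff.2 hab) ih (by simpa using ha) ?_).of_eq
      (Set.image_insert_eq).symm
    rintro _ ⟨w, hw, rfl⟩ e
    rw [hu w hw (f.map_rel_iff.1 e)]

theorem IndPath.induce (h : IndPath G a T b) (hT : T ⊆ S) :
    IndPath (G.induce S) ⟨a, hT h.left_mem⟩ (Subtype.val ⁻¹' T) ⟨b, hT h.right_mem⟩ := by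
  induction h with
  | single a => exact (IndPath.single _).of_eq (by ext; simp [Subtype.ext_iff])
  | @cons a x c T hab h ha hu ih =>
    refine (IndPath.cons (SimpleGraph.induce_adj.2 hab)
      (ih fun w hw => hT (Or.inr hw)) ha ?_).of_eq ?_
    · rintro ⟨w, hw⟩ hw' e
      exact Subtype.ext (hu w hw' e)
    · ext ⟨w, hw⟩
      simp [Subtype.ext_iff]

theorem IsIndCycle.map (f : H ↪g G) {C : Set W} (h : IsIndCycle H C) : IsIndCycle G (f '' C) := by
  obtain ⟨z, u, v, S, h1, h2, h3, h4, h5, h6, rfl⟩ := h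
  refine ⟨f z, f u, f v, f '' S, h1.map f, f.injective.ne h2, by simpa using h3,
    f.map_rel_iff.2 h4, f.map_rel_iff.2 h5, ?_, Set.image_insert_eq⟩
  rintro _ ⟨w, hw, rfl⟩ e
  exact (h6 w hw (f.map_rel_iff.1 e)).imp (congrArg f) (congrArg f)

theorem IsIndCycle.induce (h : IsIndCycle G C) (hC : C ⊆ S) :
    IsIndCycle (G.induce S) (Subtype.val ⁻¹' C) := by
  obtain ⟨z, u, v, T, h1, h2, h3, h4, h5, h6, rfl⟩ := h
  have hT : T ⊆ S := fun w hw => hC (Or.inr hw)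
  refine ⟨⟨z, hC (Or.inl rfl)⟩, ⟨u, hT h1.left_mem⟩, ⟨v, hT h1.right_mem⟩, Subtype.val ⁻¹' T,
    h1.induce hT, by simpa using h2, h3, h4, h5, ?_, ?_⟩
  · rintro ⟨w, hw⟩ hw' e
    simpa using h6 w hw' e
  · ext ⟨w, hw⟩
    simp [Subtype.ext_iff]

/-! #### From vertex sets to the solid graphs -/

theorem IsIndCycle.exists_walk (h : IsIndCycle G C) :
    ∃ (z : V) (c : G.Walk z z), c.IsCycle ∧ (∀ w, w ∈ c.support ↔ w ∈ C) ∧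
      ∀ u ∈ C, ∀ v ∈ C, G.Adj u v → s(u, v) ∈ c.edges := by
  obtain ⟨z, u, v, S, h1, h2, h3, h4, h5, h6, rfl⟩ := h
  obtain ⟨p, hp, hs, hc⟩ := h1.exists_walk
  refine ⟨z, .cons h4 (p.concat h5.symm), ?_, ?_, ?_⟩
  · rw [SimpleGraph.Walk.cons_isCycle_iff, SimpleGraph.Walk.concat_isPath_iff]
    refine ⟨⟨hp, by rwa [hs]⟩, ?_⟩
    rw [SimpleGraph.Walk.edges_concat, List.concat_eq_append, List.mem_append, List.mem_singleton]
    rintro (h | h)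
    · exact h3 ((hs z).1 (p.fst_mem_support_of_mem_edges h))
    · rw [Sym2.eq_iff] at h
      rcases h with ⟨h, -⟩ | ⟨-, h⟩
      · exact h5.ne h
      · exact h2 h
  · intro w
    simp [SimpleGraph.Walk.support_concat, hs, or_comm]
  · have key : ∀ w ∈ S, G.Adj z w → s(z, w) ∈ (SimpleGraph.Walk.cons h4 (p.concat h5.symm)).edges := by
      intro w hw e
      rcases h6 w hw e with rfl | rfl
      · simp
      · rw [Sym2.eq_swap]; simp [SimpleGraph.Walk.edges_concat]
    rintro a (rfl | ha) b (rfl | hb) e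
    · exact absurd rfl e.ne
    · exact key b hb e
    · rw [Sym2.eq_swap]; exact key a ha e.symm
    · simp [SimpleGraph.Walk.edges_concat, hc a ha b hb e]

theorem IsPyramidSet.isPyramid (h : IsPyramidSet H Set.univ) : IsPyramid H := by
  obtain ⟨w, C, f, hC, hw, hS, hf, hfw⟩ := h
  obtain ⟨z, c, hc, hs, he⟩ := hC.exists_walk
  refine ⟨w, z, c, hc, by rwa [hs], fun v => ?_, ?_, fun v v' hv hv' e => ?_⟩
  · rw [hs]; exact (hS ▸ Set.mem_univ v : v ∈ insert w C)
  · calc (3 : ℕ∞) = (Set.univ : Set (Fin 3)).encard := by simp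
      _ = (Set.range f).encard := by rw [← Set.image_univ, hf.encard_image]
      _ ≤ _ := Set.encard_le_encard (by rintro _ ⟨i, rfl⟩; exact (hfw i).2)
  · exact he v ((hS ▸ Set.mem_univ v : v ∈ insert w C).resolve_left hv) v'
      ((hS ▸ Set.mem_univ v' : v' ∈ insert w C).resolve_left hv') e

theorem IsTrihedronSet.isTrihedron (h : IsTrihedronSet H Set.univ) : IsTrihedron H := by
  obtain ⟨x, y, P, hxy, hn, hP, hd, hS, hc⟩ := h
  choose p hp hs he using fun i => (hP i).exists_walk
  refine ⟨x, y, p, hxy, fun i => ⟨hp i, ?_⟩, fun i j hij v hi hj => ?_, fun v => ?_, ?_⟩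
  · by_contra hlt
    have h1 : (p i).length ≠ 0 := fun h0 => hxy (SimpleGraph.Walk.eq_of_length_eq_zero h0)
    exact hn (SimpleGraph.Walk.adj_of_length_eq_one (by omega : (p i).length = 1))
  · exact hd i j hij v ((hs i v).1 hi) ((hs j v).1 hj)
  · obtain ⟨i, hi⟩ := Set.mem_iUnion.1 (hS ▸ Set.mem_univ v : v ∈ ⋃ i, P i)
    exact ⟨i, (hs i v).2 hi⟩
  · intro e
    induction e with | _ u v => ?_
    intro e
    obtain ⟨i, hu, hv⟩ := hc u trivial v trivial e
    exact ⟨i, he i u hu v hv e⟩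

theorem IsStampSet.isStamp (h : IsStampSet H Set.univ) : IsStamp H := by
  obtain ⟨t, x, P, ht, hx, hP, hd, hS, hc⟩ := h
  choose p hp hs he using fun i => (hP i).exists_walk
  refine ⟨t, x, p, ht, fun i => ⟨hp i, ?_⟩, fun i j hij v hi hj => ?_, fun v => ?_, ?_⟩
  · by_contra hlt
    exact hx i (SimpleGraph.Walk.eq_of_length_eq_zero (by omega : (p i).length = 0))
  · exact hd i j hij v ((hs i v).1 hi) ((hs j v).1 hj)
  · obtain ⟨i, hi⟩ := Set.mem_iUnion.1 (hS ▸ Set.mem_univ v : v ∈ ⋃ i, P i)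
    exact ⟨i, (hs i v).2 hi⟩
  · intro e
    induction e with | _ u v => ?_
    intro e
    rcases hc u trivial v trivial e with ⟨i, j, rfl, rfl⟩ | ⟨i, hu, hv⟩
    · exact Or.inl ⟨i, j, rfl⟩
    · exact Or.inr ⟨i, he i u hu v hv e⟩

theorem IsPrismSet.isPrism (h : IsPrismSet H Set.univ) : IsPrism H := by
  obtain ⟨a, b, P, ha, hb, hab, hP, hd, hS, hc⟩ := h
  choose p hp hs he using fun i => (hP i).exists_walk
  refine ⟨a, b, p, ha, hb, hab, hp, fun i j hij v hi hj => ?_, fun v => ?_, ?_⟩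
  · exact hd i j hij v ((hs i v).1 hi) ((hs j v).1 hj)
  · obtain ⟨i, hi⟩ := Set.mem_iUnion.1 (hS ▸ Set.mem_univ v : v ∈ ⋃ i, P i)
    exact ⟨i, (hs i v).2 hi⟩
  · intro e
    induction e with | _ u v => ?_
    intro e
    rcases hc u trivial v trivial e with ⟨i, j, rfl, rfl⟩ | ⟨i, j, rfl, rfl⟩ | ⟨i, hu, hv⟩
    · exact Or.inl ⟨i, j, rfl⟩
    · exact Or.inr (Or.inl ⟨i, j, rfl⟩)
    · exact Or.inr (Or.inr ⟨i, he i u hu v hv e⟩)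

theorem IsPyramidSet.mem_solids (h : IsPyramidSet G S) : S ∈ solids G := by
  obtain ⟨w, C, f, hC, hw, rfl, hf, hfw⟩ := h
  refine Or.inl (IsPyramidSet.isPyramid ⟨⟨w, Or.inl rfl⟩, _,
    fun i => ⟨f i, Or.inr (hfw i).1⟩, hC.induce (Set.subset_insert _ _), hw, ?_, ?_, hfw⟩)
  · ext ⟨v, hv⟩; simpa [Subtype.ext_iff] using hv
  · intro i j hij; exact hf (congrArg Subtype.val hij)

theorem IsTrihedronSet.mem_solids (h : IsTrihedronSet G S) : S ∈ solids G := by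
  obtain ⟨x, y, P, hxy, hn, hP, hd, rfl, hc⟩ := h
  have hPS : ∀ i, P i ⊆ ⋃ i, P i := Set.subset_iUnion P
  refine Or.inr (Or.inl (IsTrihedronSet.isTrihedron ⟨⟨x, hPS 0 (hP 0).left_mem⟩,
    ⟨y, hPS 0 (hP 0).right_mem⟩, fun i => Subtype.val ⁻¹' P i, by simpa using hxy, hn,
    fun i => (hP i).induce (hPS i), ?_, ?_, ?_⟩))
  · rintro i j hij ⟨v, hv⟩ hi hj
    simpa using hd i j hij v hi hj
  · ext ⟨v, hv⟩; simpa using hv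
  · rintro ⟨u, hu⟩ - ⟨v, hv⟩ - e
    exact hc u hu v hv e

theorem IsStampSet.mem_solids (h : IsStampSet G S) : S ∈ solids G := by
  obtain ⟨t, x, P, ht, hx, hP, hd, rfl, hc⟩ := h
  have hPS : ∀ i, P i ⊆ ⋃ i, P i := Set.subset_iUnion P
  refine Or.inr (Or.inr (Or.inl (IsStampSet.isStamp ⟨fun i => ⟨t i, hPS i (hP i).left_mem⟩,
    ⟨x, hPS 0 (hP 0).right_mem⟩, fun i => Subtype.val ⁻¹' P i, ht, fun i => by simpa using hx i,
    fun i => (hP i).induce (hPS i), ?_, ?_, ?_⟩)))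
  · rintro i j hij ⟨v, hv⟩ hi hj
    simpa using hd i j hij v hi hj
  · ext ⟨v, hv⟩; simpa using hv
  · rintro ⟨u, hu⟩ - ⟨v, hv⟩ - e
    simpa using hc u hu v hv e

theorem IsPrismSet.mem_solids (h : IsPrismSet G S) : S ∈ solids G := by
  obtain ⟨a, b, P, ha, hb, hab, hP, hd, rfl, hc⟩ := h
  have hPS : ∀ i, P i ⊆ ⋃ i, P i := Set.subset_iUnion P
  refine Or.inr (Or.inr (Or.inr (IsPrismSet.isPrism ⟨fun i => ⟨a i, hPS i (hP i).left_mem⟩,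
    fun i => ⟨b i, hPS i (hP i).right_mem⟩, fun i => Subtype.val ⁻¹' P i, ha, hb,
    fun i j => by simpa using hab i j,
    fun i => (hP i).induce (hPS i), ?_, ?_, ?_⟩)))
  · rintro i j hij ⟨v, hv⟩ hi hj
    exact hd i j hij v hi hj
  · ext ⟨v, hv⟩; simpa using hv
  · rintro ⟨u, hu⟩ - ⟨v, hv⟩ - e
    simpa using hc u hu v hv e

/-! #### From the solid graphs to vertex sets -/

theorem IsIndCycle.of_walk {z : V} (c : G.Walk z z) (hc : c.IsCycle)
    (he : ∀ u ∈ c.support, ∀ v ∈ c.support, G.Adj u v → s(u, v) ∈ c.edges) :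
    IsIndCycle G {w | w ∈ c.support} := by
  cases c with
  | nil => simp at hc
  | @cons _ u _ h p =>
    rw [SimpleGraph.Walk.cons_isCycle_iff] at hc
    -- Reversing the rest of the cycle exposes its last edge to `cases`; removing both edges at `z`
    -- leaves the induced path required by `IsIndCycle`.
    obtain ⟨q, hq⟩ : ∃ q, q = p.reverse := ⟨_, rfl⟩
    have hpq : p = q.reverse := by simp [hq]
    subst hpq
    cases q with
    | nil => exact absurd rfl h.ne
    | @cons _ v _ h' q =>
      have h1 := hc.1
      rw [SimpleGraph.Walk.isPath_reverse_iff, SimpleGraph.Walk.cons_isPath_iff] at h1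
      have h2 := hc.2
      simp only [SimpleGraph.Walk.edges_reverse, SimpleGraph.Walk.edges_cons, List.mem_reverse,
        List.mem_cons, not_or] at h2
      simp only [SimpleGraph.Walk.support_cons, SimpleGraph.Walk.support_reverse,
        SimpleGraph.Walk.edges_cons, SimpleGraph.Walk.edges_reverse, List.mem_cons,
        List.mem_reverse] at he
      refine ⟨z, v, u, {w | w ∈ q.support}, IndPath.of_walk q h1.1 ?_, ?_, h1.2, h', h, ?_, ?_⟩
      · intro x hx y hy e
        rcases he x (by simp [hx]) y (by simp [hy]) e with h | h | h
        · rw [Sym2.eq_iff] at h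
          rcases h with ⟨rfl, -⟩ | ⟨-, rfl⟩
          · exact absurd hx h1.2
          · exact absurd hy h1.2
        · rw [Sym2.eq_iff] at h
          rcases h with ⟨rfl, -⟩ | ⟨-, rfl⟩
          · exact absurd hx h1.2
          · exact absurd hy h1.2
        · exact h
      · rintro rfl; exact h2.1 rfl
      · intro w hw e
        have hw : w ∈ q.support := hw
        rcases he z (by simp) w (by simp [hw]) e with h | h | h
        · rw [Sym2.eq_iff] at h
          rcases h with ⟨-, h⟩ | ⟨h, h'⟩
          · exact Or.inr h
          · exact absurd h'.symm e.ne
        · rw [Sym2.eq_iff] at h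
          rcases h with ⟨-, h⟩ | ⟨h, h'⟩
          · exact Or.inl h
          · exact absurd h'.symm e.ne
        · exact absurd (q.fst_mem_support_of_mem_edges h) h1.2
      · ext w
        simp only [SimpleGraph.Walk.support_cons, SimpleGraph.Walk.support_reverse,
          List.mem_cons, List.mem_reverse, Set.mem_ofPred_eq, Set.mem_insert_iff]
        tauto

theorem IsPyramid.isPyramidSet (h : IsPyramid H) : IsPyramidSet H Set.univ := by
  obtain ⟨w, u, c, hc, hw, hS, h3, he⟩ := h
  have hS' : ∀ v ∈ c.support, v ≠ w := by rintro v hv rfl; exact hw hv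
  have : Nonempty W := ⟨w⟩
  have : Nonempty (Fin 3 ↪ H.neighborSet w) := by
    have : (Set.univ : Set (Fin 3)).encard ≤ (H.neighborSet w).encard := by simpa using h3
    obtain ⟨f, hf, hf'⟩ := Set.Finite.exists_injOn_of_encard_le (Set.finite_univ) this
    exact ⟨⟨fun i => ⟨f i, hf (Set.mem_univ i)⟩, fun i j hij =>
      hf' (Set.mem_univ _) (Set.mem_univ _) (by simpa using hij)⟩⟩
  obtain ⟨f⟩ := this
  refine ⟨w, {v | v ∈ c.support}, fun i => f i,
    .of_walk c hc fun a ha b hb e => he a b (hS' a ha) (hS' b hb) e, hw, ?_, ?_, fun i => ⟨?_, ?_⟩⟩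
  · ext v; simpa using hS v
  · intro i j hij; exact f.injective (Subtype.ext hij)
  · refine (hS (f i)).resolve_left ?_
    exact (f i).2.ne'
  · exact (f i).2

/-- The bound on the lengths becomes nonadjacency of `x` and `y`: an edge `xy` would lie on one of
the paths and would then be that whole path. This also makes each path induced, since an edge
between two vertices of one path that lay on another would have to be `xy`. -/
theorem IsTrihedron.isTrihedronSet (h : IsTrihedron H) : IsTrihedronSet H Set.univ := by
  obtain ⟨x, y, p, hxy, hp, hd, hS, hc⟩ := h
  have hno : ∀ i, s(x, y) ∉ (p i).edges := fun i hi => by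
    have := (hp i).1.length_eq_one hi
    have := (hp i).2
    omega
  refine ⟨x, y, fun i => {w | w ∈ (p i).support}, hxy, fun e => ?_, fun i => .of_walk _ (hp i).1 ?_,
    hd, ?_, fun u _ v _ e => ?_⟩
  · obtain ⟨i, hi⟩ := hc s(x, y) e
    exact hno i hi
  · intro u hu v hv e
    obtain ⟨j, hj⟩ := hc s(u, v) e
    by_cases hij : i = j
    · exact hij ▸ hj
    · have h1 := hd i j hij u hu ((p j).fst_mem_support_of_mem_edges hj)
      have h2 := hd i j hij v hv ((p j).snd_mem_support_of_mem_edges hj)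
      rcases h1 with rfl | rfl <;> rcases h2 with rfl | rfl
      · exact absurd rfl e.ne
      · exact absurd hj (hno j)
      · exact absurd (Sym2.eq_swap ▸ hj) (hno j)
      · exact absurd rfl e.ne
  · ext v; simpa using hS v
  · obtain ⟨j, hj⟩ := hc s(u, v) e
    exact ⟨j, (p j).fst_mem_support_of_mem_edges hj, (p j).snd_mem_support_of_mem_edges hj⟩

theorem IsStamp.isStampSet (h : IsStamp H) : IsStampSet H Set.univ := by
  obtain ⟨t, x, p, ht, hp, hd, hS, hc⟩ := h
  have hx : ∀ i, t i ≠ x := fun i => (hp i).1.ne_of_length_pos (hp i).2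
  have htm : ∀ i j, t i ∈ (p j).support → i = j := fun i j h => by
    by_contra hij
    exact hx i (hd i j hij _ (p i).start_mem_support h)
  refine ⟨t, x, fun i => {w | w ∈ (p i).support}, ht, hx, fun i => .of_walk _ (hp i).1 ?_,
    hd, ?_, fun u _ v _ e => ?_⟩
  · intro u hu v hv e
    rcases hc s(u, v) e with ⟨k, l, he⟩ | ⟨j, hj⟩
    · rw [Sym2.eq_iff] at he
      rcases he with ⟨rfl, rfl⟩ | ⟨rfl, rfl⟩ <;>
      · rw [htm _ _ hu, htm _ _ hv] at e
        exact absurd rfl e.ne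
    · by_cases hij : i = j
      · exact hij ▸ hj
      · have h1 := hd i j hij u hu ((p j).fst_mem_support_of_mem_edges hj)
        have h2 := hd i j hij v hv ((p j).snd_mem_support_of_mem_edges hj)
        rw [h1, h2] at e
        exact absurd rfl e.ne
  · ext v; simpa using hS v
  · rcases hc s(u, v) e with ⟨k, l, he⟩ | ⟨j, hj⟩
    · rw [Sym2.eq_iff] at he
      rcases he with ⟨rfl, rfl⟩ | ⟨rfl, rfl⟩
      · exact Or.inl ⟨_, _, rfl, rfl⟩
      · exact Or.inl ⟨_, _, rfl, rfl⟩
    · exact Or.inr ⟨j, (p j).fst_mem_support_of_mem_edges hj,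
        (p j).snd_mem_support_of_mem_edges hj⟩

theorem IsPrism.isPrismSet (h : IsPrism H) : IsPrismSet H Set.univ := by
  obtain ⟨a, b, p, ha, hb, hab, hp, hd, hS, hc⟩ := h
  have key : ∀ i j v, v ∈ (p i).support → v ∈ (p j).support → i = j := fun i j v h h' => by
    by_contra hij
    exact hd i j hij v h h'
  refine ⟨a, b, fun i => {w | w ∈ (p i).support}, ha, hb, hab, fun i => .of_walk _ (hp i) ?_,
    hd, ?_, fun u _ v _ e => ?_⟩
  · intro u hu v hv e
    rcases hc s(u, v) e with ⟨k, l, he⟩ | ⟨k, l, he⟩ | ⟨j, hj⟩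
    · rw [Sym2.eq_iff] at he
      rcases he with ⟨rfl, rfl⟩ | ⟨rfl, rfl⟩ <;>
      · rw [key _ _ _ (p _).start_mem_support hu, key _ _ _ (p _).start_mem_support hv] at e
        exact absurd rfl e.ne
    · rw [Sym2.eq_iff] at he
      rcases he with ⟨rfl, rfl⟩ | ⟨rfl, rfl⟩ <;>
      · rw [key _ _ _ (p _).end_mem_support hu, key _ _ _ (p _).end_mem_support hv] at e
        exact absurd rfl e.ne
    · rwa [key i j u hu ((p j).fst_mem_support_of_mem_edges hj)]
  · ext v; simpa using hS v
  · rcases hc s(u, v) e with ⟨k, l, he⟩ | ⟨k, l, he⟩ | ⟨j, hj⟩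
    · rw [Sym2.eq_iff] at he
      rcases he with ⟨rfl, rfl⟩ | ⟨rfl, rfl⟩
      · exact Or.inl ⟨_, _, rfl, rfl⟩
      · exact Or.inl ⟨_, _, rfl, rfl⟩
    · rw [Sym2.eq_iff] at he
      rcases he with ⟨rfl, rfl⟩ | ⟨rfl, rfl⟩
      · exact Or.inr (Or.inl ⟨_, _, rfl, rfl⟩)
      · exact Or.inr (Or.inl ⟨_, _, rfl, rfl⟩)
    · exact Or.inr (Or.inr ⟨j, (p j).fst_mem_support_of_mem_edges hj,
        (p j).snd_mem_support_of_mem_edges hj⟩)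

theorem image_iUnion_fin {f : W → V} {P : Fin 3 → Set W} (h : Set.univ = ⋃ i, P i) :
    Set.range f = ⋃ i, f '' P i := by
  rw [← Set.image_univ, h, Set.image_iUnion]

theorem IsPyramidSet.map (f : H ↪g G) (h : IsPyramidSet H Set.univ) :
    IsPyramidSet G (Set.range f) := by
  obtain ⟨w, C, g, hC, hw, hS, hg, hgw⟩ := h
  refine ⟨f w, f '' C, f ∘ g, hC.map f, by simpa using hw, ?_, f.injective.comp hg,
    fun i => ⟨⟨_, (hgw i).1, rfl⟩, f.map_rel_iff.2 (hgw i).2⟩⟩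
  rw [← Set.image_univ, hS, Set.image_insert_eq]

theorem IsTrihedronSet.map (f : H ↪g G) (h : IsTrihedronSet H Set.univ) :
    IsTrihedronSet G (Set.range f) := by
  obtain ⟨x, y, P, hxy, hn, hP, hd, hS, hc⟩ := h
  refine ⟨f x, f y, fun i => f '' P i, f.injective.ne hxy, fun e => hn (f.map_rel_iff.1 e),
    fun i => (hP i).map f, ?_, image_iUnion_fin hS, ?_⟩
  · rintro i j hij _ ⟨v, hv, rfl⟩ hj
    rw [f.injective.mem_set_image] at hj
    exact (hd i j hij v hv hj).imp (congrArg f) (congrArg f)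
  · rintro _ ⟨u, rfl⟩ _ ⟨v, rfl⟩ e
    obtain ⟨i, hu, hv⟩ := hc u trivial v trivial (f.map_rel_iff.1 e)
    exact ⟨i, ⟨u, hu, rfl⟩, ⟨v, hv, rfl⟩⟩

theorem IsStampSet.map (f : H ↪g G) (h : IsStampSet H Set.univ) :
    IsStampSet G (Set.range f) := by
  obtain ⟨t, x, P, ht, hx, hP, hd, hS, hc⟩ := h
  refine ⟨f ∘ t, f x, fun i => f '' P i, fun i j hij => f.map_rel_iff.2 (ht i j hij),
    fun i => f.injective.ne (hx i), fun i => (hP i).map f, ?_, image_iUnion_fin hS, ?_⟩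
  · rintro i j hij _ ⟨v, hv, rfl⟩ hj
    rw [f.injective.mem_set_image] at hj
    exact congrArg f (hd i j hij v hv hj)
  · rintro _ ⟨u, rfl⟩ _ ⟨v, rfl⟩ e
    rcases hc u trivial v trivial (f.map_rel_iff.1 e) with ⟨i, j, rfl, rfl⟩ | ⟨i, hu, hv⟩
    · exact Or.inl ⟨i, j, rfl, rfl⟩
    · exact Or.inr ⟨i, ⟨u, hu, rfl⟩, ⟨v, hv, rfl⟩⟩

theorem IsPrismSet.map (f : H ↪g G) (h : IsPrismSet H Set.univ) :
    IsPrismSet G (Set.range f) := by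
  obtain ⟨a, b, P, ha, hb, hab, hP, hd, hS, hc⟩ := h
  refine ⟨f ∘ a, f ∘ b, fun i => f '' P i, fun i j hij => f.map_rel_iff.2 (ha i j hij),
    fun i j hij => f.map_rel_iff.2 (hb i j hij),
    fun i j => f.injective.ne (hab i j), fun i => (hP i).map f, ?_, image_iUnion_fin hS, ?_⟩
  · rintro i j hij _ ⟨v, hv, rfl⟩ hj
    rw [f.injective.mem_set_image] at hj
    exact hd i j hij v hv hj
  · rintro _ ⟨u, rfl⟩ _ ⟨v, rfl⟩ e
    rcases hc u trivial v trivial (f.map_rel_iff.1 e) with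
      ⟨i, j, rfl, rfl⟩ | ⟨i, j, rfl, rfl⟩ | ⟨i, hu, hv⟩
    · exact Or.inl ⟨i, j, rfl, rfl⟩
    · exact Or.inr (Or.inl ⟨i, j, rfl, rfl⟩)
    · exact Or.inr (Or.inr ⟨i, ⟨u, hu, rfl⟩, ⟨v, hv, rfl⟩⟩)

/-- This removes the induced subgraph as a separate type: from here on solids are built and
dissected as vertex sets of `G`. -/
theorem mem_solids_iff : S ∈ solids G ↔
    IsPyramidSet G S ∨ IsTrihedronSet G S ∨ IsStampSet G S ∨ IsPrismSet G S := by
  constructor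
  · have e : Set.range (SimpleGraph.Embedding.induce (G := G) S) = S := Subtype.range_val
    rintro (h | h | h | h)
    · exact Or.inl (e ▸ h.isPyramidSet.map (SimpleGraph.Embedding.induce S))
    · exact Or.inr (Or.inl (e ▸ h.isTrihedronSet.map (SimpleGraph.Embedding.induce S)))
    · exact Or.inr (Or.inr (Or.inl (e ▸ h.isStampSet.map (SimpleGraph.Embedding.induce S))))
    · exact Or.inr (Or.inr (Or.inr (e ▸ h.isPrismSet.map (SimpleGraph.Embedding.induce S))))
  · rintro (h | h | h | h)
    exacts [h.mem_solids, h.mem_solids, h.mem_solids, h.mem_solids]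
end

/-! ### Assembling solids from induced paths -/

section
variable {V : Type*} {G : SimpleGraph V} {a b c d x y z w : V} {S T C P Q R : Set V}

theorem IndPath.interior (h : IndPath G x Q y) (hxy : x ≠ y) (hn : ¬ G.Adj x y) :
    ∃ u v I, IndPath G u I v ∧ G.Adj x u ∧ G.Adj y v ∧ (∀ w ∈ I, G.Adj x w → w = u) ∧
      (∀ w ∈ I, G.Adj y w → w = v) ∧ x ∉ I ∧ y ∉ I ∧ Q = insert x (insert y I) := by
  obtain ⟨u, S, h1, h2, h3, h4, rfl⟩ := h.uncons hxy
  have huy : y ≠ u := by rintro rfl; exact hn h2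
  obtain ⟨v, I, k1, k2, k3, k4, rfl⟩ := h1.reverse.uncons huy
  exact ⟨u, v, I, k1.reverse, h2, k2, fun w hw => h4 w (Or.inr hw), k4,
    fun h => h3 (Or.inr h), k3, rfl⟩

/-- Adjacent vertices of an induced path are consecutive. -/
theorem IndPath.split_edge (h : IndPath G a S b) (hx : x ∈ S) (hy : y ∈ S) (hxy : G.Adj x y) :
    ∃ S₁ S₂ x' y', ((x' = x ∧ y' = y) ∨ (x' = y ∧ y' = x)) ∧ IndPath G a S₁ x' ∧
      IndPath G y' S₂ b ∧ S = S₁ ∪ S₂ ∧ (∀ u ∈ S₁, u ∉ S₂) ∧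
      ∀ u ∈ S₁, ∀ v ∈ S₂, G.Adj u v → u = x' ∧ v = y' := by
  obtain ⟨S₁, S₂, h1, h2, rfl, h4, h5⟩ := h.split hx
  rcases hy with hy | hy
  · have hxb : x ≠ a := by
      rintro rfl
      rw [h1.eq_singleton] at hy
      exact hxy.ne hy.symm
    obtain ⟨v, I, k1, k2, k3, k4, rfl⟩ := h1.reverse.uncons hxb
    have : y = v := k4 y (hy.resolve_left hxy.ne') hxy
    subst this
    refine ⟨I, S₂, y, x, Or.inr ⟨rfl, rfl⟩, k1.reverse, h2, ?_, ?_, ?_⟩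
    · have := h2.left_mem
      grind
    · grind
    · grind [SimpleGraph.Adj.symm]
  · have hxb : x ≠ b := by
      rintro rfl
      rw [h2.eq_singleton] at hy
      exact hxy.ne hy.symm
    obtain ⟨v, I, k1, k2, k3, k4, rfl⟩ := h2.uncons hxb
    have : y = v := k4 y (hy.resolve_left hxy.ne') hxy
    subst this
    refine ⟨S₁, I, x, y, Or.inl ⟨rfl, rfl⟩, h1, k1, ?_, ?_, ?_⟩
    · have := h1.right_mem
      grind
    · grind
    · grind [SimpleGraph.Adj.symm]

theorem IsIndCycle.of_join (hP : IndPath G a P b) (hQ : IndPath G c Q d) (hab : a ≠ b)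
    (hac : G.Adj a c) (hbd : G.Adj b d) (hd : ∀ w ∈ P, w ∉ Q)
    (hx : ∀ u ∈ P, ∀ v ∈ Q, G.Adj u v → (u = a ∧ v = c) ∨ (u = b ∧ v = d)) :
    IsIndCycle G (P ∪ Q) := by
  obtain ⟨a', P', h1, h2, h3, h4, rfl⟩ := hP.uncons hab
  have hc := hQ.left_mem
  have ha' := h1.left_mem
  refine ⟨a, a', c, P' ∪ Q, h1.join hbd hQ.reverse ?_ ?_, ?_, ?_, h2, hac, ?_, ?_⟩
  all_goals grind

/-- As the ends are nonadjacent, `Q` has inner vertices; these form an induced path that closes `P`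
to a cycle. -/
theorem IsIndCycle.of_arcs (hP : IndPath G x P y) (hQ : IndPath G x Q y) (hxy : x ≠ y)
    (hn : ¬ G.Adj x y) (hd : ∀ w ∈ P, w ∈ Q → w = x ∨ w = y)
    (hx : ∀ u ∈ P, ∀ v ∈ Q, G.Adj u v → u = x ∨ u = y ∨ v = x ∨ v = y) :
    IsIndCycle G (P ∪ Q) := by
  obtain ⟨u, v, I, h1, h2, h3, h4, h5, h6, h7, rfl⟩ := hQ.interior hxy hn
  have := IsIndCycle.of_join hP h1 hxy h2 h3 (by grind) (by grind)
  have hx := hP.left_mem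
  have hy := hP.right_mem
  convert this using 1
  grind

/-- A cycle may be opened at any of its vertices. -/
theorem IsIndCycle.rotate (h : IsIndCycle G C) (hx : x ∈ C) :
    ∃ u v S, IndPath G u S v ∧ u ≠ v ∧ x ∉ S ∧ G.Adj x u ∧ G.Adj x v ∧
    (∀ w ∈ S, G.Adj x w → w = u ∨ w = v) ∧ C = insert x S := by
  obtain ⟨z, u, v, S, h1, h2, h3, h4, h5, h6, rfl⟩ := h
  rcases hx with rfl | hx
  · exact ⟨u, v, S, h1, h2, h3, h4, h5, h6, rfl⟩
  -- The case that the new opening vertex is a neighbour of the old one; it is used for either end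
  -- of the path.
  have key : ∀ v, IndPath G x S v → x ≠ v → G.Adj z x → G.Adj z v →
      (∀ w ∈ S, G.Adj z w → w = x ∨ w = v) → ∃ u v T, IndPath G u T v ∧ u ≠ v ∧ x ∉ T ∧
      G.Adj x u ∧ G.Adj x v ∧ (∀ w ∈ T, G.Adj x w → w = u ∨ w = v) ∧
      insert z S = insert x T := by
    intro v h1 h2 h4 h5 h6
    obtain ⟨u', S', k1, k2, k3, k4, rfl⟩ := h1.uncons h2
    have hu' := k1.left_mem
    refine ⟨u', z, S' ∪ {z}, k1.join h5.symm (.single z) ?_ ?_, ?_, ?_, k2, h4.symm, ?_, ?_⟩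
    all_goals grind [SimpleGraph.Adj.symm, SimpleGraph.Adj.ne]
  by_cases hxu : x = u
  · subst hxu
    exact key v h1 h2 h4 h5 h6
  by_cases hxv : x = v
  · subst hxv
    exact key u h1.reverse h2.symm h5 h4 fun w hw e => (h6 w hw e).symm
  obtain ⟨S₁, S₂, k1, k2, rfl, k4, k5⟩ := h1.split hx
  obtain ⟨u', T₁, l1, l2, l3, l4, rfl⟩ := k1.reverse.uncons hxu
  obtain ⟨v', T₂, m1, m2, m3, m4, rfl⟩ := k2.uncons hxv
  have hu := l1.right_mem
  have hv := m1.right_mem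
  have hu' := l1.left_mem
  have hv' := m1.left_mem
  -- Away from `z`, the opened cycle runs from one side of `x` to one end of the old path, through
  -- `z`, and back from the other end to the other side of `x`.
  have j1 := l1.join h4.symm (.single z) (by grind) (by grind [SimpleGraph.Adj.symm])
  have j2 := j1.join h5 m1.reverse (by grind) (by grind [SimpleGraph.Adj.symm])
  refine ⟨u', v', _, j2, ?_, ?_, l2, m2, ?_, ?_⟩
  all_goals grind [SimpleGraph.Adj.symm, SimpleGraph.Adj.ne]

theorem IsIndCycle.arcs (h : IsIndCycle G C) (hx : x ∈ C) (hy : y ∈ C) (hxy : x ≠ y)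
    (hn : ¬ G.Adj x y) : ∃ P Q, IndPath G x P y ∧ IndPath G x Q y ∧ C = P ∪ Q ∧
      (∀ w ∈ P, w ∈ Q → w = x ∨ w = y) ∧
      ∀ u ∈ P, ∀ v ∈ Q, G.Adj u v → u = x ∨ u = y ∨ v = x ∨ v = y := by
  obtain ⟨u, v, S, h1, h2, h3, h4, h5, h6, rfl⟩ := h.rotate hx
  have hyS := hy.resolve_left hxy.symm
  obtain ⟨S₁, S₂, k1, k2, rfl, k4, k5⟩ := h1.split hyS
  have hu := k1.left_mem
  have hv := k2.right_mem
  refine ⟨_, _, .cons h4 k1 ?_ ?_, .cons h5 k2.reverse ?_ ?_, ?_, ?_, ?_⟩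
  all_goals grind [SimpleGraph.Adj.symm, SimpleGraph.Adj.ne]

/-- An induced cycle with a triangle is a triangle. -/
theorem IsIndCycle.eq_of_triangle (h : IsIndCycle G C) (ha : a ∈ C) (hb : b ∈ C) (hc : c ∈ C)
    (hab : G.Adj a b) (hac : G.Adj a c) (hbc : G.Adj b c) : ∀ w ∈ C, w = a ∨ w = b ∨ w = c := by
  obtain ⟨u, v, S, h1, h2, h3, h4, h5, h6, rfl⟩ := h.rotate ha
  obtain ⟨u', S', k1, k2, k3, k4, rfl⟩ := h1.uncons h2
  have huv : G.Adj u v := by grind [SimpleGraph.Adj.symm, SimpleGraph.Adj.ne]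
  have : u' = v := by
    have := k1.right_mem
    grind
  subst this
  have := k1.eq_singleton
  grind [SimpleGraph.Adj.symm, SimpleGraph.Adj.ne]

theorem pyramid_mem_solids (hC : IsIndCycle G C) (hw : w ∉ C) (hx : x ∈ C) (hy : y ∈ C)
    (hz : z ∈ C) (hxy : x ≠ y) (hxz : x ≠ z) (hyz : y ≠ z) (hwx : G.Adj w x) (hwy : G.Adj w y)
    (hwz : G.Adj w z) (hS : S = insert w C) : S ∈ solids G := by
  refine IsPyramidSet.mem_solids ⟨w, C, ![x, y, z], hC, hw, hS, ?_, ?_⟩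
  · intro i j hij
    fin_cases i <;> fin_cases j <;> simp_all
  · intro i
    fin_cases i <;> simp_all

theorem iUnion_fin_three : ⋃ i, ![P, Q, R] i = P ∪ Q ∪ R := by
  ext v
  simp [Fin.exists_fin_succ, or_assoc]

theorem trihedron_mem_solids (hxy : x ≠ y) (hn : ¬ G.Adj x y) (hP : IndPath G x P y)
    (hQ : IndPath G x Q y) (hR : IndPath G x R y)
    (hPQ : ∀ w ∈ P, w ∈ Q → w = x ∨ w = y) (hPR : ∀ w ∈ P, w ∈ R → w = x ∨ w = y)
    (hQR : ∀ w ∈ Q, w ∈ R → w = x ∨ w = y)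
    (ePQ : ∀ u ∈ P, ∀ v ∈ Q, G.Adj u v → u = x ∨ u = y ∨ v = x ∨ v = y)
    (ePR : ∀ u ∈ P, ∀ v ∈ R, G.Adj u v → u = x ∨ u = y ∨ v = x ∨ v = y)
    (eQR : ∀ u ∈ Q, ∀ v ∈ R, G.Adj u v → u = x ∨ u = y ∨ v = x ∨ v = y)
    (hS : S = P ∪ Q ∪ R) : S ∈ solids G := by
  refine IsTrihedronSet.mem_solids ⟨x, y, ![P, Q, R], hxy, hn, ?_, ?_, ?_, ?_⟩
  · intro i
    fin_cases i <;> assumption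
  · intro i j hij
    fin_cases i <;> fin_cases j <;> simp at hij ⊢ <;> grind
  · rw [iUnion_fin_three, hS]
  · have := hP.left_mem
    have := hQ.left_mem
    have := hR.left_mem
    have := hP.right_mem
    have := hQ.right_mem
    have := hR.right_mem
    intro u hu v hv e
    have e' := e.symm
    simp only [Fin.exists_fin_succ, Matrix.cons_val_zero,
      Matrix.cons_val_succ, IsEmpty.exists_iff, or_false]
    grind

theorem stamp_mem_solids (hab : G.Adj a b) (hac : G.Adj a c) (hbc : G.Adj b c)
    (hax : a ≠ x) (hbx : b ≠ x) (hcx : c ≠ x) (hP : IndPath G a P x)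
    (hQ : IndPath G b Q x) (hR : IndPath G c R x)
    (hPQ : ∀ w ∈ P, w ∈ Q → w = x) (hPR : ∀ w ∈ P, w ∈ R → w = x)
    (hQR : ∀ w ∈ Q, w ∈ R → w = x)
    (ePQ : ∀ u ∈ P, ∀ v ∈ Q, G.Adj u v → (u = a ∧ v = b) ∨ u = x ∨ v = x)
    (ePR : ∀ u ∈ P, ∀ v ∈ R, G.Adj u v → (u = a ∧ v = c) ∨ u = x ∨ v = x)
    (eQR : ∀ u ∈ Q, ∀ v ∈ R, G.Adj u v → (u = b ∧ v = c) ∨ u = x ∨ v = x)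
    (hS : S = P ∪ Q ∪ R) : S ∈ solids G := by
  refine IsStampSet.mem_solids ⟨![a, b, c], x, ![P, Q, R], ?_, ?_, ?_, ?_, ?_, ?_⟩
  · intro i j hij
    fin_cases i <;> fin_cases j <;> simp_all [SimpleGraph.adj_comm]
  · intro i
    fin_cases i <;> assumption
  · intro i
    fin_cases i <;> assumption
  · intro i j hij
    fin_cases i <;> fin_cases j <;> simp at hij ⊢ <;> grind
  · rw [iUnion_fin_three, hS]
  · have := hP.right_mem
    have := hQ.right_mem
    have := hR.right_mem
    intro u hu v hv e
    have e' := e.symm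
    simp only [Fin.exists_fin_succ, Matrix.cons_val_zero,
      Matrix.cons_val_succ, IsEmpty.exists_iff, or_false]
    grind

theorem prism_mem_solids {a' b' c' : V} (hab : G.Adj a b) (hac : G.Adj a c) (hbc : G.Adj b c)
    (hab' : G.Adj a' b') (hac' : G.Adj a' c') (hbc' : G.Adj b' c')
    (haa : a ≠ a') (hbb : b ≠ b') (hcc : c ≠ c') (hP : IndPath G a P a')
    (hQ : IndPath G b Q b') (hR : IndPath G c R c')
    (hPQ : ∀ w ∈ P, w ∉ Q) (hPR : ∀ w ∈ P, w ∉ R) (hQR : ∀ w ∈ Q, w ∉ R)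
    (ePQ : ∀ u ∈ P, ∀ v ∈ Q, G.Adj u v → (u = a ∧ v = b) ∨ (u = a' ∧ v = b'))
    (ePR : ∀ u ∈ P, ∀ v ∈ R, G.Adj u v → (u = a ∧ v = c) ∨ (u = a' ∧ v = c'))
    (eQR : ∀ u ∈ Q, ∀ v ∈ R, G.Adj u v → (u = b ∧ v = c) ∨ (u = b' ∧ v = c'))
    (hS : S = P ∪ Q ∪ R) : S ∈ solids G := by
  have := hP.right_mem
  have := hQ.right_mem
  have := hR.right_mem
  have := hP.left_mem
  have := hQ.left_mem
  have := hR.left_mem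
  refine IsPrismSet.mem_solids ⟨![a, b, c], ![a', b', c'], ![P, Q, R], ?_, ?_, ?_, ?_, ?_, ?_, ?_⟩
  · intro i j hij
    fin_cases i <;> fin_cases j <;> simp_all [SimpleGraph.adj_comm]
  · intro i j hij
    fin_cases i <;> fin_cases j <;> simp_all [SimpleGraph.adj_comm]
  · intro i j
    fin_cases i <;> fin_cases j <;> simp <;> grind
  · intro i
    fin_cases i <;> assumption
  · intro i j hij
    fin_cases i <;> fin_cases j <;> simp at hij ⊢ <;> grind
  · rw [iUnion_fin_three, hS]
  · intro u hu v hv e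
    have e' := e.symm
    simp only [Fin.exists_fin_succ, Matrix.cons_val_zero,
      Matrix.cons_val_succ, IsEmpty.exists_iff, or_false]
    grind
end

/-! ### Connecting three vertices -/

/-- `a` has a neighbour in `E`. -/
def Sees {V : Type*} (G : SimpleGraph V) (a : V) (E : Set V) : Prop := ∃ e ∈ E, G.Adj a e

/-- `E` is an induced path whose ends are the only neighbours of `a` and of `c`, respectively, while
`b` has at least two neighbours on it. -/
def IsFan {V : Type*} (G : SimpleGraph V) (a c b : V) (E : Set V) : Prop :=
  ∃ u v, IndPath G u E v ∧ G.Adj a u ∧ G.Adj c v ∧ (∀ w ∈ E, G.Adj a w → w = u) ∧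
    (∀ w ∈ E, G.Adj c w → w = v) ∧ ∃ x ∈ E, ∃ y ∈ E, x ≠ y ∧ G.Adj b x ∧ G.Adj b y

/-- `E` together with `a`, `b`, `c` consists of three induced paths to a common vertex. -/
def IsClaw {V : Type*} (G : SimpleGraph V) (a b c : V) (E : Set V) : Prop :=
  ∃ x P Q R, x ∈ E ∧ IndPath G a P x ∧ IndPath G b Q x ∧ IndPath G c R x ∧
    (∀ w ∈ P, w ∈ Q → w = x) ∧ (∀ w ∈ P, w ∈ R → w = x) ∧ (∀ w ∈ Q, w ∈ R → w = x) ∧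
    (∀ u ∈ P, ∀ v ∈ Q, G.Adj u v → (u = a ∧ v = b) ∨ u = x ∨ v = x) ∧
    (∀ u ∈ P, ∀ v ∈ R, G.Adj u v → (u = a ∧ v = c) ∨ u = x ∨ v = x) ∧
    (∀ u ∈ Q, ∀ v ∈ R, G.Adj u v → (u = b ∧ v = c) ∨ u = x ∨ v = x) ∧
    insert a (insert b (insert c E)) = P ∪ Q ∪ R

/-- `E` together with `a`, `b`, `c` consists of three induced paths to the vertices of a
triangle. -/
def IsNet {V : Type*} (G : SimpleGraph V) (a b c : V) (E : Set V) : Prop :=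
  ∃ x y z P Q R, x ∈ E ∧ y ∈ E ∧ z ∈ E ∧ G.Adj x y ∧ G.Adj x z ∧ G.Adj y z ∧
    IndPath G a P x ∧ IndPath G b Q y ∧ IndPath G c R z ∧
    (∀ w ∈ P, w ∉ Q) ∧ (∀ w ∈ P, w ∉ R) ∧ (∀ w ∈ Q, w ∉ R) ∧
    (∀ u ∈ P, ∀ v ∈ Q, G.Adj u v → (u = a ∧ v = b) ∨ (u = x ∧ v = y)) ∧
    (∀ u ∈ P, ∀ v ∈ R, G.Adj u v → (u = a ∧ v = c) ∨ (u = x ∧ v = z)) ∧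
    (∀ u ∈ Q, ∀ v ∈ R, G.Adj u v → (u = b ∧ v = c) ∨ (u = y ∧ v = z)) ∧
    insert a (insert b (insert c E)) = P ∪ Q ∪ R

section
variable {V : Type*} {G : SimpleGraph V} {a b c d u v w x y z q b₁ : V} {S T C P Q R E I J : Set V}

theorem Sees.mono (h : Sees G a S) (hST : S ⊆ T) : Sees G a T :=
  let ⟨e, he, h⟩ := h; ⟨e, hST he, h⟩

theorem IsClaw.of_legs (ha : a ∉ P ∪ Q ∪ R) (hb : b ∉ P ∪ Q ∪ R) (hc : c ∉ P ∪ Q ∪ R)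
    (hab : a ≠ b) (hac : a ≠ c) (hbc : b ≠ c)
    (hP : IndPath G u P x) (hQ : IndPath G v Q x) (hR : IndPath G w R x)
    (hau : G.Adj a u) (hbv : G.Adj b v) (hcw : G.Adj c w)
    (hPQ : ∀ w ∈ P, w ∈ Q → w = x) (hPR : ∀ w ∈ P, w ∈ R → w = x) (hQR : ∀ w ∈ Q, w ∈ R → w = x)
    (ePQ : ∀ u ∈ P, ∀ v ∈ Q, G.Adj u v → u = x ∨ v = x)
    (ePR : ∀ u ∈ P, ∀ v ∈ R, G.Adj u v → u = x ∨ v = x)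
    (eQR : ∀ u ∈ Q, ∀ v ∈ R, G.Adj u v → u = x ∨ v = x)
    (hau' : ∀ y ∈ P ∪ Q ∪ R, G.Adj a y → y = u) (hbv' : ∀ y ∈ P ∪ Q ∪ R, G.Adj b y → y = v)
    (hcw' : ∀ y ∈ P ∪ Q ∪ R, G.Adj c y → y = w) : IsClaw G a b c (P ∪ Q ∪ R) := by
  have h1 := hP.left_mem
  have h2 := hQ.left_mem
  have h3 := hR.left_mem
  have h4 := hP.right_mem
  have h5 := hQ.right_mem
  have h6 := hR.right_mem
  refine ⟨x, _, _, _, by grind, .cons hau hP (by grind) (by grind), .cons hbv hQ (by grind) (by grind),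
    .cons hcw hR (by grind) (by grind), ?_, ?_, ?_, ?_, ?_, ?_, ?_⟩
  · grind
  · grind
  · grind
  · grind [SimpleGraph.Adj.symm]
  · grind [SimpleGraph.Adj.symm]
  · grind [SimpleGraph.Adj.symm]
  · grind

theorem IsNet.of_legs (ha : a ∉ P ∪ Q ∪ R) (hb : b ∉ P ∪ Q ∪ R) (hc : c ∉ P ∪ Q ∪ R)
    (hab : a ≠ b) (hac : a ≠ c) (hbc : b ≠ c) (hxy : G.Adj x y) (hxz : G.Adj x z)
    (hyz : G.Adj y z) (hP : IndPath G u P x) (hQ : IndPath G v Q y) (hR : IndPath G w R z)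
    (hau : G.Adj a u) (hbv : G.Adj b v) (hcw : G.Adj c w)
    (hPQ : ∀ w ∈ P, w ∉ Q) (hPR : ∀ w ∈ P, w ∉ R) (hQR : ∀ w ∈ Q, w ∉ R)
    (ePQ : ∀ u ∈ P, ∀ v ∈ Q, G.Adj u v → u = x ∧ v = y)
    (ePR : ∀ u ∈ P, ∀ v ∈ R, G.Adj u v → u = x ∧ v = z)
    (eQR : ∀ u ∈ Q, ∀ v ∈ R, G.Adj u v → u = y ∧ v = z)
    (hau' : ∀ y ∈ P ∪ Q ∪ R, G.Adj a y → y = u) (hbv' : ∀ y ∈ P ∪ Q ∪ R, G.Adj b y → y = v)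
    (hcw' : ∀ y ∈ P ∪ Q ∪ R, G.Adj c y → y = w) : IsNet G a b c (P ∪ Q ∪ R) := by
  have h1 := hP.left_mem
  have h2 := hQ.left_mem
  have h3 := hR.left_mem
  have h4 := hP.right_mem
  have h5 := hQ.right_mem
  have h6 := hR.right_mem
  refine ⟨x, y, z, _, _, _, by grind, by grind, by grind, hxy, hxz, hyz,
    .cons hau hP (by grind) (by grind), .cons hbv hQ (by grind) (by grind),
    .cons hcw hR (by grind) (by grind), ?_, ?_, ?_, ?_, ?_, ?_, ?_⟩
  · grind
  · grind
  · grind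
  · grind [SimpleGraph.Adj.symm]
  · grind [SimpleGraph.Adj.symm]
  · grind [SimpleGraph.Adj.symm]
  · grind

/-- `E` is minimal among the connected sets that are seen by `a`, `b` and `c`. -/
def MinLink {V : Type*} (G : SimpleGraph V) (a b c : V) (E : Set V) : Prop :=
  ∀ F ⊆ E, SetConn G F → Sees G a F → Sees G b F → Sees G c F → F = E

/-- If `a` sees `J`, the part of `I` between `c` and the first neighbour of `q` makes, together with
`J`, a set seen by all three. By minimality this is all of `E`, so `u` is the only neighbour of `q`
on `I`, and `J` followed by `I` is an induced path. `c` cannot see `J`, or `J` alone would do. Thus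
`a` has a neighbour on each of the two pieces. -/
theorem IsFan.of_sees (hmin : MinLink G a b c E) (hI : IndPath G u I v) (hIE : I ⊆ E)
    (hau : G.Adj a u) (hcv : G.Adj c v) (hcv' : ∀ w ∈ I, G.Adj c w → w = v) (hbI : ¬ Sees G b I)
    (hJ : IndPath G b₁ J q) (hJE : J ⊆ E) (hb : G.Adj b b₁) (hb' : ∀ w ∈ J, G.Adj b w → w = b₁)
    (hq : Sees G q I) (hdis : ∀ w ∈ J, w ∉ I)
    (hq' : ∀ w ∈ J, Sees G w I → w = q) (haJ : Sees G a J) : IsFan G b c a E := by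
  obtain ⟨y, S₁, S₂, k0, k1, k2, k3, k4, k5, k6⟩ := hI.reverse.exists_first (G.Adj q) hq
  have hS₁ : S₁ ⊆ I := k3 ▸ Set.subset_union_left
  have hM := hmin (J ∪ S₁) (Set.union_subset hJE (hS₁.trans hIE))
    (hJ.setConn.union k1.setConn hJ.right_mem k1.right_mem (Or.inr k0))
    (haJ.mono Set.subset_union_left) ⟨b₁, Or.inl hJ.left_mem, hb⟩ ⟨v, Or.inr k1.left_mem, hcv⟩
  have huI := hI.left_mem
  have huS : u ∈ S₁ := by
    rcases (hM.symm ▸ hIE huI : u ∈ J ∪ S₁) with h | h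
    · exact absurd huI (hdis u h)
    · exact h
  have huy : u = y := k4 u huS k2.right_mem
  subst huy
  have hS₂ := k2.eq_singleton
  have hIS : I = S₁ := by
    rw [k3, hS₂]
    have := k1.right_mem
    grind
  subst hIS
  have hcJ : ¬ Sees G c J := fun hcJ => by
    have := hmin J hJE hJ.setConn haJ ⟨b₁, hJ.left_mem, hb⟩ hcJ
    exact hdis u (this.symm ▸ hIE huI) huI
  obtain ⟨w, hw, haw⟩ := haJ
  refine ⟨b₁, v, (hJ.join k0 hI hdis ?_).of_eq hM, hb, hcv, ?_, ?_, w, hJE hw, u, hIE huI, ?_,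
    haw, hau⟩
  · intro x hx y hy e
    have := hq' x hx ⟨y, hy, e⟩
    subst this
    exact ⟨rfl, k6 y hy e⟩
  · rw [← hM]
    rintro x (hx | hx) e
    · exact hb' x hx e
    · exact absurd ⟨x, hx, e⟩ hbI
  · rw [← hM]
    rintro x (hx | hx) e
    · exact absurd ⟨x, hx, e⟩ hcJ
    · exact hcv' x hx e
  · rintro rfl
    exact hdis w hw huI

/-- Link `a` to `c` by an induced path `I` in `E`, and then `b` to `I` by a path `J`. The outcome
depends on the neighbours on `I` of `b`, or of the last vertex `q` of `J`. Minimality is needed only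
when `a` or `c` sees `J`. -/
theorem MinLink.structure (hmin : MinLink G a b c E) (hE : SetConn G E) (ha : a ∉ E) (hb : b ∉ E)
    (hc : c ∉ E) (hab : a ≠ b) (hac : a ≠ c) (hbc : b ≠ c) (hsa : Sees G a E) (hsb : Sees G b E)
    (hsc : Sees G c E) :
    ∃ F ⊆ E, SetConn G F ∧ Sees G a F ∧ Sees G b F ∧ Sees G c F ∧
      (IsFan G a c b F ∨ IsFan G b c a F ∨ IsFan G a b c F ∨ IsClaw G a b c F ∨
        IsNet G a b c F) := by
  obtain ⟨u, v, I, hIE, hI, hau, hcv, hau', hcv'⟩ := hE.exists_link (G.Adj a) (G.Adj c) hsa hsc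
  have hu := hI.left_mem
  have hv := hI.right_mem
  by_cases hbI : Sees G b I
  · obtain ⟨x, hx, hbx⟩ := hbI
    refine ⟨I, hIE, hI.setConn, ⟨u, hu, hau⟩, ⟨x, hx, hbx⟩, ⟨v, hv, hcv⟩, ?_⟩
    by_cases h2 : ∃ y ∈ I, x ≠ y ∧ G.Adj b y
    · obtain ⟨y, hy, hxy, hby⟩ := h2
      exact Or.inl ⟨u, v, hI, hau, hcv, hau', hcv', x, hx, y, hy, hxy, hbx, hby⟩
    · obtain ⟨S₁, S₂, k1, k2, rfl, k4, k5⟩ := hI.split hx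
      have hx1 := k1.right_mem
      have e : S₁ ∪ S₂ = S₁ ∪ {x} ∪ S₂ := by grind
      rw [e]
      refine Or.inr (Or.inr (Or.inr (Or.inl (IsClaw.of_legs (u := u) (v := x) (w := v) (x := x)
        ?_ ?_ ?_ hab hac hbc k1 (.single x) k2.reverse hau hbx hcv ?_ k4 ?_ ?_ k5 ?_ ?_ ?_ ?_))))
      all_goals grind
  · obtain ⟨b₁, q, J, hJE, hJ, hbb, hq, hbb', hq'⟩ := hE.exists_link (G.Adj b)
      (fun w => w ∈ I ∨ Sees G w I) hsb ⟨u, hIE hu, Or.inl hu⟩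
    have hqJ := hJ.right_mem
    have hbJ := hJ.left_mem
    -- If `q` were on `I`, then either it is the neighbour of `b`, so that `b` sees `I`, or its
    -- predecessor on `J` already sees `I`.
    have hqI : q ∉ I := fun hqI => by
      by_cases hb1 : q = b₁
      · exact hbI ⟨b₁, hb1 ▸ hqI, hbb⟩
      · obtain ⟨q', J', h1, h2, h3, h4, rfl⟩ := hJ.reverse.uncons hb1
        have := hq' q' (Or.inr h1.left_mem) (Or.inr ⟨q, hqI, h2.symm⟩)
        exact h2.ne this.symm
    have hsq : Sees G q I := hq.resolve_left hqI
    have hdis : ∀ w ∈ J, w ∉ I := fun w hw hwI => hqI (hq' w hw (Or.inl hwI) ▸ hwI)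
    have hq'' : ∀ w ∈ J, Sees G w I → w = q := fun w hw h => hq' w hw (Or.inr h)
    by_cases haJ : Sees G a J
    · exact ⟨E, subset_rfl, hE, hsa, hsb, hsc, Or.inr (Or.inl (IsFan.of_sees hmin hI hIE hau hcv
        hcv' hbI hJ hJE hbb hbb' hsq hdis hq'' haJ))⟩
    by_cases hcJ : Sees G c J
    · refine ⟨E, subset_rfl, hE, hsa, hsb, hsc, Or.inr (Or.inr (Or.inl ?_))⟩
      have hmin' : MinLink G c b a E := fun F h1 h2 h3 h4 h5 => hmin F h1 h2 h5 h4 h3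
      obtain ⟨x, y, h1, h2, h3, h4, h5, h6⟩ := IsFan.of_sees hmin' hI.reverse hIE hcv hau
        hau' hbI hJ hJE hbb hbb' hsq hdis hq'' hcJ
      exact ⟨y, x, h1.reverse, h3, h2, h5, h4, h6⟩
    -- `x` and `y` are the first and the last neighbour of `q` on `I`. If they coincide, the three
    -- legs meet in `x`; if they are adjacent, `x`, `q`, `y` form the triangle of a net; otherwise
    -- the stretch between them is dropped and the legs meet in `q`.
    obtain ⟨x, S₁, S', k0, k1, k', k3, k4, k5, k6⟩ := hI.exists_first (G.Adj q) hsq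
    obtain ⟨y, S₃, S₂, l0, l1, l2, l3, l4, l5, l6⟩ := k'.reverse.exists_first (G.Adj q)
      ⟨x, k'.left_mem, k0⟩
    subst l3 k3
    have hx1 := k1.right_mem
    have hx2 := l2.right_mem
    have hy2 := l2.left_mem
    have hy3 := l1.right_mem
    have hv3 := l1.left_mem
    have hu1 := k1.left_mem
    simp only [Sees, not_exists, not_and] at haJ hcJ hbI hq''
    have hJI : ∀ w ∈ J, ∀ z ∈ S₁ ∪ (S₃ ∪ S₂), G.Adj w z → w = q := fun w hw z hz e =>
      hq'' w hw ⟨z, hz, e⟩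
    have hfin : ∀ F, F ⊆ E → (SetConn G F) → u ∈ F → v ∈ F → b₁ ∈ F →
        (IsClaw G a b c F ∨ IsNet G a b c F) → ∃ F ⊆ E, SetConn G F ∧ Sees G a F ∧ Sees G b F ∧
          Sees G c F ∧ (IsFan G a c b F ∨ IsFan G b c a F ∨ IsFan G a b c F ∨ IsClaw G a b c F ∨
        IsNet G a b c F) := fun F h1 h2 h3 h4 h5 h6 => ⟨F, h1, h2, ⟨u, h3, hau⟩, ⟨b₁, h5, hbb⟩,
          ⟨v, h4, hcv⟩, Or.inr (Or.inr (Or.inr h6))⟩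
    by_cases hxy : x = y
    · subst hxy
      have hS₂ := l2.eq_singleton
      subst hS₂
      have hJx := hJ.join k0 (.single x) (by grind) (by grind)
      refine hfin (S₁ ∪ (J ∪ {x}) ∪ S₃) (by grind) ?_ (by grind) (by grind) (by grind) (Or.inl ?_)
      · exact (k1.setConn.union hJx.setConn hx1 (Or.inr rfl) (Or.inl rfl)).union l1.setConn
          (Or.inl hx1) hy3 (Or.inl rfl)
      · refine IsClaw.of_legs (u := u) (v := b₁) (w := v) (x := x)
          ?_ ?_ ?_ hab hac hbc k1 hJx l1 hau hbb hcv ?_ ?_ ?_ ?_ ?_ ?_ ?_ ?_ ?_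
        all_goals grind [SimpleGraph.Adj.symm]
    by_cases hxy' : G.Adj x y
    · refine hfin (S₁ ∪ J ∪ S₃) (by grind) ?_ (by grind) (by grind) (by grind) (Or.inr ?_)
      · exact (k1.setConn.union hJ.setConn hx1 hqJ (Or.inr k0.symm)).union l1.setConn
          (Or.inl hx1) hy3 (Or.inr hxy')
      · refine IsNet.of_legs (u := u) (v := b₁) (w := v) (x := x) (y := q) (z := y)
          ?_ ?_ ?_ hab hac hbc k0.symm hxy' l0 k1 hJ l1 hau hbb hcv ?_ ?_ ?_ ?_ ?_ ?_ ?_ ?_ ?_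
        all_goals grind [SimpleGraph.Adj.symm]
    · have hP := k1.join k0.symm (.single q) (by grind) (by grind [SimpleGraph.Adj.symm])
      have hR := l1.join l0.symm (.single q) (by grind) (by grind [SimpleGraph.Adj.symm])
      refine hfin (S₁ ∪ {q} ∪ J ∪ (S₃ ∪ {q})) (by grind) ?_ (by grind) (by grind) (by grind)
        (Or.inl ?_)
      · exact (hP.setConn.union hJ.setConn (Or.inr rfl) hqJ (Or.inl rfl)).union hR.setConn
          (Or.inr hqJ) (Or.inr rfl) (Or.inl rfl)
      · refine IsClaw.of_legs (u := u) (v := b₁) (w := v) (x := q)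
          ?_ ?_ ?_ hab hac hbc hP hJ hR hau hbb hcv ?_ ?_ ?_ ?_ ?_ ?_ ?_ ?_ ?_
        all_goals grind [SimpleGraph.Adj.symm]

theorem exists_minimal_set [Finite V] (p : Set V → Prop) (hp : p S) :
    ∃ T ⊆ S, p T ∧ ∀ F ⊆ T, p F → F = T := by
  obtain ⟨T, ⟨hT, hTS⟩, hmin⟩ := (Set.toFinite {T | p T ∧ T ⊆ S}).exists_minimal ⟨S, hp, subset_rfl⟩
  exact ⟨T, hTS, hT, fun F hF h => hF.antisymm (hmin ⟨h, hF.trans hTS⟩ hF)⟩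

theorem exists_link_structure [Finite V] (hE : SetConn G E) (ha : a ∉ E) (hb : b ∉ E)
    (hc : c ∉ E) (hab : a ≠ b) (hac : a ≠ c) (hbc : b ≠ c) (hsa : Sees G a E) (hsb : Sees G b E)
    (hsc : Sees G c E) :
    ∃ F ⊆ E, SetConn G F ∧ Sees G a F ∧ Sees G b F ∧ Sees G c F ∧
      (IsFan G a c b F ∨ IsFan G b c a F ∨ IsFan G a b c F ∨ IsClaw G a b c F ∨
        IsNet G a b c F) := by
  obtain ⟨T, hTE, ⟨h1, h2, h3, h4⟩, hmin⟩ := exists_minimal_set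
    (fun F => SetConn G F ∧ Sees G a F ∧ Sees G b F ∧ Sees G c F) ⟨hE, hsa, hsb, hsc⟩
  have hm : MinLink G a b c T := fun F k1 k2 k3 k4 k5 => hmin F k1 ⟨k2, k3, k4, k5⟩
  obtain ⟨F, hF, h⟩ := hm.structure h1 (fun h => ha (hTE h)) (fun h => hb (hTE h))
    (fun h => hc (hTE h)) hab hac hbc h2 h3 h4
  exact ⟨F, hF.trans hTE, h⟩
end

/-! ### Solids from a cycle and a connected set -/

section
variable {V : Type*} {G : SimpleGraph V} {a b c d u v w x y z q : V}
  {S T C P Q R E F D I J : Set V}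

/-- The path is closed to a cycle through `a` and `c`, with `b` as the apex of a pyramid; `b` is
adjacent to `a`, `c` and a vertex of the path. -/
theorem IsFan.solid_of_triangle (h : IsFan G a c b F) (ha : a ∉ F) (hb : b ∉ F) (hc : c ∉ F)
    (hab : G.Adj a b) (hac : G.Adj a c) (hbc : G.Adj b c)
    (hS : S = insert a (insert b (insert c F))) : S ∈ solids G := by
  obtain ⟨u, v, h1, h2, h3, h4, h5, x, hx, y, hy, hxy, hbx, hby⟩ := h
  have hu := h1.left_mem
  have hv := h1.right_mem
  have hp := h1.join h3.symm (.single c) (by grind) (by grind [SimpleGraph.Adj.symm])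
  have hC : IsIndCycle G (insert a (F ∪ {c})) :=
    ⟨a, u, c, _, hp, by grind, by grind [SimpleGraph.Adj.ne], h2, hac, by grind, rfl⟩
  exact pyramid_mem_solids (x := a) (y := c) (z := x) (w := b) hC
    (by grind [SimpleGraph.Adj.ne]) (by grind) (by grind) (by grind) hac.ne (by grind) (by grind)
    hab.symm hbc hbx (by rw [hS]; grind)

/-- The triangle and the three legs are a stamp. -/
theorem IsClaw.solid_of_triangle (h : IsClaw G a b c F) (ha : a ∉ F) (hb : b ∉ F) (hc : c ∉ F)
    (hab : G.Adj a b) (hac : G.Adj a c) (hbc : G.Adj b c)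
    (hS : S = insert a (insert b (insert c F))) : S ∈ solids G := by
  obtain ⟨x, P, Q, R, hx, hP, hQ, hR, h1, h2, h3, h4, h5, h6, h7⟩ := h
  exact stamp_mem_solids hab hac hbc (by grind) (by grind) (by grind) hP hQ hR h1 h2 h3 h4 h5 h6
    (hS.trans h7)

/-- The two triangles and the three legs are a prism. -/
theorem IsNet.solid_of_triangle (h : IsNet G a b c F) (ha : a ∉ F) (hb : b ∉ F) (hc : c ∉ F)
    (hab : G.Adj a b) (hac : G.Adj a c) (hbc : G.Adj b c)
    (hS : S = insert a (insert b (insert c F))) : S ∈ solids G := by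
  obtain ⟨x, y, z, P, Q, R, hx, hy, hz, hxy, hxz, hyz, hP, hQ, hR, h1, h2, h3, h4, h5, h6, h7⟩ := h
  exact prism_mem_solids hab hac hbc hxy hxz hyz (by grind) (by grind) (by grind) hP hQ hR
    h1 h2 h3 h4 h5 h6 (hS.trans h7)

/-- A triangle and a connected set seen by all its vertices contain a solid. -/
theorem exists_solid_of_triangle [Finite V] (hE : SetConn G E) (ha : a ∉ E) (hb : b ∉ E)
    (hc : c ∉ E) (hab : G.Adj a b) (hac : G.Adj a c) (hbc : G.Adj b c) (hsa : Sees G a E)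
    (hsb : Sees G b E) (hsc : Sees G c E) :
    ∃ F ⊆ E, SetConn G F ∧ Sees G a F ∧ Sees G b F ∧ Sees G c F ∧
      insert a (insert b (insert c F)) ∈ solids G := by
  obtain ⟨F, hF, h1, h2, h3, h4, h⟩ :=
    exists_link_structure hE ha hb hc hab.ne hac.ne hbc.ne hsa hsb hsc
  have ha : a ∉ F := fun h => ha (hF h)
  have hb : b ∉ F := fun h => hb (hF h)
  have hc : c ∉ F := fun h => hc (hF h)
  refine ⟨F, hF, h1, h2, h3, h4, ?_⟩
  rcases h with h | h | h | h | h
  · exact h.solid_of_triangle ha hb hc hab hac hbc rfl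
  · exact h.solid_of_triangle hb ha hc hab.symm hbc hac (by grind)
  · exact h.solid_of_triangle ha hc hb hac hab hbc.symm (by grind)
  · exact h.solid_of_triangle ha hb hc hab hac hbc rfl
  · exact h.solid_of_triangle ha hb hc hab hac hbc rfl

/-- The cycle now closes through `q`. The apex `b` of the pyramid sees `q` and two vertices of the
path, so its adjacency to `a` and `c` does not matter. -/
theorem IsFan.solid_of_apex (h : IsFan G a c b F) (ha : a ∉ F) (hb : b ∉ F) (hc : c ∉ F)
    (hqF : q ∉ F) (hq : ∀ w ∈ F, ¬ G.Adj q w) (hqa : G.Adj q a) (hqb : G.Adj q b) (hqc : G.Adj q c)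
    (hac : ¬ G.Adj a c) (nab : a ≠ b) (nac : a ≠ c) (nbc : b ≠ c)
    (hS : S = insert q (insert a (insert b (insert c F)))) : S ∈ solids G := by
  obtain ⟨u, v, h1, h2, h3, h4, h5, x, hx, y, hy, hxy, hbx, hby⟩ := h
  have hu := h1.left_mem
  have hv := h1.right_mem
  have hp := (IndPath.cons h2 h1 ha h4).join h3.symm (.single c) (by grind)
    (by grind [SimpleGraph.Adj.symm])
  have hC : IsIndCycle G (insert q (insert a F ∪ {c})) :=
    ⟨q, a, c, _, hp, nac, by grind [SimpleGraph.Adj.ne], hqa, hqc, by grind, rfl⟩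
  exact pyramid_mem_solids (x := q) (y := x) (z := y) (w := b) hC
    (by grind [SimpleGraph.Adj.ne]) (by grind) (by grind) (by grind) (by grind) (by grind) hxy
    hqb.symm hbx hby (by rw [hS]; grind)

/-- Extending the three legs to `q` gives a trihedron with ends `q` and the centre of the claw. -/
theorem IsClaw.solid_of_apex (h : IsClaw G a b c F) (ha : a ∉ F) (hb : b ∉ F) (hc : c ∉ F)
    (hqF : q ∉ F) (hq : ∀ w ∈ F, ¬ G.Adj q w) (hqa : G.Adj q a) (hqb : G.Adj q b) (hqc : G.Adj q c)
    (hab : ¬ G.Adj a b) (hac : ¬ G.Adj a c) (hbc : ¬ G.Adj b c)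
    (hS : S = insert q (insert a (insert b (insert c F)))) : S ∈ solids G := by
  obtain ⟨x, P, Q, R, hx, hP, hQ, hR, h1, h2, h3, h4, h5, h6, h7⟩ := h
  have hPm : ∀ w ∈ P, w = a ∨ w = b ∨ w = c ∨ w ∈ F := by grind
  have hQm : ∀ w ∈ Q, w = a ∨ w = b ∨ w = c ∨ w ∈ F := by grind
  have hRm : ∀ w ∈ R, w = a ∨ w = b ∨ w = c ∨ w ∈ F := by grind
  have haP := hP.left_mem
  have hbQ := hQ.left_mem
  have hcR := hR.left_mem
  have hxP := hP.right_mem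
  have hxQ := hQ.right_mem
  have hxR := hR.right_mem
  have na := hqa.ne
  have nb := hqb.ne
  have nc := hqc.ne
  refine trihedron_mem_solids (x := q) (y := x) (by grind) (hq x hx)
    (IndPath.cons hqa hP (by grind) (by grind)) (IndPath.cons hqb hQ (by grind) (by grind))
    (IndPath.cons hqc hR (by grind) (by grind)) ?_ ?_ ?_ ?_ ?_ ?_ (by rw [hS, h7]; grind)
  all_goals grind

/-- The triangle of the net and the three legs, extended to the common end `q`, are a stamp. -/
theorem IsNet.solid_of_apex (h : IsNet G a b c F) (hb : b ∉ F) (hc : c ∉ F)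
    (hqF : q ∉ F) (hq : ∀ w ∈ F, ¬ G.Adj q w) (hqa : G.Adj q a) (hqb : G.Adj q b) (hqc : G.Adj q c)
    (hab : ¬ G.Adj a b) (hac : ¬ G.Adj a c) (hbc : ¬ G.Adj b c)
    (hS : S = insert q (insert a (insert b (insert c F)))) : S ∈ solids G := by
  obtain ⟨x, y, z, P, Q, R, hx, hy, hz, hxy, hxz, hyz, hP, hQ, hR, h1, h2, h3, h4, h5, h6, h7⟩ := h
  have hPm : ∀ w ∈ P, w = a ∨ w = b ∨ w = c ∨ w ∈ F := by grind
  have hQm : ∀ w ∈ Q, w = a ∨ w = b ∨ w = c ∨ w ∈ F := by grind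
  have hRm : ∀ w ∈ R, w = a ∨ w = b ∨ w = c ∨ w ∈ F := by grind
  have haP := hP.left_mem
  have hbQ := hQ.left_mem
  have hcR := hR.left_mem
  have hxP := hP.right_mem
  have hyQ := hQ.right_mem
  have hzR := hR.right_mem
  have na := hqa.ne
  have nb := hqb.ne
  have nc := hqc.ne
  refine stamp_mem_solids (x := q) hxy hxz hyz (by grind) (by grind) (by grind)
    (IndPath.cons hqa hP (by grind) (by grind)).reverse
    (IndPath.cons hqb hQ (by grind) (by grind)).reverse
    (IndPath.cons hqc hR (by grind) (by grind)).reverse ?_ ?_ ?_ ?_ ?_ ?_ (by rw [hS, h7]; grind)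
  all_goals grind

/-- Three independent neighbours of `q` that see a connected set outside the neighbourhood of `q`
give rise to a solid. -/
theorem exists_solid_of_apex [Finite V] (hE : SetConn G E) (ha : a ∉ E) (hb : b ∉ E)
    (hc : c ∉ E) (hqE : q ∉ E) (hq : ∀ w ∈ E, ¬ G.Adj q w) (hqa : G.Adj q a) (hqb : G.Adj q b)
    (hqc : G.Adj q c) (hab : ¬ G.Adj a b) (hac : ¬ G.Adj a c) (hbc : ¬ G.Adj b c)
    (nab : a ≠ b) (nac : a ≠ c) (nbc : b ≠ c) (hsa : Sees G a E) (hsb : Sees G b E)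
    (hsc : Sees G c E) :
    ∃ F ⊆ E, SetConn G F ∧ Sees G a F ∧ Sees G b F ∧ Sees G c F ∧
      insert q (insert a (insert b (insert c F))) ∈ solids G := by
  obtain ⟨F, hF, h1, h2, h3, h4, h⟩ :=
    exists_link_structure hE ha hb hc nab nac nbc hsa hsb hsc
  have ha : a ∉ F := fun h => ha (hF h)
  have hb : b ∉ F := fun h => hb (hF h)
  have hc : c ∉ F := fun h => hc (hF h)
  have hqF : q ∉ F := fun h => hqE (hF h)
  have hq : ∀ w ∈ F, ¬ G.Adj q w := fun w h => hq w (hF h)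
  refine ⟨F, hF, h1, h2, h3, h4, ?_⟩
  rcases h with h | h | h | h | h
  · exact h.solid_of_apex ha hb hc hqF hq hqa hqb hqc hac nab nac nbc rfl
  · exact h.solid_of_apex hb ha hc hqF hq hqb hqa hqc hbc nab.symm nbc nac (by grind)
  · exact h.solid_of_apex ha hc hb hqF hq hqa hqc hqb hab nac nab nbc.symm (by grind)
  · exact h.solid_of_apex ha hb hc hqF hq hqa hqb hqc hab hac hbc rfl
  · exact h.solid_of_apex hb hc hqF hq hqa hqb hqc hab hac hbc rfl

/-- Two nonadjacent vertices of `C` see `D`. -/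
def SeesPair {V : Type*} (G : SimpleGraph V) (C D : Set V) : Prop :=
  ∃ x ∈ C, ∃ y ∈ C, x ≠ y ∧ ¬ G.Adj x y ∧ Sees G x D ∧ Sees G y D

/-- An induced cycle and a vertex with two nonadjacent neighbours on it. -/
theorem solid_of_vertex (hC : IsIndCycle G C) (hd : d ∉ C) (hx : x ∈ C) (hy : y ∈ C) (hxy : x ≠ y)
    (hn : ¬ G.Adj x y) (hdx : G.Adj d x) (hdy : G.Adj d y) : C ∪ {d} ∈ solids G := by
  by_cases h : ∃ z ∈ C, z ≠ x ∧ z ≠ y ∧ G.Adj d z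
  · obtain ⟨z, hz, hzx, hzy, hdz⟩ := h
    exact pyramid_mem_solids hC hd hx hy hz hxy hzx.symm hzy.symm hdx hdy hdz (by grind)
  · obtain ⟨P, Q, hP, hQ, rfl, h1, h2⟩ := hC.arcs hx hy hxy hn
    have k1 := hP.left_mem
    have k2 := hP.right_mem
    have hR : IndPath G x (insert x (insert d {y})) y :=
      .cons hdx.symm (.cons hdy (.single y) (by grind) (by grind)) (by grind)
        (by grind [SimpleGraph.Adj.ne])
    refine trihedron_mem_solids hxy hn hP hQ hR h1 ?_ ?_ h2 ?_ ?_ ?_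
    all_goals grind [SimpleGraph.Adj.symm]

/-- An induced cycle `C` and a disjoint induced path such that the two ends of the path see
disjoint cliques of `C`, one of them a single vertex, and the inner vertices see nothing. -/
theorem solid_of_edge_vertex (hC : IsIndCycle G C) (hJ : IndPath G u J v) (hd : ∀ w ∈ J, w ∉ C)
    (hz : z ∈ C) (hx : x ∈ C) (hy : y ∈ C) (hxz : G.Adj x z) (hyx : y ≠ x)
    (hyz : y ≠ z) (hux : G.Adj u x) (huz : G.Adj u z) (hvy : G.Adj v y)
    (hc : ∀ w ∈ J, ∀ t ∈ C, G.Adj w t → (w = u ∧ (t = x ∨ t = z)) ∨ (w = v ∧ t = y)) :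
    C ∪ J ∈ solids G := by
  obtain ⟨s, t, S, h1, h2, h3, h4, h5, h6, rfl⟩ := hC.rotate hx
  obtain ⟨t, S, h1, h2, h3, h4, h6, rfl⟩ : ∃ t S', IndPath G z S' t ∧ z ≠ t ∧ x ∉ S' ∧
      G.Adj x t ∧ (∀ w ∈ S', G.Adj x w → w = z ∨ w = t) ∧ S = S' := by
    rcases h6 z (hz.resolve_left hxz.ne') hxz with rfl | rfl
    · exact ⟨t, S, h1, h2, h3, h5, h6, rfl⟩
    · exact ⟨s, S, h1.reverse, h2.symm, h3, h4, fun w hw e => (h6 w hw e).symm, rfl⟩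
  have hyS : y ∈ S := hy.resolve_left hyx
  obtain ⟨S₁, S₂, k1, k2, rfl, k4, k5⟩ := h1.split hyS
  have a1 := k1.left_mem
  have a2 := k1.right_mem
  have a3 := k2.left_mem
  have a4 := k2.right_mem
  have a5 := hJ.left_mem
  have a6 := hJ.right_mem
  -- The solid is a stamp: its triangle is `x`, `z`, `u`, its centre is `y`, and its paths are the
  -- two arcs of the cycle to `y` and the path `J`.
  have hR := hJ.join hvy (.single y) (by grind) (by grind)
  refine stamp_mem_solids (a := x) (b := z) (c := u) (x := y) hxz hux.symm huz.symm (by grind)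
    (by grind) (by grind) (.cons h4 k2.reverse (by grind) (by grind)) k1 hR ?_ ?_ ?_ ?_ ?_ ?_ ?_
  all_goals grind [SimpleGraph.Adj.symm]

/-- The ends of `J` form triangles with two disjoint edges of `C`. Deleting these edges from `C`
leaves two arcs, which with `J` are the three paths of a prism. -/
theorem solid_of_edge_edge {s t : V} (hC : IsIndCycle G C) (hJ : IndPath G u J v)
    (hd : ∀ w ∈ J, w ∉ C) (huv : u ≠ v) (hz : z ∈ C) (hx : x ∈ C) (hs : s ∈ C) (ht : t ∈ C)
    (hxz : G.Adj x z) (hst : G.Adj s t) (hsx : s ≠ x) (hsz : s ≠ z) (htx : t ≠ x) (htz : t ≠ z)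
    (hux : G.Adj u x) (huz : G.Adj u z) (hvs : G.Adj v s) (hvt : G.Adj v t)
    (hc : ∀ w ∈ J, ∀ r ∈ C, G.Adj w r → (w = u ∧ (r = x ∨ r = z)) ∨ (w = v ∧ (r = s ∨ r = t))) :
    C ∪ J ∈ solids G := by
  obtain ⟨s', t', S, h1, h2, h3, h4, h5, h6, rfl⟩ := hC.rotate hx
  obtain ⟨p, S, h1, h2, h3, h4, h6, rfl⟩ : ∃ t S', IndPath G z S' t ∧ z ≠ t ∧ x ∉ S' ∧
      G.Adj x t ∧ (∀ w ∈ S', G.Adj x w → w = z ∨ w = t) ∧ S = S' := by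
    rcases h6 z (hz.resolve_left hxz.ne') hxz with rfl | rfl
    · exact ⟨t', S, h1, h2, h3, h5, h6, rfl⟩
    · exact ⟨s', S, h1.reverse, h2.symm, h3, h4, fun w hw e => (h6 w hw e).symm, rfl⟩
  -- Here `y` and `y'` are `s` and `t` in the order in which the path from `z` meets them.
  obtain ⟨S₁, S₂, y, y', hyy, k1, k2, rfl, k4, k5⟩ :=
    h1.split_edge (hs.resolve_left hsx) (ht.resolve_left htx) hst
  have a1 := k1.left_mem
  have a2 := k1.right_mem
  have a3 := k2.left_mem
  have a4 := k2.right_mem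
  have a5 := hJ.left_mem
  have a6 := hJ.right_mem
  have b1 : G.Adj y' y := by grind [SimpleGraph.Adj.symm]
  have b2 : G.Adj v y := by grind
  have b3 : G.Adj v y' := by grind
  refine prism_mem_solids (a := x) (b := z) (c := u) (a' := y') (b' := y) (c' := v) hxz hux.symm
    huz.symm b1 b3.symm b2.symm (by grind) (by grind) huv
    (.cons h4 k2.reverse (by grind) (by grind)) k1 hJ ?_ ?_ ?_ ?_ ?_ ?_ ?_
  all_goals grind [SimpleGraph.Adj.symm]

/-- A trihedron with ends `x` and `y`: the two arcs of `C` and the path through `J`. -/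
theorem solid_of_vertex_vertex (hC : IsIndCycle G C) (hJ : IndPath G u J v) (hd : ∀ w ∈ J, w ∉ C)
    (hx : x ∈ C) (hy : y ∈ C) (hxy : x ≠ y) (hn : ¬ G.Adj x y) (hux : G.Adj u x)
    (hvy : G.Adj v y)
    (hc : ∀ w ∈ J, ∀ t ∈ C, G.Adj w t → (w = u ∧ t = x) ∨ (w = v ∧ t = y)) :
    C ∪ J ∈ solids G := by
  obtain ⟨P, Q, hP, hQ, rfl, h1, h2⟩ := hC.arcs hx hy hxy hn
  have k1 := hP.left_mem
  have k2 := hP.right_mem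
  have k3 := hJ.left_mem
  have k4 := hJ.right_mem
  have hR := hJ.join hvy (.single y) (by grind) (by grind)
  have hR' := IndPath.cons hux.symm hR (by grind) (by grind [SimpleGraph.Adj.symm])
  refine trihedron_mem_solids hxy hn hP hQ hR' h1 ?_ ?_ h2 ?_ ?_ ?_
  all_goals grind [SimpleGraph.Adj.symm]

/-- A vertex `b` of `C` with both cycle neighbours `x`, `y` attached to the ends of `J` is traded
for `J`: the rest of `C` together with `J` is an induced cycle, and `b` is the apex of a pyramid,
adjacent to `x`, `y` and a vertex of `J`. -/
theorem solid_of_centre (hC : IsIndCycle G C) (hJ : IndPath G u J v) (hd : ∀ w ∈ J, w ∉ C)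
    (hx : x ∈ C) (hy : y ∈ C) (hb : b ∈ C) (hxy : x ≠ y) (hn : ¬ G.Adj x y) (hux : G.Adj u x)
    (hvy : G.Adj v y) (hbx : G.Adj b x) (hby : G.Adj b y) (hbJ : Sees G b J)
    (hc : ∀ w ∈ J, ∀ t ∈ C, G.Adj w t → (w = u ∧ t = x) ∨ (w = v ∧ t = y) ∨ t = b) :
    C ∪ J ∈ solids G := by
  obtain ⟨s, t, S, h1, h2, h3, h4, h5, h6, rfl⟩ := hC.rotate hb
  obtain ⟨S, h1, rfl⟩ : ∃ S', IndPath G x S' y ∧ S = S' := by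
    have e1 := h6 x (hx.resolve_left hbx.ne') hbx
    have e2 := h6 y (hy.resolve_left hby.ne') hby
    rcases e1 with rfl | rfl <;> rcases e2 with rfl | rfl
    · exact absurd rfl hxy
    · exact ⟨S, h1, rfl⟩
    · exact ⟨S, h1.reverse, rfl⟩
    · exact absurd rfl hxy
  have k1 := h1.left_mem
  have k2 := h1.right_mem
  obtain ⟨w, hw, hbw⟩ := hbJ
  have hC' := IsIndCycle.of_join h1 hJ hxy hux.symm hvy.symm (by grind)
    (by grind [SimpleGraph.Adj.symm])
  exact pyramid_mem_solids (w := b) (x := x) (y := y) (z := w) hC' (by grind) (by grind) (by grind)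
    (by grind) hxy (by grind) (by grind) hbx hby hbw (by grind)

/-- An induced cycle and a connected set seen by two nonadjacent vertices of it contain a solid. -/
theorem exists_solid_of_seesPair [Finite V] (hC : IsIndCycle G C) (hD : SetConn G D)
    (hdis : ∀ w ∈ D, w ∉ C) (h : SeesPair G C D) :
    ∃ F ⊆ D, SetConn G F ∧ SeesPair G C F ∧ C ∪ F ∈ solids G := by
  obtain ⟨F, hFD, ⟨hF, hp⟩, hmin⟩ := exists_minimal_set
    (fun F => SetConn G F ∧ SeesPair G C F) ⟨hD, h⟩
  refine ⟨F, hFD, hF, hp, ?_⟩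
  have hdis : ∀ w ∈ F, w ∉ C := fun w hw => hdis w (hFD hw)
  obtain ⟨x, hx, y, hy, hxy, hn, hxF, hyF⟩ := hp
  obtain ⟨u, v, J, hJF, hJ, hxu, hyv, hxu', hyv'⟩ :=
    hF.exists_link (G.Adj x) (G.Adj y) hxF hyF
  have hu := hJ.left_mem
  have hv := hJ.right_mem
  have : J = F := hmin J hJF ⟨hJ.setConn, x, hx, y, hy, hxy, hn, ⟨u, hu, hxu⟩, ⟨v, hv, hyv⟩⟩
  subst this
  by_cases huv : u = v
  · subst huv
    have := hJ.eq_singleton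
    subst this
    exact solid_of_vertex hC (hdis _ hu) hx hy hxy hn hxu.symm hyv.symm
  -- the vertices of `C` that see the path without its last, respectively first, vertex
  have key : ∀ p q, q ∈ J → p ≠ q → ∀ K, IndPath G p K q → J = K → ∀ s ∈ C, ∀ t ∈ C, s ≠ t →
      (∃ w ∈ J, w ≠ p ∧ G.Adj w s) → (∃ w ∈ J, w ≠ p ∧ G.Adj w t) → G.Adj s t := by
    rintro p q hq hpq K hK rfl s hs t ht hst ⟨w, hw, hwp, hws⟩ ⟨w', hw', hwp', hwt⟩
    by_contra hne
    obtain ⟨p', K', h1, h2, h3, h4, e⟩ := hK.uncons hpq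
    have h5 := hmin K' (e ▸ Set.subset_insert _ _) ⟨h1.setConn, s, hs, t, ht, hst, hne,
      ⟨w, (e ▸ hw : w ∈ insert p K').resolve_left hwp, hws.symm⟩,
      ⟨w', (e ▸ hw' : w' ∈ insert p K').resolve_left hwp', hwt.symm⟩⟩
    exact h3 (h5 ▸ e ▸ Or.inl rfl)
  have kv := key u v hv huv J hJ rfl
  have ku := key v u hu (Ne.symm huv) J hJ.reverse rfl
  -- A triangle in `C` would be all of `C`, but `x` and `y` are nonadjacent. So the cliques found
  -- below have at most two vertices.
  have notri : ∀ b ∈ C, ∀ c ∈ C, ∀ d ∈ C, G.Adj b c → G.Adj b d → G.Adj c d → False := by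
    intro b hb c hc d hd h1 h2 h3
    have := hC.eq_of_triangle hb hc hd h1 h2 h3
    have e1 := this x hx
    have e2 := this y hy
    grind [SimpleGraph.Adj.symm]
  -- If some `b` sees `J` both without `u` and without `v`, it is adjacent to `x` and to `y`. As `C`
  -- has no triangle, all edges between `C` and `J` other than `ux` and `vy` are at `b`.
  by_cases hcen : ∃ b ∈ C, (∃ w ∈ J, w ≠ u ∧ G.Adj w b) ∧ ∃ w ∈ J, w ≠ v ∧ G.Adj w b
  · obtain ⟨b, hb, h1, h2⟩ := hcen
    have hbx : b ≠ x := by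
      rintro rfl
      obtain ⟨w, hw, hwu, e⟩ := h1
      exact hwu (hxu' w hw e.symm)
    have hby : b ≠ y := by
      rintro rfl
      obtain ⟨w, hw, hwu, e⟩ := h2
      exact hwu (hyv' w hw e.symm)
    have e1 : G.Adj b x := ku b hb x hx hbx h2 ⟨u, hu, huv, hxu.symm⟩
    have e2 : G.Adj b y := kv b hb y hy hby h1 ⟨v, hv, Ne.symm huv, hyv.symm⟩
    refine solid_of_centre hC hJ hdis hx hy hb hxy hn hxu.symm hyv.symm e1 e2 ?_ ?_
    · obtain ⟨w, hw, -, h⟩ := h1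
      exact ⟨w, hw, h.symm⟩
    · intro w hw t ht e
      by_cases htb : t = b
      · exact Or.inr (Or.inr htb)
      by_cases hwu : w = u
      · have hwv : w ≠ v := fun h => huv (hwu.symm.trans h)
        have e3 := ku b hb t ht (Ne.symm htb) h2 ⟨w, hw, hwv, e⟩
        by_cases htx : t = x
        · exact Or.inl ⟨hwu, htx⟩
        · have e4 := ku t ht x hx htx ⟨w, hw, hwv, e⟩ ⟨u, hu, huv, hxu.symm⟩
          exact (notri b hb t ht x hx e3 e1 e4).elim
      · have e3 := kv b hb t ht (Ne.symm htb) h1 ⟨w, hw, hwu, e⟩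
        by_cases hty : t = y
        · subst hty
          exact Or.inr (Or.inl ⟨hyv' w hw e.symm, rfl⟩)
        · have e4 := kv t ht y hy hty ⟨w, hw, hwu, e⟩ ⟨v, hv, Ne.symm huv, hyv.symm⟩
          exact (notri b hb t ht y hy e3 e2 e4).elim
  -- Otherwise only `u` and `v` have neighbours on `C`, and these form two disjoint cliques of one
  -- or two vertices. The four size patterns give a prism, a stamp (twice) or a trihedron.
  · have hends : ∀ w ∈ J, ∀ t ∈ C, G.Adj w t → w = u ∨ w = v := by
      intro w hw t ht e
      by_contra! hne
      exact hcen ⟨t, ht, ⟨w, hw, hne.1, e⟩, ⟨w, hw, hne.2, e⟩⟩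
    have hnot : ∀ t ∈ C, ¬ (G.Adj u t ∧ G.Adj v t) := fun t ht h =>
      hcen ⟨t, ht, ⟨v, hv, Ne.symm huv, h.2⟩, ⟨u, hu, huv, h.1⟩⟩
    have cu : ∀ s ∈ C, ∀ t ∈ C, s ≠ t → G.Adj u s → G.Adj u t → G.Adj s t := fun s hs t ht h h1 h2 =>
      ku s hs t ht h ⟨u, hu, huv, h1⟩ ⟨u, hu, huv, h2⟩
    have cv : ∀ s ∈ C, ∀ t ∈ C, s ≠ t → G.Adj v s → G.Adj v t → G.Adj s t := fun s hs t ht h h1 h2 =>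
      kv s hs t ht h ⟨v, hv, Ne.symm huv, h1⟩ ⟨v, hv, Ne.symm huv, h2⟩
    have hxu2 := hxu.symm
    have hyv2 := hyv.symm
    by_cases h1 : ∃ z ∈ C, z ≠ x ∧ G.Adj u z
    · obtain ⟨z, hz, hzx, huz⟩ := h1
      have hxz := cu x hx z hz hzx.symm hxu2 huz
      have hu3 : ∀ t ∈ C, G.Adj u t → t = x ∨ t = z := by
        intro t ht e
        by_contra! hne
        exact notri x hx z hz t ht hxz (cu x hx t ht hne.1.symm hxu2 e)
          (cu z hz t ht hne.2.symm huz e)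
      by_cases h2 : ∃ t ∈ C, t ≠ y ∧ G.Adj v t
      · obtain ⟨t, ht, hty, hvt⟩ := h2
        have hyt := cv y hy t ht hty.symm hyv2 hvt
        have hv3 : ∀ s ∈ C, G.Adj v s → s = y ∨ s = t := by
          intro s hs e
          by_contra! hne
          exact notri y hy t ht s hs hyt (cv y hy s hs hne.1.symm hyv2 e)
            (cv t ht s hs hne.2.symm hvt e)
        refine solid_of_edge_edge (x := x) (z := z) (s := y) (t := t) hC hJ hdis huv hz hx hy ht
          hxz hyt hxy.symm ?_ ?_ ?_ hxu2 huz hyv2 hvt ?_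
        all_goals grind
      · refine solid_of_edge_vertex (x := x) (z := z) (y := y) hC hJ hdis hz hx hy hxz hxy.symm
          ?_ hxu2 huz hyv2 ?_
        all_goals grind
    · by_cases h2 : ∃ t ∈ C, t ≠ y ∧ G.Adj v t
      · obtain ⟨t, ht, hty, hvt⟩ := h2
        have hyt := cv y hy t ht hty.symm hyv2 hvt
        have hv3 : ∀ s ∈ C, G.Adj v s → s = y ∨ s = t := by
          intro s hs e
          by_contra! hne
          exact notri y hy t ht s hs hyt (cv y hy s hs hne.1.symm hyv2 e)
            (cv t ht s hs hne.2.symm hvt e)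
        refine solid_of_edge_vertex (x := y) (z := t) (y := x) hC hJ.reverse hdis ht hy hx hyt hxy
          ?_ hyv2 hvt hxu2 ?_
        all_goals grind
      · refine solid_of_vertex_vertex hC hJ hdis hx hy hxy hn hxu2 hyv2 ?_
        grind
end

/-! ### Presenting a solid as a cycle and a connected set -/

/-- The vertices of `C` that see `D` do not lie on a single vertex or edge. -/
def Attaches {V : Type*} (G : SimpleGraph V) (C D : Set V) : Prop :=
  SeesPair G C D ∨ ∃ a b c, G.Adj a b ∧ G.Adj a c ∧ G.Adj b c ∧ C = {a, b, c} ∧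
    Sees G a D ∧ Sees G b D ∧ Sees G c D

/-- `S` consists of an induced cycle and a connected set that contains `z` and is minimal
attaching to the cycle. -/
def CyclePresented {V : Type*} (G : SimpleGraph V) (S : Set V) (z : V) : Prop :=
  ∃ C D, IsIndCycle G C ∧ SetConn G D ∧ (∀ w ∈ D, w ∉ C) ∧ S = C ∪ D ∧ z ∈ D ∧ Attaches G C D ∧
    ∀ D' ⊆ D, SetConn G D' → Attaches G C D' → D ⊆ D'

/-- `S` consists of a vertex `q` with three independent neighbours and a connected set that contains
`z` and is minimal seen by these neighbours. -/
def ApexPresented {V : Type*} (G : SimpleGraph V) (S : Set V) (z : V) : Prop :=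
  ∃ (q : V) (a : Fin 3 → V) (D : Set V), (∀ i, G.Adj q (a i)) ∧
    (∀ i j, i ≠ j → a i ≠ a j ∧ ¬ G.Adj (a i) (a j)) ∧ q ∉ D ∧ (∀ w ∈ D, ¬ G.Adj q w) ∧
    (∀ i, a i ∉ D) ∧ SetConn G D ∧ S = insert q (Set.range a ∪ D) ∧ z ∈ D ∧
    (∀ i, Sees G (a i) D) ∧ ∀ D' ⊆ D, SetConn G D' → (∀ i, Sees G (a i) D') → D ⊆ D'

section
variable {V : Type*} {G : SimpleGraph V} {a b c d u v w x y z q : V}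
  {S T C P Q R E F D I J : Set V}

theorem exists_solid_of_attaches [Finite V] (hC : IsIndCycle G C) (hD : SetConn G D)
    (hdis : ∀ w ∈ D, w ∉ C) (h : Attaches G C D) :
    ∃ F ⊆ D, SetConn G F ∧ Attaches G C F ∧ C ∪ F ∈ solids G := by
  rcases h with h | ⟨a, b, c, hab, hac, hbc, rfl, ha, hb, hc⟩
  · obtain ⟨F, h1, h2, h3, h4⟩ := exists_solid_of_seesPair hC hD hdis h
    exact ⟨F, h1, h2, Or.inl h3, h4⟩
  · obtain ⟨F, h1, h2, h3, h4, h5, h6⟩ := exists_solid_of_triangle hD (by grind) (by grind)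
      (by grind) hab hac hbc ha hb hc
    refine ⟨F, h1, h2, Or.inr ⟨a, b, c, hab, hac, hbc, rfl, h3, h4, h5⟩, ?_⟩
    convert h6 using 1
    ext; simp [or_assoc]

theorem Attaches.not_subset_edge (h : Attaches G C D) (hpq : x = y ∨ G.Adj x y)
    (hC : ∀ t ∈ C, Sees G t D → t = x ∨ t = y) : False := by
  rcases h with ⟨s, hs, t, ht, hst, hn, h1, h2⟩ | ⟨a, b, c, hab, hac, hbc, rfl, ha, hb, hc⟩
  · have := hC s hs h1
    have := hC t ht h2
    grind [SimpleGraph.Adj.symm]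
  · have := hC a (by simp) ha
    have := hC b (by simp) hb
    have := hC c (by simp) hc
    grind [SimpleGraph.Adj.ne]

/-- Three vertices of an induced cycle include a nonadjacent pair unless they form a triangle, which
is then the whole cycle. -/
theorem Attaches.of_three (hC : IsIndCycle G C) (hx : x ∈ C) (hy : y ∈ C) (hz : z ∈ C)
    (hxy : x ≠ y) (hxz : x ≠ z) (hyz : y ≠ z) (h1 : Sees G x D) (h2 : Sees G y D)
    (h3 : Sees G z D) : Attaches G C D := by
  by_cases e1 : G.Adj x y
  · by_cases e2 : G.Adj x z
    · by_cases e3 : G.Adj y z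
      · refine Or.inr ⟨x, y, z, e1, e2, e3, ?_, h1, h2, h3⟩
        have := hC.eq_of_triangle hx hy hz e1 e2 e3
        ext w
        simp only [Set.mem_insert_iff, Set.mem_singleton_iff]
        refine ⟨this w, ?_⟩
        rintro (rfl | rfl | rfl) <;> assumption
      · exact Or.inl ⟨y, hy, z, hz, hyz, e3, h2, h3⟩
    · exact Or.inl ⟨x, hx, z, hz, hxz, e2, h1, h3⟩
  · exact Or.inl ⟨x, hx, y, hy, hxy, e1, h1, h2⟩

/-- Without either end, the path is seen only from a vertex or an edge of `C` and hence no longer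
attaches. So an attaching connected subset contains both ends, and with them the whole path. -/
theorem CyclePresented.of_path {p q p' q' : V} (hC : IsIndCycle G C) (hI : IndPath G u I v)
    (hdis : ∀ w ∈ I, w ∉ C) (hz : z ∈ I) (hatt : Attaches G C I)
    (hpq : p = q ∨ G.Adj p q) (hu : ∀ t ∈ C, ∀ w ∈ I, w ≠ u → G.Adj t w → t = p ∨ t = q)
    (hpq' : p' = q' ∨ G.Adj p' q') (hv : ∀ t ∈ C, ∀ w ∈ I, w ≠ v → G.Adj t w → t = p' ∨ t = q')
    (hS : S = C ∪ I) : CyclePresented G S z := by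
  refine ⟨C, I, hC, hI.setConn, hdis, hS, hz, hatt, fun D' hD' hc hat => ?_⟩
  refine hI.subset_of_ends hD' hc ?_ ?_
  · by_contra hn
    exact hat.not_subset_edge hpq fun t ht ⟨w, hw, e⟩ =>
      hu t ht w (hD' hw) (fun h => hn (h ▸ hw)) e
  · by_contra hn
    exact hat.not_subset_edge hpq' fun t ht ⟨w, hw, e⟩ =>
      hv t ht w (hD' hw) (fun h => hn (h ▸ hw)) e

theorem IndPath.append (h : IndPath G a S z) (h' : IndPath G z T b)
    (hd : ∀ w ∈ S, w ∈ T → w = z) (hx : ∀ u ∈ S, ∀ v ∈ T, G.Adj u v → u = z ∨ v = z) :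
    IndPath G a (S ∪ T) b := by
  have hz := h.right_mem
  by_cases hzb : z = b
  · subst hzb
    have := h'.eq_singleton
    exact h.of_eq (by grind)
  · obtain ⟨y, T', h1, h2, h3, h4, rfl⟩ := h'.uncons hzb
    exact (h.join h2 h1 (by grind) (by grind)).of_eq (by grind)

/-- If `z` is the apex, `D` is `{z}`. Otherwise the cycle is rerouted: `w` and a segment of the old
cycle between consecutive neighbours `c₁`, `c₂` of `w`, avoiding `z`, form the new cycle, and `D` is
the remainder of the old one. The third neighbour of `w` lies in `D`, so `w`, `c₁` and `c₂` all see
it. -/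
theorem IsPyramidSet.cyclePresented (h : IsPyramidSet G S) (hz : z ∈ S) :
    CyclePresented G S z := by
  obtain ⟨w, C, f, hC, hw, rfl, hf, hfw⟩ := h
  by_cases hzw : z = w
  · subst hzw
    refine .of_path (p := z) (q := z) (p' := z) (q' := z) hC (.single z) (by grind) rfl
      (.of_three hC (hfw 0).1 (hfw 1).1 (hfw 2).1 (hf.ne (by decide)) (hf.ne (by decide))
        (hf.ne (by decide)) ⟨z, rfl, (hfw 0).2.symm⟩ ⟨z, rfl, (hfw 1).2.symm⟩
        ⟨z, rfl, (hfw 2).2.symm⟩) (Or.inl rfl) (by grind) (Or.inl rfl) (by grind) (by grind)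
  obtain ⟨u, v, S, h1, h2, h3, h4, h5, h6, rfl⟩ := hC.rotate (hz.resolve_left hzw)
  have hthree : ∀ c₁ c₂, ∃ s ∈ insert z S, s ≠ c₁ ∧ s ≠ c₂ ∧ G.Adj w s := by
    intro c₁ c₂
    have e0 := hfw 0
    have e1 := hfw 1
    have e2 := hfw 2
    have n1 : f 0 ≠ f 1 := hf.ne (by decide)
    have n2 : f 0 ≠ f 2 := hf.ne (by decide)
    have n3 : f 1 ≠ f 2 := hf.ne (by decide)
    grind
  clear hfw hf f
  obtain ⟨s₁, hs₁', hs₁z, -, hws₁⟩ := hthree z z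
  obtain ⟨s₂, hs₂', hs₂z, hs, hws₂⟩ := hthree z s₁
  have hs₁ := hs₁'.resolve_left hs₁z
  have hs₂ := hs₂'.resolve_left hs₂z
  obtain ⟨c₁, S₁, S₂, k0, k1, k2, rfl, k4, k5, k6⟩ := h1.exists_first (G.Adj w) ⟨s₁, hs₁, hws₁⟩
  obtain ⟨s, hsS, hsc, hws⟩ : ∃ s ∈ S₂, s ≠ c₁ ∧ G.Adj w s := by
    clear hs₁' hs₂'
    grind
  have hc₁v : c₁ ≠ v := by
    rintro rfl
    have := k2.eq_singleton
    grind
  obtain ⟨e, S₂, l1, l2, l3, l4, rfl⟩ := k2.uncons hc₁v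
  obtain ⟨c₂, S₃, S₄, m0, m1, m2, rfl, m4, m5, m6⟩ :=
    l1.exists_first (G.Adj w) ⟨s, hsS.resolve_left hsc, hws⟩
  have a1 := k1.left_mem
  have a2 := k1.right_mem
  have a3 := m1.left_mem
  have a4 := m1.right_mem
  have a5 := m2.left_mem
  have a6 := m2.right_mem
  have hC' : IsIndCycle G (insert w (insert c₁ S₃)) :=
    ⟨w, c₁, c₂, _, .cons l2 m1 (by grind) (by grind), by grind, by grind, k0, m0, by grind, rfl⟩
  have hzu : ∀ y ∈ S₁, G.Adj z y → y = u := by grind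
  have hzv : ∀ y ∈ S₄, G.Adj z y → y = v := by grind
  -- The remainder of the old cycle is assembled from two paths ending in `z`. Prepending `z` before
  -- stripping `c₁` and `c₂` covers the case that one of these is a neighbour of `z`.
  obtain ⟨e₁, R₁, r1, r2, r3, r4, r5⟩ :=
    (IndPath.cons h4 k1 (by grind) hzu).reverse.uncons (by grind)
  obtain ⟨e₂, R₂, t1, t2, t3, t4, t5⟩ :=
    (IndPath.cons h5 m2.reverse (by grind) hzv).reverse.uncons (by grind)
  have b1 := r1.left_mem
  have b2 := t1.left_mem
  have b3 := r1.right_mem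
  have b4 := t1.right_mem
  have sR₁ : ∀ y ∈ R₁, y = z ∨ y ∈ S₁ := fun y hy => (r5 ▸ Or.inr hy : y ∈ insert z S₁)
  have sR₂ : ∀ y ∈ R₂, y = z ∨ y ∈ S₄ := fun y hy => (t5 ▸ Or.inr hy : y ∈ insert z S₄)
  have hD := r1.append t1.reverse (by grind) (by grind [SimpleGraph.Adj.symm])
  have hdis : ∀ y ∈ R₁ ∪ R₂, y ∉ insert w (insert c₁ S₃) := by grind
  -- Of the new cycle, only `w`, `c₁` and `c₂` see the remainder, and `c₁`, `c₂` see it only in its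
  -- ends `e₁`, `e₂`. Without `e₁` only the edge `w c₂` is left to see it, without `e₂` only the
  -- edge `w c₁`.
  have f1 : ∀ t ∈ S₃, ∀ y ∈ R₁ ∪ R₂, G.Adj t y → t = c₂ := by
    have hz : ∀ t ∈ S₃, G.Adj t z → t = c₂ := by
      intro t ht e
      rcases h6 t (Or.inr (Or.inr (Or.inl ht))) e.symm with rfl | rfl
      · exact absurd (Or.inl ht) (k4 t a1 (Or.inr (Or.inl ht)) ▸ l3)
      · exact m4 t ht a6
    rintro t ht y (hy | hy) e
    · rcases sR₁ y hy with rfl | hy1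
      · exact hz t ht e
      · rcases k5 y hy1 t (Or.inr (Or.inl ht)) e.symm with rfl | rfl
        · exact absurd hy r3
        · exact absurd (Or.inl ht) l3
    · rcases sR₂ y hy with rfl | hy1
      · exact hz t ht e
      · rcases m5 t ht y hy1 e with rfl | rfl
        · rfl
        · exact absurd hy t3
  have f2 : ∀ y ∈ R₁ ∪ R₂, G.Adj c₁ y → y = e₁ := by
    rintro y (hy | hy) e
    · exact r4 y hy e
    · rcases sR₂ y hy with rfl | hy1
      · exact r4 y b3 e
      · have := l4 y (Or.inr hy1) e
        subst this
        exact absurd hy (m4 y a3 hy1 ▸ t3)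
  have f3 : ∀ y ∈ R₁ ∪ R₂, G.Adj c₂ y → y = e₂ := by
    rintro y (hy | hy) e
    · rcases sR₁ y hy with rfl | hy1
      · exact t4 y b4 e
      · rcases k5 y hy1 c₂ (Or.inr (Or.inl a4)) e.symm with rfl | rfl
        · exact absurd hy r3
        · exact absurd (Or.inl a4) l3
    · exact t4 y hy e
  have hwD : Sees G w (R₁ ∪ R₂) := by
    obtain ⟨s, hs, hs1, hs2, hws⟩ := hthree c₁ c₂
    refine ⟨s, ?_, hws⟩
    rcases hs with rfl | hs | rfl | hs | hs
    · exact Or.inl b3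
    · exact absurd (k6 s hs hws) hs1
    · exact absurd rfl hs1
    · exact absurd (m6 s hs hws) hs2
    · exact Or.inr ((t5 ▸ Or.inr hs : s ∈ insert c₂ R₂).resolve_left hs2)
  have hc₁₂ : c₁ ≠ c₂ := fun h => l3 (h ▸ Or.inl a4)
  refine .of_path (p := w) (q := c₂) (p' := w) (q' := c₁) hC' hD hdis (Or.inl b3)
    (.of_three hC' (x := w) (y := c₁) (z := c₂) (Or.inl rfl) (Or.inr (Or.inl rfl))
      (Or.inr (Or.inr a4)) k0.ne m0.ne hc₁₂ hwD ⟨e₁, Or.inl b1, r2⟩ ⟨e₂, Or.inr b2, t2⟩)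
    (Or.inr m0) ?_ (Or.inr k0) ?_ ?_
  · rintro t (rfl | rfl | ht) y hy hye e
    · exact Or.inl rfl
    · exact absurd (f2 y hy e) hye
    · exact Or.inr (f1 t ht y hy e)
  · rintro t (rfl | rfl | ht) y hy hye e
    · exact Or.inl rfl
    · exact Or.inr rfl
    · have := f1 t ht y hy e
      subst this
      exact absurd (f3 y hy e) hye
  · have q1 : ∀ y, y ∈ insert z S₁ ↔ y ∈ insert c₁ R₁ := fun y => by rw [r5]
    have q2 : ∀ y, y ∈ insert z S₄ ↔ y ∈ insert c₂ R₂ := fun y => by rw [t5]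
    clear * - q1 q2 a4
    ext y
    have := q1 y
    have := q2 y
    simp only [Set.mem_insert_iff, Set.mem_union] at *
    grind
end

/-! ### Presenting trihedra, prisms and stamps at a given vertex. -/

section
variable {V : Type*} {G : SimpleGraph V} {a b c d u v w x y z q : V}
  {S T C P Q R E F D I J : Set V}

theorem exists_others (i : Fin 3) : ∃ j k : Fin 3, j ≠ i ∧ k ≠ i ∧ j ≠ k ∧
    ∀ l, l = i ∨ l = j ∨ l = k := by
  revert i; decide

theorem iUnion_eq_of_others {P : Fin 3 → Set V} {i j k : Fin 3} (h : ∀ l, l = i ∨ l = j ∨ l = k) :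
    ⋃ l, P l = P j ∪ P k ∪ P i := by
  ext v
  simp only [Set.mem_iUnion, Set.mem_union]
  constructor
  · rintro ⟨l, hl⟩
    rcases h l with rfl | rfl | rfl <;> tauto
  · rintro ((h | h) | h) <;> exact ⟨_, h⟩

theorem SetConn.iUnion {ι : Type*} {R : ι → Set V} (hR : ∀ i, SetConn G (R i)) (hz : ∀ i, z ∈ R i) :
    SetConn G (⋃ i, R i) := by
  intro A hA hne hcl
  have key : ∀ i, (A ∩ R i).Nonempty → R i ⊆ A := by
    intro i hn v hv
    have := hR i (A ∩ R i) Set.inter_subset_right hn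
      (fun u hu v hv huv => ⟨hcl u hu.1 v (Set.mem_iUnion.2 ⟨i, hv⟩) huv, hv⟩)
    exact (this.symm ▸ hv : v ∈ A ∩ R i).1
  obtain ⟨u, hu⟩ := hne
  obtain ⟨i, hi⟩ := Set.mem_iUnion.1 (hA hu)
  have hzA := key i ⟨u, hu, hi⟩ (hz i)
  exact hA.antisymm (Set.iUnion_subset fun j => key j ⟨z, hzA, hz j⟩)

/-- A connected subset of a subdivided claw that contains its leaves is the whole claw. -/
theorem tripod_subset {s : Fin 3 → V} {R : Fin 3 → Set V} (hR : ∀ i, IndPath G (s i) (R i) z)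
    (hd : ∀ i j, i ≠ j → ∀ v ∈ R i, v ∈ R j → v = z)
    (hc : ∀ u ∈ ⋃ i, R i, ∀ v ∈ ⋃ i, R i, G.Adj u v → ∃ i, u ∈ R i ∧ v ∈ R i)
    (hD : D ⊆ ⋃ i, R i) (hconn : SetConn G D) (hs : ∀ i, s i ∈ D) : ⋃ i, R i ⊆ D := by
  refine Set.iUnion_subset fun i w hw => ?_
  by_contra hwD
  obtain ⟨S₁, S₂, h1, h2, h3, h4, h5⟩ := (hR i).split hw
  have hz2 := h2.right_mem
  have hS₁ : S₁ ⊆ R i := h3 ▸ Set.subset_union_left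
  -- The missing vertex `w` cuts off the outer part `S₁` of its leg, so `D` would lie within `S₁`;
  -- but `D` contains the leaf of another leg.
  have hA := hconn (D ∩ S₁) Set.inter_subset_left ⟨s i, hs i, h1.left_mem⟩ (by
    rintro u ⟨hu, hu1⟩ v hv huv
    refine ⟨hv, ?_⟩
    obtain ⟨j, huj, hvj⟩ := hc u (hD hu) v (hD hv) huv
    by_cases hij : i = j
    · subst hij
      rcases (h3 ▸ hvj : v ∈ S₁ ∪ S₂) with h | h
      · exact h
      · rcases h5 u hu1 v h huv with rfl | rfl
        · exact absurd hu hwD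
        · exact absurd hv hwD
    · have := hd i j hij u (hS₁ hu1) huj
      subst this
      exact absurd hu (h4 u hu1 hz2 ▸ hwD))
  obtain ⟨j, k, hj, -⟩ := exists_others i
  have hsj : s j ∈ S₁ := (hA.symm ▸ hs j : s j ∈ D ∩ S₁).2
  have hsz := hd i j (Ne.symm hj) _ (hS₁ hsj) (hR j).left_mem
  have := h4 _ hsj (hsz ▸ hz2)
  exact hwD (this ▸ hs j)

/-- Take the far end `x` as the apex. Without `x` and its three neighbours a subdivided claw with
centre `y` remains; each neighbour of `x` sees only its leaf, so a connected set seen by all three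
contains all leaves. -/
theorem trihedron_apexPresented {P : Fin 3 → Set V} (hxy : x ≠ y) (hn : ¬ G.Adj x y)
    (hP : ∀ i, IndPath G x (P i) y)
    (hd : ∀ i j, i ≠ j → ∀ v ∈ P i, v ∈ P j → v = x ∨ v = y)
    (hc : ∀ u ∈ ⋃ i, P i, ∀ v ∈ ⋃ i, P i, G.Adj u v → ∃ i, u ∈ P i ∧ v ∈ P i) :
    ApexPresented G (⋃ i, P i) y := by
  choose a Q h1 h2 h3 h4 h5 using fun i => (hP i).uncons hxy
  have hay : ∀ i, a i ≠ y := fun i h => hn (h ▸ h2 i)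
  choose s R k1 k2 k3 k4 k5 using fun i => (h1 i).uncons (hay i)
  have hRP : ∀ i w, w ∈ R i → w ∈ P i := fun i w hw => by
    rw [h5, k5]; exact Or.inr (Or.inr hw)
  have haP : ∀ i, a i ∈ P i := fun i => by rw [h5, k5]; exact Or.inr (Or.inl rfl)
  have hRP' : ∀ w, w ∈ ⋃ i, R i → w ∈ ⋃ i, P i := fun w hw => by
    obtain ⟨i, hi⟩ := Set.mem_iUnion.1 hw
    exact Set.mem_iUnion.2 ⟨i, hRP i w hi⟩
  have haP' : ∀ i, a i ∈ ⋃ i, P i := fun i => Set.mem_iUnion.2 ⟨i, haP i⟩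
  have hxR : ∀ i, x ∉ R i := fun i h => h3 i (k5 i ▸ Or.inr h)
  have hxa : ∀ i, x ≠ a i := fun i => (h2 i).ne
  have hxR' : x ∉ ⋃ i, R i := fun h => by
    obtain ⟨i, hi⟩ := Set.mem_iUnion.1 h
    exact hxR i hi
  have haj : ∀ i j, a i ∈ P j → i = j := fun i j h => by
    by_contra hij
    rcases hd i j hij _ (haP i) h with h | h
    · exact hxa i h.symm
    · exact hay i h
  have hcR : ∀ u ∈ ⋃ i, R i, ∀ v ∈ ⋃ i, R i, G.Adj u v → ∃ i, u ∈ R i ∧ v ∈ R i := by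
    intro u hu v hv e
    have key : ∀ w ∈ ⋃ i, R i, ∀ j, w ∈ P j → w ∈ R j := by
      intro w hw j hj
      obtain ⟨i, hi⟩ := Set.mem_iUnion.1 hw
      by_cases hij : i = j
      · exact hij ▸ hi
      · rcases hd i j hij w (hRP i w hi) hj with rfl | rfl
        · exact absurd hi (hxR i)
        · exact (k1 j).right_mem
    obtain ⟨i, hi, hi'⟩ := hc u (hRP' u hu) v (hRP' v hv) e
    exact ⟨i, key u hu i hi, key v hv i hi'⟩
  have hsee : ∀ i, ∀ w ∈ ⋃ i, R i, G.Adj (a i) w → w = s i := by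
    intro i w hw e
    obtain ⟨j, hj, hj'⟩ := hc _ (haP' i) w (hRP' w hw) e
    have := haj i j hj
    subst this
    rw [h5, k5] at hj'
    rcases hj' with rfl | rfl | hj'
    · exact absurd hw hxR'
    · exact absurd rfl e.ne
    · exact k4 i w hj' e
  have haR : ∀ i, a i ∉ ⋃ i, R i := fun i h => by
    obtain ⟨j, hj⟩ := Set.mem_iUnion.1 h
    have := haj i j (hRP j _ hj)
    subst this
    exact k3 i hj
  refine ⟨x, a, ⋃ i, R i, h2, ?_, hxR', ?_, haR, .iUnion (fun i => (k1 i).setConn)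
    (fun i => (k1 i).right_mem), ?_, Set.mem_iUnion.2 ⟨0, (k1 0).right_mem⟩, ?_, ?_⟩
  · intro i j hij
    refine ⟨fun h => hij (haj i j (h ▸ haP j)), fun e => ?_⟩
    obtain ⟨l, hl, hl'⟩ := hc _ (haP' i) _ (haP' j) e
    exact hij ((haj i l hl).trans (haj j l hl').symm)
  · intro w hw e
    obtain ⟨i, hi, hi'⟩ := hc x (Set.mem_iUnion.2 ⟨0, (hP 0).left_mem⟩) w (hRP' w hw) e
    rw [h5] at hi'
    rcases hi' with rfl | hi'
    · exact e.ne rfl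
    · have := h4 i w hi' e
      subst this
      exact haR i hw
  · ext w
    simp only [Set.mem_iUnion, Set.mem_insert_iff, Set.mem_union, Set.mem_range]
    constructor
    · rintro ⟨i, hi⟩
      rw [h5, k5] at hi
      rcases hi with rfl | rfl | hi
      · exact Or.inl rfl
      · exact Or.inr (Or.inl ⟨i, rfl⟩)
      · exact Or.inr (Or.inr ⟨i, hi⟩)
    · rintro (rfl | ⟨i, rfl⟩ | ⟨i, hi⟩)
      · exact ⟨0, (hP 0).left_mem⟩
      · exact ⟨i, haP i⟩
      · exact ⟨i, hRP i w hi⟩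
  · exact fun i => ⟨s i, Set.mem_iUnion.2 ⟨i, (k1 i).left_mem⟩, k2 i⟩
  · intro D' hD' hconn hs
    refine tripod_subset k1 ?_ hcR hD' hconn ?_
    · intro i j hij v hi hj
      exact (hd i j hij v (hRP i v hi) (hRP j v hj)).resolve_left fun h => hxR i (h ▸ hi)
    · intro i
      obtain ⟨w, hw, e⟩ := hs i
      exact hsee i w (hD' hw) e ▸ hw

/-- Every cycle of a trihedron passes through both its ends, so for these no cycle avoiding `z`
exists; this is why the apex presentation is needed. For an inner vertex of one path, the other two
paths form the cycle. -/
theorem IsTrihedronSet.presented (h : IsTrihedronSet G S) (hz : z ∈ S) :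
    CyclePresented G S z ∨ ApexPresented G S z := by
  obtain ⟨x, y, P, hxy, hn, hP, hd, rfl, hc⟩ := h
  by_cases hzy : z = y
  · subst hzy
    exact Or.inr (trihedron_apexPresented hxy hn hP hd hc)
  by_cases hzx : z = x
  · subst hzx
    exact Or.inr (trihedron_apexPresented hxy.symm (fun e => hn e.symm) (fun i => (hP i).reverse)
      (fun i j hij v hi hj => (hd i j hij v hi hj).symm) hc)
  obtain ⟨i, hi⟩ := Set.mem_iUnion.1 hz
  obtain ⟨j, k, hji, hki, hjk, hall⟩ := exists_others i
  obtain ⟨u, v, I, h1, h2, h3, h4, h5, h6, h7, h8⟩ := (hP i).interior hxy hn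
  have hu := h1.left_mem
  have hv := h1.right_mem
  have hIP : ∀ w ∈ I, w ∈ P i := fun w hw => h8 ▸ Or.inr (Or.inr hw)
  have hxP : ∀ l, x ∈ P l := fun l => (hP l).left_mem
  have hyP : ∀ l, y ∈ P l := fun l => (hP l).right_mem
  have hin : ∀ l w, w ∈ P l → w ∈ ⋃ l, P l := fun l w hw => Set.mem_iUnion.2 ⟨l, hw⟩
  have hIl : ∀ w ∈ I, ∀ l, w ∈ P l → l = i := by
    intro w hw l hl
    by_contra hli
    rcases hd l i hli w hl (hIP w hw) with rfl | rfl
    · exact h6 hw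
    · exact h7 hw
  have hC := IsIndCycle.of_arcs (hP j) (hP k) hxy hn (hd j k hjk) (by
    intro u hu v hv e
    obtain ⟨l, hl, hl'⟩ := hc u (hin j u hu) v (hin k v hv) e
    by_cases hlj : l = j
    · subst hlj
      have := hd l k hjk v hl' hv
      tauto
    · have := hd l j hlj u hl hu
      tauto)
  have hCI : ∀ t ∈ P j ∪ P k, ∀ w ∈ I, G.Adj t w → t = x ∨ t = y := by
    intro t ht w hw e
    have ht' : t ∈ ⋃ l, P l := by
      rcases ht with ht | ht
      exacts [hin _ _ ht, hin _ _ ht]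
    obtain ⟨l, hl, hl'⟩ := hc t ht' w (hin i w (hIP w hw)) e
    have := hIl w hw l hl'
    subst this
    rcases ht with ht | ht
    · exact hd j l hji t ht hl
    · exact hd k l hki t ht hl
  refine Or.inl (.of_path (p := y) (q := y) (p' := x) (q' := x) hC h1 ?_ ?_ ?_ (Or.inl rfl) ?_
    (Or.inl rfl) ?_ ?_)
  · rintro w hw (h | h)
    · exact hji (hIl w hw j h)
    · exact hki (hIl w hw k h)
  · rw [h8] at hi
    exact (hi.resolve_left hzx).resolve_left hzy
  · exact Or.inl ⟨x, Or.inl (hxP j), y, Or.inl (hyP j), hxy, hn, ⟨u, hu, h2⟩, ⟨v, hv, h3⟩⟩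
  · intro t ht w hw hwu e
    refine Or.inl ((hCI t ht w hw e).resolve_left ?_)
    rintro rfl
    exact hwu (h4 w hw e)
  · intro t ht w hw hwv e
    refine Or.inl ((hCI t ht w hw e).resolve_right ?_)
    rintro rfl
    exact hwv (h5 w hw e)
  · rw [iUnion_eq_of_others hall, h8]
    have := hxP j
    have := hyP j
    grind

/-- The path through `z` attaches to the cycle formed by the other two, by one edge of the cycle at
each end. -/
theorem IsPrismSet.cyclePresented (h : IsPrismSet G S) (hz : z ∈ S) : CyclePresented G S z := by
  obtain ⟨a, b, P, ha, hb, hab, hP, hd, rfl, hc⟩ := h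
  obtain ⟨i, hi⟩ := Set.mem_iUnion.1 hz
  obtain ⟨j, k, hji, hki, hjk, hall⟩ := exists_others i
  have haP : ∀ l, a l ∈ P l := fun l => (hP l).left_mem
  have hbP : ∀ l, b l ∈ P l := fun l => (hP l).right_mem
  have hin : ∀ l w, w ∈ P l → w ∈ ⋃ l, P l := fun l w hw => Set.mem_iUnion.2 ⟨l, hw⟩
  have hone : ∀ w l m, w ∈ P l → w ∈ P m → l = m := fun w l m h h' => by
    by_contra hlm
    exact hd l m hlm w h h'
  have hcr : ∀ l m, l ≠ m → ∀ u ∈ P l, ∀ v ∈ P m, G.Adj u v →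
      (u = a l ∧ v = a m) ∨ (u = b l ∧ v = b m) := by
    intro l m hlm u hu v hv e
    rcases hc u (hin l u hu) v (hin m v hv) e with ⟨s, t, rfl, rfl⟩ | ⟨s, t, rfl, rfl⟩ | ⟨s, h, h'⟩
    · rw [hone _ _ _ hu (haP s), hone _ _ _ hv (haP t)]
      exact Or.inl ⟨rfl, rfl⟩
    · rw [hone _ _ _ hu (hbP s), hone _ _ _ hv (hbP t)]
      exact Or.inr ⟨rfl, rfl⟩
    · exact absurd ((hone _ _ _ hu h).trans (hone _ _ _ hv h').symm) hlm
  have hC := IsIndCycle.of_join (hP j) (hP k) (hab j j) (ha j k hjk) (hb j k hjk) (hd j k hjk)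
    (hcr j k hjk)
  have hCI : ∀ t ∈ P j ∪ P k, ∀ w ∈ P i, G.Adj t w →
      ((t = a j ∨ t = a k) ∧ w = a i) ∨ ((t = b j ∨ t = b k) ∧ w = b i) := by
    rintro t (ht | ht) w hw e
    · rcases hcr j i hji t ht w hw e with h | h <;> tauto
    · rcases hcr k i hki t ht w hw e with h | h <;> tauto
  refine .of_path (p := b j) (q := b k) (p' := a j) (q' := a k) hC (hP i) ?_ hi ?_
    (Or.inr (hb j k hjk)) ?_ (Or.inr (ha j k hjk)) ?_ (iUnion_eq_of_others hall)
  · rintro w hw (h | h)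
    · exact hd j i hji w h hw
    · exact hd k i hki w h hw
  · exact .of_three hC (Or.inl (haP j)) (Or.inr (haP k)) (Or.inl (hbP j)) (ha j k hjk).ne
      (hab j j) (hab k j) ⟨a i, haP i, ha j i hji⟩ ⟨a i, haP i, ha k i hki⟩ ⟨b i, hbP i, hb j i hji⟩
  · intro t ht w hw hwa e
    rcases hCI t ht w hw e with h | h
    · exact absurd h.2 hwa
    · exact h.1
  · intro t ht w hw hwb e
    rcases hCI t ht w hw e with h | h
    · exact h.1
    · exact absurd h.2 hwb

/-- If `z` is the centre, the cycle is the triangle and `D` is the subdivided claw of the remaining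
vertices. Otherwise the two legs avoiding `z` close to a cycle, and `D` is the leg of `z` without
the centre. -/
theorem IsStampSet.cyclePresented (h : IsStampSet G S) (hz : z ∈ S) : CyclePresented G S z := by
  obtain ⟨t, x, P, ht, hx, hP, hd, rfl, hc⟩ := h
  have htP : ∀ l, t l ∈ P l := fun l => (hP l).left_mem
  have hxP : ∀ l, x ∈ P l := fun l => (hP l).right_mem
  have hin : ∀ l w, w ∈ P l → w ∈ ⋃ l, P l := fun l w hw => Set.mem_iUnion.2 ⟨l, hw⟩
  have hone : ∀ w, w ≠ x → ∀ l m, w ∈ P l → w ∈ P m → l = m := fun w hw l m h h' => by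
    by_contra hlm
    exact hw (hd l m hlm w h h')
  have hcr : ∀ l m, l ≠ m → ∀ u ∈ P l, ∀ v ∈ P m, G.Adj u v →
      (u = t l ∧ v = t m) ∨ u = x ∨ v = x := by
    intro l m hlm u hu v hv e
    rcases hc u (hin l u hu) v (hin m v hv) e with ⟨r, s, rfl, rfl⟩ | ⟨s, h, h'⟩
    · rw [hone _ (hx r) _ _ hu (htP r), hone _ (hx s) _ _ hv (htP s)]
      exact Or.inl ⟨rfl, rfl⟩
    · by_contra! hne
      exact hlm ((hone _ hne.2.1 _ _ hu h).trans (hone _ hne.2.2 _ _ hv h').symm)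
  by_cases hzx : z = x
  · subst hzx
    choose s R k1 k2 k3 k4 k5 using fun i => (hP i).uncons (hx i)
    have hRP : ∀ i w, w ∈ R i → w ∈ P i := fun i w hw => by rw [k5]; exact Or.inr hw
    have htR : ∀ i j, t i ∉ R j := fun i j h => by
      have := hone _ (hx i) i j (htP i) (hRP j _ h)
      subst this
      exact k3 i h
    have key : ∀ u ∈ ⋃ i, R i, ∀ j, u ∈ P j → u ∈ R j := by
      intro u hu j hj
      obtain ⟨i, hi⟩ := Set.mem_iUnion.1 hu
      by_cases hux : u = z
      · exact hux ▸ (k1 j).right_mem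
      · exact hone u hux i j (hRP i u hi) hj ▸ hi
    have hRP' : ∀ w, w ∈ ⋃ i, R i → w ∈ ⋃ i, P i := fun w hw => by
      obtain ⟨i, hi⟩ := Set.mem_iUnion.1 hw
      exact Set.mem_iUnion.2 ⟨i, hRP i w hi⟩
    have htR' : ∀ i, t i ∉ ⋃ i, R i := fun i h => by
      obtain ⟨j, hj⟩ := Set.mem_iUnion.1 h
      exact htR i j hj
    have hC : IsIndCycle G (Set.range t) := by
      refine ⟨t 0, t 1, t 2, {t 1} ∪ {t 2}, (IndPath.single _).join (ht 1 2 (by decide)) (.single _)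
        ?_ ?_, (ht 1 2 (by decide)).ne, ?_, ht 0 1 (by decide), ht 0 2 (by decide), ?_, ?_⟩
      · have := (ht 1 2 (by decide)).ne
        grind
      · grind
      · have := (ht 0 1 (by decide)).ne
        have := (ht 0 2 (by decide)).ne
        grind
      · grind
      · ext w
        simp [Fin.exists_fin_succ, eq_comm]
        tauto
    refine ⟨Set.range t, ⋃ i, R i, hC, .iUnion (fun i => (k1 i).setConn)
      (fun i => (k1 i).right_mem), ?_, ?_, Set.mem_iUnion.2 ⟨0, (k1 0).right_mem⟩, ?_, ?_⟩
    · rintro w hw ⟨i, rfl⟩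
      exact htR' i hw
    · ext w
      simp only [Set.mem_iUnion, Set.mem_union, Set.mem_range]
      constructor
      · rintro ⟨i, hi⟩
        rw [k5] at hi
        rcases hi with rfl | hi
        · exact Or.inl ⟨i, rfl⟩
        · exact Or.inr ⟨i, hi⟩
      · rintro (⟨i, rfl⟩ | ⟨i, hi⟩)
        · exact ⟨i, htP i⟩
        · exact ⟨i, hRP i w hi⟩
    · have hs : ∀ i, Sees G (t i) (⋃ i, R i) := fun i =>
        ⟨s i, Set.mem_iUnion.2 ⟨i, (k1 i).left_mem⟩, k2 i⟩
      exact .of_three hC ⟨0, rfl⟩ ⟨1, rfl⟩ ⟨2, rfl⟩ (ht 0 1 (by decide)).ne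
        (ht 0 2 (by decide)).ne (ht 1 2 (by decide)).ne (hs 0) (hs 1) (hs 2)
    · intro D' hD' hconn hatt
      refine tripod_subset k1 (fun i j hij v hi hj => hd i j hij v (hRP i v hi) (hRP j v hj)) ?_
        hD' hconn fun i => ?_
      · intro u hu v hv e
        rcases hc u (hRP' u hu) v (hRP' v hv) e with ⟨i, j, rfl, rfl⟩ | ⟨i, hi, hi'⟩
        · exact absurd hu (htR' i)
        · exact ⟨i, key u hu i hi, key v hv i hi'⟩
      · obtain ⟨j, k, hji, hki, hjk, hall⟩ := exists_others i
        -- A set missed by one vertex of the triangle would be seen only from the opposite edge.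
        have hsee : Sees G (t i) D' := by
          by_contra hn
          refine hatt.not_subset_edge (Or.inr (ht j k hjk)) ?_
          rintro _ ⟨l, rfl⟩ hl
          rcases hall l with rfl | rfl | rfl
          · exact absurd hl hn
          · exact Or.inl rfl
          · exact Or.inr rfl
        obtain ⟨w, hw, e⟩ := hsee
        have hwR := hD' hw
        rcases hc _ (hin i _ (htP i)) w (hRP' w hwR) e with ⟨l, m, -, rfl⟩ | ⟨l, hl, hl'⟩
        · exact absurd hwR (htR' m)
        · have := hone _ (hx i) i l (htP i) hl
          subst this
          exact k4 i w (key w hwR i hl') e ▸ hw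
  obtain ⟨i, hi⟩ := Set.mem_iUnion.1 hz
  obtain ⟨j, k, hji, hki, hjk, hall⟩ := exists_others i
  obtain ⟨v, I, h1, h2, h3, h4, h5⟩ := (hP i).reverse.uncons (hx i).symm
  obtain ⟨v', Q, l1, l2, l3, l4, l5⟩ := (hP k).reverse.uncons (hx k).symm
  have hQk : ∀ w ∈ Q, w ∈ P k := fun w hw => l5 ▸ Or.inr hw
  have hIP : ∀ w ∈ I, w ∈ P i := fun w hw => h5 ▸ Or.inr hw
  have hIx : ∀ w ∈ I, w ≠ x := fun w hw h => h3 (h ▸ hw)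
  have hti := h1.right_mem
  have hv := h1.left_mem
  have htk := l1.right_mem
  have hUn : P j ∪ P k = P j ∪ Q := by
    rw [l5]
    have := hxP j
    grind
  have hC := IsIndCycle.of_join (hP j) l1.reverse (hx j) (ht j k hjk) l2 (by
    intro w hw hw'
    exact l3 (hd j k hjk w hw (hQk w hw') ▸ hw')) (by
    intro u hu w hw e
    rcases hcr j k hjk u hu w (hQk w hw) e with h | rfl | rfl
    · exact Or.inl h
    · exact Or.inr ⟨rfl, l4 w hw e⟩
    · exact absurd hw l3)
  rw [← hUn] at hC
  have hCI : ∀ s ∈ P j ∪ P k, ∀ w ∈ I, G.Adj s w → ((s = t j ∨ s = t k) ∧ w = t i) ∨ s = x := by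
    rintro s (hs | hs) w hw e
    · rcases hcr j i hji s hs w (hIP w hw) e with h | h | h
      · tauto
      · tauto
      · exact absurd h (hIx w hw)
    · rcases hcr k i hki s hs w (hIP w hw) e with h | h | h
      · tauto
      · tauto
      · exact absurd h (hIx w hw)
  refine .of_path (p := t j) (q := t k) (p' := x) (q' := x) hC h1 ?_ ?_ ?_
    (Or.inr (ht j k hjk)) ?_ (Or.inl rfl) ?_ ?_
  · rintro w hw (h | h)
    · exact hji (hone w (hIx w hw) _ _ h (hIP w hw))
    · exact hki (hone w (hIx w hw) _ _ h (hIP w hw))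
  · rw [h5] at hi
    exact hi.resolve_left hzx
  · exact .of_three hC (x := t j) (y := t k) (z := x) (Or.inl (htP j)) (Or.inr (htP k))
      (Or.inl (hxP j)) (ht j k hjk).ne (hx j) (hx k) ⟨t i, hti, ht j i hji⟩
      ⟨t i, hti, ht k i hki⟩ ⟨v, hv, h2⟩
  · intro s hs w hw hwv e
    rcases hCI s hs w hw e with h | h
    · exact h.1
    · subst h
      exact absurd (h4 w hw e) hwv
  · intro s hs w hw hwt e
    rcases hCI s hs w hw e with h | h
    · exact absurd h.2 hwt
    · exact Or.inl h
  · rw [iUnion_eq_of_others hall, h5]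
    have := hxP j
    grind

theorem presented_of_mem_solids (h : S ∈ solids G) (hz : z ∈ S) :
    CyclePresented G S z ∨ ApexPresented G S z := by
  rcases mem_solids_iff.1 h with h | h | h | h
  · exact Or.inl (h.cyclePresented hz)
  · exact h.presented hz
  · exact Or.inl (h.cyclePresented hz)
  · exact Or.inl (h.cyclePresented hz)
end

/-! ### Lifting solids through the contraction of a connected set -/

/-- `G'` arises from `G` by contracting `B` to its vertex `z`. -/
structure IsContraction {V : Type*} (G G' : SimpleGraph V) (B : Set V) (z : V) : Prop where
  conn : SetConn G B
  mem : z ∈ B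
  adj_iff : ∀ u ∉ B, ∀ v ∉ B, (G'.Adj u v ↔ G.Adj u v)
  adj_iff_sees : ∀ u ∉ B, (G'.Adj u z ↔ Sees G u B)

/-- The image of `F` under the contraction of `B` to `z`. -/
def contractImage {V : Type*} (B : Set V) (z : V) (F : Set V) : Set V :=
  {w | w ∉ B ∧ w ∈ F ∨ w = z ∧ ∃ b ∈ B, b ∈ F}

/-- The preimage of `D` under the contraction of `B` to `z`. -/
def contractPreimage {V : Type*} (B : Set V) (z : V) (D : Set V) : Set V := D \ {z} ∪ B

section
variable {V : Type*} {G G' : SimpleGraph V} {a b c d u v w x y z q : V}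
  {S T C P Q R E F D I J B : Set V}

namespace IsContraction

/-- A set closed under adjacency that meets `B` contains `B`, as `B` is connected; so its image is
closed in `D` and must be all of `D`. -/
theorem setConn_preimage (h : IsContraction G G' B z) (hD : SetConn G' D) (hz : z ∈ D)
    (hDB : ∀ w ∈ D, w ∈ B → w = z) : SetConn G (contractPreimage B z D) := by
  intro A hA hne hcl
  obtain ⟨hc, hm, h1, h2⟩ := h
  have hB : ∀ b ∈ B, b ∈ A → B ⊆ A := by
    intro b hb hbA
    have := hc (A ∩ B) Set.inter_subset_right ⟨b, hbA, hb⟩ (by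
      intro u hu v hv huv
      exact ⟨hcl u hu.1 v (Or.inr hv) huv, hv⟩)
    intro w hw
    rw [← this] at hw
    exact hw.1
  have key := hD (contractImage B z A ∩ D) Set.inter_subset_right ?_ ?_
  · apply hA.antisymm
    have hzA : z ∈ contractImage B z A ∩ D := by rw [key]; exact hz
    have hBA : B ⊆ A := by
      rcases hzA.1 with h | ⟨-, b, hb, hbA⟩
      · exact absurd hm h.1
      · exact hB b hb hbA
    rintro w (hw | hw)
    · have : w ∈ contractImage B z A ∩ D := by rw [key]; exact hw.1
      rcases this.1 with h | h
      · exact h.2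
      · exact absurd h.1 hw.2
    · exact hBA hw
  · obtain ⟨w, hw⟩ := hne
    by_cases hwB : w ∈ B
    · exact ⟨z, Or.inr ⟨rfl, w, hwB, hw⟩, hz⟩
    · rcases hA hw with h | h
      · exact ⟨w, Or.inl ⟨hwB, hw⟩, h.1⟩
      · exact absurd h hwB
  · rintro u ⟨hu, huD⟩ v hv huv
    refine ⟨?_, hv⟩
    by_cases hvB : v ∈ B
    · obtain rfl := hDB v hv hvB
      refine Or.inr ⟨rfl, ?_⟩
      rcases hu with hu | hu
      · obtain ⟨b, hb, hub⟩ := (h2 u hu.1).1 huv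
        exact ⟨b, hb, hcl u hu.2 b (Or.inr hb) hub⟩
      · exact hu.2
    · have hvz : v ≠ z := fun h => hvB (h ▸ hm)
      refine Or.inl ⟨hvB, ?_⟩
      rcases hu with hu | ⟨rfl, b, hb, hbA⟩
      · exact hcl u hu.2 v (Or.inl ⟨hv, hvz⟩) ((h1 u hu.1 v hvB).1 huv)
      · obtain ⟨b', hb', hub⟩ := (h2 v hvB).1 huv.symm
        exact hcl b' (hB b hb hbA hb') v (Or.inl ⟨hv, hvz⟩) hub.symm

theorem setConn_image (h : IsContraction G G' B z) (hF : SetConn G F) :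
    SetConn G' (contractImage B z F) := by
  intro A hA hne hcl
  obtain ⟨hc, hm, h1, h2⟩ := h
  have key := hF {w ∈ F | w ∉ B ∧ w ∈ A ∨ w ∈ B ∧ z ∈ A} (Set.sep_subset _ _) ?_ ?_
  · apply hA.antisymm
    rintro w (⟨hwB, hw⟩ | ⟨rfl, b, hb, hbF⟩)
    · rw [← key] at hw
      grind
    · rw [← key] at hbF
      grind
  · obtain ⟨w, hw⟩ := hne
    rcases hA hw with ⟨h, h'⟩ | ⟨rfl, b, hb, hbF⟩
    · exact ⟨w, h', Or.inl ⟨h, hw⟩⟩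
    · exact ⟨b, hbF, Or.inr ⟨hb, hw⟩⟩
  · rintro u ⟨huF, hu⟩ v hv huv
    refine ⟨hv, ?_⟩
    by_cases hvB : v ∈ B
    · refine Or.inr ⟨hvB, ?_⟩
      rcases hu with hu | hu
      · exact hcl u hu.2 z (Or.inr ⟨rfl, v, hvB, hv⟩) ((h2 u hu.1).2 ⟨v, hvB, huv⟩)
      · exact hu.2
    · refine Or.inl ⟨hvB, ?_⟩
      rcases hu with hu | hu
      · exact hcl u hu.2 v (Or.inl ⟨hvB, hv⟩) ((h1 u hu.1 v hvB).2 huv)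
      · exact hcl z hu.2 v (Or.inl ⟨hvB, hv⟩) ((h2 v hvB).2 ⟨u, hu.1, huv.symm⟩).symm

theorem sees_preimage (h : IsContraction G G' B z) (hu : u ∉ B)
    (hDB : ∀ w ∈ D, w ∈ B → w = z) (hs : Sees G' u D) : Sees G u (contractPreimage B z D) := by
  obtain ⟨hc, hm, h1, h2⟩ := h
  obtain ⟨w, hw, huw⟩ := hs
  by_cases hwB : w ∈ B
  · obtain rfl := hDB w hw hwB
    obtain ⟨b, hb, hub⟩ := (h2 u hu).1 huw
    exact ⟨b, Or.inr hb, hub⟩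
  · exact ⟨w, Or.inl ⟨hw, fun h => hwB (h ▸ hm)⟩, (h1 u hu w hwB).1 huw⟩

theorem sees_image (h : IsContraction G G' B z) (hu : u ∉ B) (hs : Sees G u F) :
    Sees G' u (contractImage B z F) := by
  obtain ⟨hc, hm, h1, h2⟩ := h
  obtain ⟨w, hw, huw⟩ := hs
  by_cases hwB : w ∈ B
  · exact ⟨z, Or.inr ⟨rfl, w, hwB, hw⟩, (h2 u hu).2 ⟨w, hwB, huw⟩⟩
  · exact ⟨w, Or.inl ⟨hwB, hw⟩, (h1 u hu w hwB).2 huw⟩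

theorem image_subset (hz : z ∈ D) (hF : F ⊆ contractPreimage B z D) :
    contractImage B z F ⊆ D := by
  rintro w (⟨hwB, hw⟩ | ⟨rfl, -⟩)
  · rcases hF hw with h | h
    · exact h.1
    · exact absurd h hwB
  · exact hz

end IsContraction

theorem Attaches.transfer {D' : Set V} (h : Attaches G C D)
    (hC : ∀ u ∈ C, ∀ v ∈ C, G.Adj u v ↔ G'.Adj u v) (hs : ∀ u ∈ C, Sees G u D → Sees G' u D') :
    Attaches G' C D' := by
  rcases h with ⟨x, hx, y, hy, hxy, hn, hsx, hsy⟩ | ⟨a, b, c, hab, hac, hbc, rfl, ha, hb, hc⟩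
  · exact Or.inl ⟨x, hx, y, hy, hxy, fun h => hn ((hC x hx y hy).2 h), hs x hx hsx, hs y hy hsy⟩
  · exact Or.inr ⟨a, b, c, (hC _ (by simp) _ (by simp)).1 hab, (hC _ (by simp) _ (by simp)).1 hac,
      (hC _ (by simp) _ (by simp)).1 hbc, rfl, hs _ (by simp) ha, hs _ (by simp) hb,
      hs _ (by simp) hc⟩

theorem IsIndCycle.transfer (h : IsIndCycle G C) (hC : ∀ u ∈ C, ∀ v ∈ C, G.Adj u v ↔ G'.Adj u v) :
    IsIndCycle G' C := by
  obtain ⟨z, u, v, S, hS, huv, hz, hzu, hzv, hw, rfl⟩ := h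
  have hu := hS.left_mem
  have hv := hS.right_mem
  exact ⟨z, u, v, S, hS.transfer fun a ha b hb => hC a (Or.inr ha) b (Or.inr hb), huv, hz,
    (hC _ (Or.inl rfl) _ (Or.inr hu)).1 hzu, (hC _ (Or.inl rfl) _ (Or.inr hv)).1 hzv,
    fun w hw' h => hw w hw' ((hC _ (Or.inl rfl) _ (Or.inr hw')).2 h), rfl⟩

/-- A solid of a contraction of `G` that contains the contracted vertex lifts to a solid of `G`. -/
theorem IsContraction.exists_solid [Finite V] (h : IsContraction G G' B z) (hS : S ∈ solids G')
    (hz : z ∈ S) (hSB : ∀ w ∈ S, w ∈ B → w = z) :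
    ∃ T ∈ solids G, T ⊆ contractPreimage B z S ∧ S \ {z} ⊆ T ∧ ∃ w ∈ T, w ∈ B := by
  rcases presented_of_mem_solids hS hz with
    ⟨C, D, hC, hD, hdis, rfl, hzD, hat, hmin⟩ | ⟨q, a, D, hqa, hind, hqD, hq, haD, hD, rfl, hzD, hs, hmin⟩
  · have hCB : ∀ u ∈ C, u ∉ B := fun u hu huB => by
      obtain rfl := hSB u (Or.inl hu) huB
      exact hdis _ hzD hu
    have hDB : ∀ w ∈ D, w ∈ B → w = z := fun w hw => hSB w (Or.inr hw)
    have hCC : ∀ u ∈ C, ∀ v ∈ C, G'.Adj u v ↔ G.Adj u v := fun u hu v hv =>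
      h.adj_iff u (hCB u hu) v (hCB v hv)
    obtain ⟨F, hF, hFc, hFa, hFs⟩ := exists_solid_of_attaches (hC.transfer hCC)
      (h.setConn_preimage hD hzD hDB) (by
        rintro w (hw | hw) hwC
        · exact hdis w hw.1 hwC
        · exact hCB w hwC hw)
      (hat.transfer hCC fun u hu => h.sees_preimage (hCB u hu) hDB)
    -- The minimality of `D` is used here: the contracted image of `F` lies in `D`, is connected and
    -- attaches, so it is `D`. Hence `F` contains `D` without `z` and meets `B`.
    have hDF := hmin _ (image_subset hzD hF) (h.setConn_image hFc)
      (hFa.transfer (fun u hu v hv => (hCC u hu v hv).symm) fun u hu => h.sees_image (hCB u hu))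
    refine ⟨_, hFs, ?_, ?_, ?_⟩
    · rintro w (hw | hw)
      · exact Or.inl ⟨Or.inl hw, fun h' => hCB w hw (h' ▸ h.mem)⟩
      · rcases hF hw with h' | h'
        · exact Or.inl ⟨Or.inr h'.1, h'.2⟩
        · exact Or.inr h'
    · rintro w ⟨hw | hw, hwz⟩
      · exact Or.inl hw
      · rcases hDF hw with h' | h'
        · exact Or.inr h'.2
        · exact absurd h'.1 hwz
    · rcases hDF hzD with h' | ⟨-, b, hb, hbF⟩
      · exact absurd h.mem h'.1
      · exact ⟨b, Or.inr hbF, hb⟩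
  · have haB : ∀ i, a i ∉ B := fun i hi => haD i (by
      rw [hSB _ (Or.inr (Or.inl ⟨i, rfl⟩)) hi]; exact hzD)
    have hqB : q ∉ B := fun hi => hqD (by rw [hSB _ (Or.inl rfl) hi]; exact hzD)
    have hDB : ∀ w ∈ D, w ∈ B → w = z := fun w hw => hSB w (Or.inr (Or.inr hw))
    -- As `q` is not adjacent to `z` in the contraction, it has no neighbour in `B`; the expanded
    -- set still avoids its neighbourhood.
    have hqz : ∀ b ∈ B, ¬ G.Adj q b := fun b hb hqb =>
      hq z hzD ((h.adj_iff_sees q hqB).2 ⟨b, hb, hqb⟩)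
    have hdis : ∀ u, u ∉ B → u ∉ D → u ∉ contractPreimage B z D := by
      rintro u h1 h2 (h | h)
      · exact h2 h.1
      · exact h1 h
    have hadj := fun i => (h.adj_iff q hqB (a i) (haB i)).1 (hqa i)
    have hnadj : ∀ i j, i ≠ j → ¬ G.Adj (a i) (a j) := fun i j hij h' =>
      (hind i j hij).2 ((h.adj_iff _ (haB i) _ (haB j)).2 h')
    have hsee := fun i => h.sees_preimage (haB i) hDB (hs i)
    obtain ⟨F, hF, hFc, h0, h1, h2, hFs⟩ := exists_solid_of_apex (h.setConn_preimage hD hzD hDB)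
      (hdis _ (haB 0) (haD 0)) (hdis _ (haB 1) (haD 1)) (hdis _ (haB 2) (haD 2)) (hdis _ hqB hqD)
      (by
        rintro w (hw | hw)
        · by_cases hwB : w ∈ B
          · exact hqz w hwB
          · exact fun h' => hq w hw.1 ((h.adj_iff q hqB w hwB).2 h')
        · exact hqz w hw)
      (hadj 0) (hadj 1) (hadj 2) (hnadj 0 1 (by decide)) (hnadj 0 2 (by decide))
      (hnadj 1 2 (by decide)) (hind 0 1 (by decide)).1 (hind 0 2 (by decide)).1
      (hind 1 2 (by decide)).1 (hsee 0) (hsee 1) (hsee 2)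
    have hDF := hmin _ (image_subset hzD hF) (h.setConn_image hFc) (by
      intro i
      refine h.sees_image (haB i) ?_
      fin_cases i <;> assumption)
    have hr : insert q (insert (a 0) (insert (a 1) (insert (a 2) F))) =
        insert q (Set.range a ∪ F) := by
      ext w
      simp [Fin.exists_fin_succ, eq_comm, or_assoc]
    rw [hr] at hFs
    refine ⟨_, hFs, ?_, ?_, ?_⟩
    · rintro w (rfl | ⟨i, rfl⟩ | hw)
      · exact Or.inl ⟨Or.inl rfl, fun h' => hqB (h' ▸ h.mem)⟩
      · exact Or.inl ⟨Or.inr (Or.inl ⟨i, rfl⟩), fun h' => haB i (h' ▸ h.mem)⟩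
      · rcases hF hw with h' | h'
        · exact Or.inl ⟨Or.inr (Or.inr h'.1), h'.2⟩
        · exact Or.inr h'
    · rintro w ⟨hw | hw | hw, hwz⟩
      · exact Or.inl hw
      · exact Or.inr (Or.inl hw)
      · rcases hDF hw with h' | h'
        · exact Or.inr (Or.inr h'.2)
        · exact absurd h'.1 hwz
    · rcases hDF hzD with h' | ⟨-, b, hb, hbF⟩
      · exact absurd h.mem h'.1
      · exact ⟨b, Or.inr (Or.inr hbF), hb⟩

end

/-! ### Solids in the branch sets of a complete minor -/

/-- The graph obtained from `G` by contracting `B` to `z`; the remaining vertices of `B` become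
isolated. -/
def collapse {V : Type*} (G : SimpleGraph V) (B : Set V) (z : V) : SimpleGraph V where
  -- Requiring `z ∈ B` rules out a loop at `z`, so no hypothesis on `z` is needed in the definition.
  Adj u v := z ∈ B ∧ ((u ∉ B ∧ v ∉ B ∧ G.Adj u v) ∨ (u = z ∧ v ∉ B ∧ Sees G v B) ∨
    (v = z ∧ u ∉ B ∧ Sees G u B))
  symm := ⟨fun u v h => by grind [SimpleGraph.Adj.symm]⟩
  loopless := ⟨fun u h => by grind [G.loopless.irrefl u]⟩

section
variable {V : Type*} {G G' : SimpleGraph V} {a b c d u v w x y z q : V}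
  {S T C P Q R E F D I J B : Set V}

/-- Apply the triangle lemma to three of the vertices, with the fourth as the connected set. -/
theorem exists_solid_of_clique [Finite V] (hab : G.Adj a b) (hac : G.Adj a c) (had : G.Adj a d)
    (hbc : G.Adj b c) (hbd : G.Adj b d) (hcd : G.Adj c d) : ({a, b, c, d} : Set V) ∈ solids G := by
  obtain ⟨F, hF, -, ⟨w, hw, -⟩, -, -, h⟩ := exists_solid_of_triangle (SetConn.singleton (G := G) d)
    (a := a) (b := b) (c := c) had.ne hbd.ne hcd.ne hab hac hbc ⟨d, rfl, had⟩ ⟨d, rfl, hbd⟩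
    ⟨d, rfl, hcd⟩
  obtain rfl : F = {d} := hF.antisymm (by rintro _ rfl; have := hF hw; grind)
  exact h

theorem SetConn.transfer (h : SetConn G D) (e : ∀ u ∈ D, ∀ v ∈ D, G.Adj u v ↔ G'.Adj u v) :
    SetConn G' D := fun A hA hne hcl =>
  h A hA hne fun u hu v hv huv => hcl u hu v hv ((e u (hA hu) v hv).1 huv)

theorem setConn_of_connected (h : (G.induce D).Connected) : SetConn G D := by
  intro A hA ⟨a, ha⟩ hcl
  apply hA.antisymm
  intro w hw
  obtain ⟨p⟩ := h.preconnected ⟨a, hA ha⟩ ⟨w, hw⟩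
  have : ∀ (u v : D), (G.induce D).Walk u v → u.1 ∈ A → v.1 ∈ A := by
    intro u v p
    induction p with
    | nil => exact id
    | @cons u v w huv p ih => exact fun hu => ih (hcl u hu v v.2 huv)
  exact this _ _ p ha

theorem isContraction_collapse (hB : SetConn G B) (hz : z ∈ B) :
    IsContraction G (collapse G B z) B z where
  conn := hB
  mem := hz
  adj_iff u hu v hv := by
    simp only [collapse]
    grind
  adj_iff_sees u hu := by
    simp only [collapse]
    grind

/-- Induction on the set `K` of the indices whose branch set may have more than one vertex, over all
graphs on `V` at once: contracting the branch set of `k` removes `k` from `K` but changes the graph.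
-/
theorem exists_solid_of_branchSets [Finite V] {ι : Type*} [DecidableEq ι] [Fintype ι]
    (hι : Fintype.card ι = 4) (K : Finset ι) : ∀ (G : SimpleGraph V) (B : ι → Set V),
    (∀ i, SetConn G (B i)) → (∀ i, (B i).Nonempty) → (∀ i j, i ≠ j → ∀ w ∈ B i, w ∉ B j) →
    (∀ i j, i ≠ j → ∃ u ∈ B i, Sees G u (B j)) → (∀ i ∉ K, (B i).Subsingleton) →
    ∃ S ∈ solids G, S ⊆ ⋃ i, B i ∧ ∀ i, ∃ w ∈ S, w ∈ B i := by
  induction K using Finset.induction_on with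
  | empty =>
    intro G B hB hne hdis hadj hsub
    choose b hb using hne
    have hs : ∀ i, ∀ w ∈ B i, w = b i := fun i w hw => hsub i (by simp) hw (hb i)
    have hbb : ∀ i j, i ≠ j → G.Adj (b i) (b j) := by
      intro i j hij
      obtain ⟨u, hu, v, hv, huv⟩ := hadj i j hij
      rwa [← hs i u hu, ← hs j v hv]
    let e : Fin 4 ≃ ι := (Fintype.equivFinOfCardEq hι).symm
    have he : ∀ i j, i ≠ j → G.Adj (b (e i)) (b (e j)) := fun i j hij =>
      hbb _ _ (e.injective.ne hij)
    refine ⟨_, exists_solid_of_clique (he 0 1 (by decide)) (he 0 2 (by decide))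
      (he 0 3 (by decide)) (he 1 2 (by decide)) (he 1 3 (by decide)) (he 2 3 (by decide)), ?_, ?_⟩
    · rintro w (rfl | rfl | rfl | rfl) <;> exact Set.mem_iUnion.2 ⟨_, hb _⟩
    · intro i
      refine ⟨b i, ?_, hb i⟩
      obtain ⟨j, rfl⟩ := e.surjective i
      fin_cases j <;> simp
  | insert k K hk ih =>
    intro G B hB hne hdis hadj hsub
    obtain ⟨b, hb⟩ := hne k
    have hcon := isContraction_collapse (hB k) hb
    have hupd : ∀ i, i ≠ k → Function.update B k {b} i = B i := fun i hi => by simp [hi]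
    have hadj' : ∀ i, i ≠ k → ∀ j, j ≠ k → ∀ u ∈ B i, ∀ v ∈ B j,
        G.Adj u v ↔ (collapse G (B k) b).Adj u v := fun i hi j hj u hu v hv =>
      (hcon.adj_iff u (hdis i k hi u hu) v (hdis j k hj v hv)).symm
    -- The solid found in the contraction meets the branch set `{b}` and so contains the contracted
    -- vertex, as the lifting requires.
    have IH : ∃ S ∈ solids (collapse G (B k) b), S ⊆ ⋃ i, Function.update B k {b} i ∧
        ∀ i, ∃ w ∈ S, w ∈ Function.update B k {b} i := by
      refine ih _ _ ?_ ?_ ?_ ?_ ?_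
      · intro i
        by_cases hik : i = k
        · subst hik
          simpa using SetConn.singleton b
        · rw [hupd i hik]
          exact (hB i).transfer (hadj' i hik i hik)
      · intro i
        by_cases hik : i = k
        · subst hik
          simp
        · rw [hupd i hik]
          exact hne i
      · intro i j hij
        by_cases hik : i = k
        · subst hik
          rw [hupd j hij.symm]
          simp only [Function.update_self, Set.mem_singleton_iff, forall_eq]
          exact hdis i j hij b hb
        · rw [hupd i hik]
          by_cases hjk : j = k
          · subst hjk
            simp only [Function.update_self, Set.mem_singleton_iff]
            rintro w hw rfl
            exact hdis i j hij _ hw hb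
          · rw [hupd j hjk]
            exact hdis i j hij
      · intro i j hij
        by_cases hik : i = k
        · subst hik
          rw [hupd j hij.symm]
          simp only [Function.update_self]
          obtain ⟨u, hu, hs⟩ := hadj j i hij.symm
          exact ⟨b, rfl, u, hu, ((hcon.adj_iff_sees u (hdis _ _ hij.symm u hu)).2 hs).symm⟩
        · rw [hupd i hik]
          obtain ⟨u, hu, hs⟩ := hadj i j hij
          by_cases hjk : j = k
          · subst hjk
            simp only [Function.update_self]
            exact ⟨u, hu, b, rfl, (hcon.adj_iff_sees u (hdis _ _ hij u hu)).2 hs⟩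
          · rw [hupd j hjk]
            obtain ⟨v, hv, huv⟩ := hs
            exact ⟨u, hu, v, hv, (hadj' i hik j hjk u hu v hv).1 huv⟩
      · intro i hi
        by_cases hik : i = k
        · subst hik
          simp
        · rw [hupd i hik]
          exact hsub i (by simp [hik, hi])
    obtain ⟨S, hS, hSB, hSm⟩ := IH
    have hbS : b ∈ S := by
      obtain ⟨w, hw, hw'⟩ := hSm k
      simp only [Function.update_self, Set.mem_singleton_iff] at hw'
      exact hw' ▸ hw
    obtain ⟨T, hT, hTS, hST, hTB⟩ := hcon.exists_solid hS hbS (by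
      intro w hw hwB
      obtain ⟨i, hi⟩ := Set.mem_iUnion.1 (hSB hw)
      by_cases hik : i = k
      · subst hik
        simpa using hi
      · rw [hupd i hik] at hi
        exact absurd hwB (hdis i k hik w hi))
    refine ⟨T, hT, ?_, ?_⟩
    · intro w hw
      rcases hTS hw with h | h
      · obtain ⟨i, hi⟩ := Set.mem_iUnion.1 (hSB h.1)
        by_cases hik : i = k
        · subst hik
          exact absurd (by simpa using hi) h.2
        · rw [hupd i hik] at hi
          exact Set.mem_iUnion.2 ⟨i, hi⟩
      · exact Set.mem_iUnion.2 ⟨k, h⟩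
    · intro i
      by_cases hik : i = k
      · subst hik
        exact hTB
      · obtain ⟨w, hw, hw'⟩ := hSm i
        rw [hupd i hik] at hw'
        refine ⟨w, hST ⟨hw, ?_⟩, hw'⟩
        rintro rfl
        exact hdis i k hik _ hw' hb

/-- A four-set of indices is recovered from its solid as the set of the branch sets that the solid
meets. -/
theorem HasCompleteMinor.choose_le_encard_solids [Finite V] {t : ℕ} (h : HasCompleteMinor G t) :
    ((t.choose 4 : ℕ) : ℕ∞) ≤ (solids G).encard := by
  obtain ⟨B, hconn, hdis, hadj⟩ := h
  have hdis' : ∀ i j, i ≠ j → ∀ w ∈ B i, w ∉ B j := fun i j hij w hw hw' =>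
    Set.disjoint_left.1 (hdis i j hij) hw hw'
  have key : ∀ A ∈ Finset.powersetCard 4 (Finset.univ : Finset (Fin t)), ∃ S ∈ solids G,
      ∀ i, i ∈ A ↔ ∃ w ∈ S, w ∈ B i := by
    intro A hA
    obtain ⟨S, hS, hSB, hSm⟩ := exists_solid_of_branchSets (ι := A)
      (by simpa using (Finset.mem_powersetCard.1 hA).2) Finset.univ G (fun i => B i)
      (fun i => setConn_of_connected (hconn i))
      (fun i => by obtain ⟨x⟩ := (hconn i).nonempty; exact ⟨x, x.2⟩)
      (fun i j hij => hdis' i j (fun h => hij (Subtype.ext h)))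
      (fun i j hij => by
        obtain ⟨u, hu, v, hv, huv⟩ := hadj i j (fun h => hij (Subtype.ext h))
        exact ⟨u, hu, v, hv, huv⟩) (fun i hi => absurd (Finset.mem_univ i) hi)
    refine ⟨S, hS, fun i => ⟨fun hi => hSm ⟨i, hi⟩, ?_⟩⟩
    rintro ⟨w, hw, hwi⟩
    obtain ⟨j, hj⟩ := Set.mem_iUnion.1 (hSB hw)
    by_contra hi
    exact hdis' i j (fun h => hi (h ▸ j.2)) w hwi hj
  choose! f hf hfA using key
  have : (Finset.powersetCard 4 (Finset.univ : Finset (Fin t)) : Set (Finset (Fin t))).encard ≤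
      (solids G).encard := by
    refine Set.encard_le_encard_of_injOn (f := f) hf ?_
    intro A hA A' hA' h
    ext i
    rw [hfA A hA, hfA A' hA', h]
  simpa using this

end

/-! ### A vertex whose neighbourhood triples lie in solids -/

/-- `U` contains a solid through `v` in which the neighbours of `v` are `a`, `b` and `c`. -/
def HasSolidAt {V : Type*} (G : SimpleGraph V) (U : Set V) (v a b c : V) : Prop :=
  ∃ S ∈ solids G, S ⊆ U ∧ v ∈ S ∧ ∀ w, w ∈ S ∧ G.Adj v w ↔ w = a ∨ w = b ∨ w = c

/-- `U` contains a connected set that avoids the closed neighbourhood of `v` and is seen by both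
`a` and `b`. -/
def LinkedOff {V : Type*} (G : SimpleGraph V) (U : Set V) (v a b : V) : Prop :=
  ∃ E ⊆ U, SetConn G E ∧ (∀ w ∈ E, w ≠ v ∧ ¬ G.Adj v w) ∧ Sees G a E ∧ Sees G b E

/-- Any three neighbours of `v` in `U` are the neighbours of `v` in a solid in `U`, and any
two nonadjacent neighbours of `v` in `U` are linked off the closed neighbourhood of `v`. -/
structure IsGoodVertex {V : Type*} (G : SimpleGraph V) (U : Set V) (v : V) : Prop where
  mem : v ∈ U
  hasSolidAt : ∀ a ∈ U, ∀ b ∈ U, ∀ c ∈ U, G.Adj v a → G.Adj v b → G.Adj v c → a ≠ b → a ≠ c →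
    b ≠ c → HasSolidAt G U v a b c
  linkedOff : ∀ a ∈ U, ∀ b ∈ U, G.Adj v a → G.Adj v b → a ≠ b → ¬ G.Adj a b → LinkedOff G U v a b

section
variable {V : Type*} {G G' : SimpleGraph V} {a b c d u v w x y z q : V}
  {S T C P Q R E F D I J B U : Set V}

theorem HasSolidAt.rotate (h : HasSolidAt G U v a b c) : HasSolidAt G U v b c a := by
  obtain ⟨S, h1, h2, h3, h4⟩ := h
  exact ⟨S, h1, h2, h3, fun w => (h4 w).trans (by tauto)⟩

theorem HasSolidAt.mono (h : HasSolidAt G R v a b c) (hRU : R ⊆ U) : HasSolidAt G U v a b c := by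
  obtain ⟨S, h1, h2, h3, h4⟩ := h
  exact ⟨S, h1, h2.trans hRU, h3, h4⟩

theorem LinkedOff.mono (h : LinkedOff G R v a b) (hRU : R ⊆ U) : LinkedOff G U v a b := by
  obtain ⟨E, h1, h2⟩ := h
  exact ⟨E, h1.trans hRU, h2⟩

theorem hasSolidAt_of_clique [Finite V] (hv : v ∈ U) (ha : a ∈ U) (hb : b ∈ U) (hc : c ∈ U)
    (hva : G.Adj v a) (hvb : G.Adj v b) (hvc : G.Adj v c) (hab : G.Adj a b) (hac : G.Adj a c)
    (hbc : G.Adj b c) : HasSolidAt G U v a b c := by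
  refine ⟨_, exists_solid_of_clique hva hvb hvc hab hac hbc, by grind, by simp, fun w => ?_⟩
  have := G.loopless.irrefl v
  constructor
  · rintro ⟨rfl | h, h'⟩
    · exact absurd h' this
    · exact h
  · rintro (rfl | rfl | rfl) <;> simp [*]

/-- Apply the triangle lemma to `v`, `a`, `b` and the connected set `insert c E`. There `c` is the
only neighbour of `v`, so any part of the set seen by `v` contains `c`. -/
theorem hasSolidAt_of_edge [Finite V] (hv : v ∈ U) (ha : a ∈ U) (hb : b ∈ U) (hc : c ∈ U)
    (hva : G.Adj v a) (hvb : G.Adj v b) (hvc : G.Adj v c) (hab : G.Adj a b) (nac : a ≠ c)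
    (nbc : b ≠ c) (hEU : E ⊆ U) (hE : SetConn G E) (hvE : ∀ w ∈ E, w ≠ v ∧ ¬ G.Adj v w)
    (hcE : Sees G c E) (haE : Sees G a (insert c E)) (hbE : Sees G b (insert c E)) :
    HasSolidAt G U v a b c := by
  obtain ⟨e, he, hce⟩ := hcE
  have hv' := G.loopless.irrefl v
  obtain ⟨F, hF, -, ⟨w, hw, hvw⟩, -, -, h⟩ := exists_solid_of_triangle (hE.insert he hce)
    (a := v) (b := a) (c := b) (by grind) (by grind) (by grind) hva hvb hab ⟨c, Or.inl rfl, hvc⟩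
    haE hbE
  have hFc : ∀ w ∈ F, G.Adj v w → w = c := fun w hw hvw => by
    rcases hF hw with h | h
    · exact h
    · exact absurd hvw (hvE w h).2
  obtain rfl := hFc w hw hvw
  refine ⟨_, h, ?_, by simp, ?_⟩
  · rintro x (rfl | rfl | rfl | hx)
    · exact hv
    · exact ha
    · exact hb
    · rcases hF hx with rfl | h
      · exact hc
      · exact hEU h
  · intro x
    constructor
    · rintro ⟨rfl | rfl | rfl | hx, hvx⟩
      · exact absurd hvx hv'
      · simp
      · simp
      · exact Or.inr (Or.inr (hFc x hx hvx))
    · rintro (rfl | rfl | rfl) <;> simp [*]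

/-- The vertex `v` serves as the apex; `E` contributes no further neighbour of `v`. -/
theorem hasSolidAt_of_independent [Finite V] (hv : v ∈ U) (ha : a ∈ U) (hb : b ∈ U) (hc : c ∈ U)
    (hva : G.Adj v a) (hvb : G.Adj v b) (hvc : G.Adj v c) (hab : ¬ G.Adj a b) (hac : ¬ G.Adj a c)
    (hbc : ¬ G.Adj b c) (nab : a ≠ b) (nac : a ≠ c) (nbc : b ≠ c) (hEU : E ⊆ U) (hE : SetConn G E)
    (hvE : ∀ w ∈ E, w ≠ v ∧ ¬ G.Adj v w) (haE : Sees G a E) (hbE : Sees G b E) (hcE : Sees G c E) :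
    HasSolidAt G U v a b c := by
  have hv' := G.loopless.irrefl v
  obtain ⟨F, hF, -, -, -, -, h⟩ := exists_solid_of_apex hE (q := v) (a := a) (b := b) (c := c)
    (by grind) (by grind) (by grind) (by grind) (by grind) hva hvb hvc hab hac hbc nab nac nbc
    haE hbE hcE
  refine ⟨_, h, by grind, by simp, fun x => ?_⟩
  constructor
  · rintro ⟨rfl | rfl | rfl | rfl | hx, hvx⟩
    · exact absurd hvx hv'
    · simp
    · simp
    · simp
    · exact absurd hvx (hvE x (hF hx)).2
  · rintro (rfl | rfl | rfl) <;> simp [*]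

/-- A good vertex of the part of `U` that does not see `D` is a good vertex of `U` if that part is
completely joined to the vertices of `U` that see `D`. -/
theorem IsGoodVertex.extend [Finite V] (hDU : D ⊆ U) (hD : SetConn G D)
    (hR : ∀ w, w ∈ R ↔ w ∈ U ∧ w ∉ D ∧ ¬ Sees G w D)
    (hA : ∀ r ∈ R, ∀ a ∈ U, a ∉ D → a ∉ R → G.Adj r a) (h : IsGoodVertex G R v) :
    IsGoodVertex G U v := by
  obtain ⟨hvR, h1, h2⟩ := h
  have hRU : R ⊆ U := fun w hw => ((hR w).1 hw).1
  have hvD : ∀ w ∈ D, w ≠ v ∧ ¬ G.Adj v w := fun w hw =>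
    ⟨fun h => ((hR v).1 hvR).2.1 (h ▸ hw), fun h => ((hR v).1 hvR).2.2 ⟨w, hw, h⟩⟩
  -- The neighbours of `v` lie in `R` or see `D`. As these two classes are completely joined,
  -- nonadjacent neighbours belong to the same class.
  have hside : ∀ a ∈ U, ∀ b ∈ U, G.Adj v a → G.Adj v b → ¬ G.Adj a b →
      a ∈ R ∧ b ∈ R ∨ (a ∉ R ∧ b ∉ R ∧ Sees G a D ∧ Sees G b D) := by
    intro a ha b hb hva hvb hab
    have haD : a ∉ D := fun h => (hvD a h).2 hva
    have hbD : b ∉ D := fun h => (hvD b h).2 hvb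
    by_cases haR : a ∈ R
    · refine Or.inl ⟨haR, ?_⟩
      by_contra hbR
      exact hab (hA a haR b hb hbD hbR)
    · by_cases hbR : b ∈ R
      · exact absurd (hA b hbR a ha haD haR).symm hab
      · refine Or.inr ⟨haR, hbR, ?_, ?_⟩
        · by_contra h
          exact haR ((hR a).2 ⟨ha, haD, h⟩)
        · by_contra h
          exact hbR ((hR b).2 ⟨hb, hbD, h⟩)
  have hlink : ∀ a ∈ U, ∀ b ∈ U, G.Adj v a → G.Adj v b → a ≠ b → ¬ G.Adj a b →
      LinkedOff G U v a b := by
    intro a ha b hb hva hvb nab hab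
    rcases hside a ha b hb hva hvb hab with ⟨haR, hbR⟩ | ⟨-, -, hsa, hsb⟩
    · exact (h2 a haR b hbR hva hvb nab hab).mono hRU
    · exact ⟨D, hDU, hD, hvD, hsa, hsb⟩
  -- exactly one edge among the three neighbours
  have hone : ∀ a ∈ U, ∀ b ∈ U, ∀ c ∈ U, G.Adj v a → G.Adj v b → G.Adj v c → a ≠ b → a ≠ c →
      b ≠ c → G.Adj a b → ¬ G.Adj a c → ¬ G.Adj b c → HasSolidAt G U v a b c := by
    intro a ha b hb c hc hva hvb hvc nab nac nbc hab hac hbc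
    rcases hside a ha c hc hva hvc hac with ⟨haR, hcR⟩ | ⟨haR, hcR, hsa, hsc⟩
    · rcases hside b hb c hc hvb hvc hbc with ⟨hbR, -⟩ | ⟨-, hcR', -, -⟩
      · exact (h1 a haR b hbR c hcR hva hvb hvc nab nac nbc).mono hRU
      · exact absurd hcR hcR'
    · rcases hside b hb c hc hvb hvc hbc with ⟨-, hcR'⟩ | ⟨-, -, hsb, -⟩
      · exact absurd hcR' hcR
      · exact hasSolidAt_of_edge (hRU hvR) ha hb hc hva hvb hvc hab nac nbc hDU hD hvD hsc
          (hsa.mono (Set.subset_insert _ _)) (hsb.mono (Set.subset_insert _ _))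
  -- exactly two edges
  have htwo : ∀ a ∈ U, ∀ b ∈ U, ∀ c ∈ U, G.Adj v a → G.Adj v b → G.Adj v c → a ≠ b → a ≠ c →
      b ≠ c → G.Adj a b → ¬ G.Adj a c → G.Adj b c → HasSolidAt G U v a b c := by
    intro a ha b hb c hc hva hvb hvc nab nac nbc hab hac hbc
    -- A link between the nonadjacent pair suffices, as the middle vertex `b` sees `c` itself.
    obtain ⟨E, hEU, hE, hvE, hsa, hsc⟩ := hlink a ha c hc hva hvc nac hac
    exact hasSolidAt_of_edge (hRU hvR) ha hb hc hva hvb hvc hab nac nbc hEU hE hvE hsc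
      (hsa.mono (Set.subset_insert _ _)) ⟨c, Or.inl rfl, hbc⟩
  refine ⟨hRU hvR, ?_, hlink⟩
  intro a ha b hb c hc hva hvb hvc nab nac nbc
  by_cases hab : G.Adj a b <;> by_cases hac : G.Adj a c <;> by_cases hbc : G.Adj b c
  · exact hasSolidAt_of_clique (hRU hvR) ha hb hc hva hvb hvc hab hac hbc
  · exact (htwo c hc a ha b hb hvc hva hvb nac.symm nbc.symm nab hac.symm
      (fun h => hbc h.symm) hab).rotate
  · exact htwo a ha b hb c hc hva hvb hvc nab nac nbc hab hac hbc
  · exact hone a ha b hb c hc hva hvb hvc nab nac nbc hab hac hbc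
  · exact (htwo b hb c hc a ha hvb hvc hva nbc nab.symm nac.symm hbc
      (fun h => hab h.symm) hac.symm).rotate.rotate
  · exact (hone c hc a ha b hb hvc hva hvb nac.symm nbc.symm nab hac.symm
      (fun h => hbc h.symm) hab).rotate
  · exact (hone b hb c hc a ha hvb hvc hva nbc nab.symm nac.symm hbc
      (fun h => hab h.symm) (fun h => hac h.symm)).rotate.rotate
  · rcases hside a ha b hb hva hvb hab with ⟨haR, hbR⟩ | ⟨haR, hbR, hsa, hsb⟩
    · rcases hside a ha c hc hva hvc hac with ⟨-, hcR⟩ | ⟨haR', -⟩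
      · exact (h1 a haR b hbR c hcR hva hvb hvc nab nac nbc).mono hRU
      · exact absurd haR haR'
    · rcases hside a ha c hc hva hvc hac with ⟨haR', -⟩ | ⟨-, -, -, hsc⟩
      · exact absurd haR' haR
      · exact hasSolidAt_of_independent (hRU hvR) ha hb hc hva hvb hvc hab hac hbc nab nac nbc
          hDU hD hvD hsa hsb hsc

/-- Unless `U` is a clique, choose a maximal connected `D` that some vertex of `U` outside `D` does
not see, and let `R` be the set of all such vertices. A vertex `a` of `U` that lies outside `D` and
sees it is joined to all of `R`: if it missed some `r`, then `insert a D` would be larger and still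
unseen by `r`. Hence a good vertex of `R`, found by induction, is good in `U`. -/
theorem exists_isGoodVertex [Finite V] (G : SimpleGraph V) (U : Set V) (hU : U.Nonempty) :
    ∃ v, IsGoodVertex G U v := by
  induction U using WellFoundedLT.induction with
  | ind U ih =>
  by_cases hcl : ∀ x ∈ U, ∀ y ∈ U, x ≠ y → G.Adj x y
  · obtain ⟨v, hv⟩ := hU
    exact ⟨v, hv, fun a ha b hb c hc hva hvb hvc nab nac nbc =>
      hasSolidAt_of_clique hv ha hb hc hva hvb hvc (hcl a ha b hb nab) (hcl a ha c hc nac)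
        (hcl b hb c hc nbc), fun a ha b hb _ _ nab hab => absurd (hcl a ha b hb nab) hab⟩
  · push Not at hcl
    obtain ⟨x, hx, y, hy, nxy, hxy⟩ := hcl
    obtain ⟨D, ⟨hDU, hD, hDne, v, hvU, hvD⟩, hmax⟩ := (Set.toFinite {D : Set V | D ⊆ U ∧ SetConn G D ∧
      D.Nonempty ∧ ∃ v ∈ U, ∀ w ∈ D, w ≠ v ∧ ¬ G.Adj v w}).exists_maximal
      ⟨{y}, by simpa using hy, .singleton y, by simp, x, hx, by simp [nxy.symm, hxy]⟩
    obtain ⟨d, hd⟩ := hDne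
    have hvR : v ∈ {w | w ∈ U ∧ w ∉ D ∧ ¬ Sees G w D} :=
      ⟨hvU, fun h => (hvD v h).1 rfl, fun ⟨w, hw, h⟩ => (hvD w hw).2 h⟩
    obtain ⟨v', hv'⟩ := ih {w | w ∈ U ∧ w ∉ D ∧ ¬ Sees G w D}
      ((Set.ssubset_iff_of_subset fun w hw => hw.1).2 ⟨d, hDU hd, fun h => h.2.1 hd⟩) ⟨v, hvR⟩
    refine ⟨v', hv'.extend hDU hD (fun w => Iff.rfl) ?_⟩
    rintro r ⟨hrU, hrD, hrs⟩ a haU haD haR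
    by_contra hra
    have har : a ≠ r := by
      rintro rfl
      exact haR ⟨hrU, hrD, hrs⟩
    have has : Sees G a D := by
      by_contra h
      exact haR ⟨haU, haD, h⟩
    obtain ⟨e, he, hae⟩ := has
    refine haD (hmax ⟨Set.insert_subset haU hDU, hD.insert he hae, Set.insert_nonempty _ _, r, hrU,
      ?_⟩ (Set.subset_insert a D) (Set.mem_insert a D))
    rintro w (rfl | hw)
    · exact ⟨har, hra⟩
    · exact ⟨fun h => hrD (h ▸ hw), fun h => hrs ⟨w, hw, h⟩⟩

end

/-! ### Counting solids -/

/-- The vertices in `U` have a proper colouring with the colours `0, …, m - 1`. -/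
def ColorableOn {V : Type*} (G : SimpleGraph V) (U : Set V) (m : ℕ) : Prop :=
  ∃ f : V → ℕ, (∀ u ∈ U, f u < m) ∧ ∀ u ∈ U, ∀ v ∈ U, G.Adj u v → f u ≠ f v

section
variable {V : Type*} {G : SimpleGraph V} {v : V} {U : Set V}

/-- Three neighbours of `v` are recovered from their solid as its intersection with the
neighbourhood of `v`. -/
theorem IsGoodVertex.choose_le_ncard [Finite V] (h : IsGoodVertex G U v) :
    ({w ∈ U | G.Adj v w}.ncard).choose 3 ≤ {S ∈ solids G | S ⊆ U ∧ v ∈ S}.ncard := by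
  classical
  have hfin : {w ∈ U | G.Adj v w}.Finite := Set.toFinite _
  have key : ∀ A ∈ Finset.powersetCard 3 hfin.toFinset, ∃ S, (S ∈ solids G ∧ S ⊆ U ∧ v ∈ S) ∧
      ∀ w, w ∈ S ∧ G.Adj v w ↔ w ∈ A := by
    intro A hA
    obtain ⟨hAN, hA3⟩ := Finset.mem_powersetCard.1 hA
    obtain ⟨a, b, c, nab, nac, nbc, rfl⟩ := Finset.card_eq_three.1 hA3
    have hm : ∀ w ∈ ({a, b, c} : Finset V), w ∈ U ∧ G.Adj v w := fun w hw => by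
      simpa using hAN hw
    obtain ⟨ha, hva⟩ := hm a (by simp)
    obtain ⟨hb, hvb⟩ := hm b (by simp)
    obtain ⟨hc, hvc⟩ := hm c (by simp)
    obtain ⟨S, h1, h2, h3, h4⟩ := h.hasSolidAt a ha b hb c hc hva hvb hvc nab nac nbc
    exact ⟨S, ⟨h1, h2, h3⟩, fun w => by rw [h4]; simp⟩
  choose! f hf hfA using key
  have := Set.ncard_le_ncard_of_injOn (s := (Finset.powersetCard 3 hfin.toFinset : Set (Finset V)))
    (t := {S ∈ solids G | S ⊆ U ∧ v ∈ S}) f hf (by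
      intro A hA A' hA' hAA
      ext w
      rw [← hfA A hA, ← hfA A' hA', hAA]) (Set.toFinite _)
  rwa [Set.ncard_coe_finset, Finset.card_powersetCard, ← Set.ncard_eq_toFinset_card _ hfin] at this

/-- Induction on `U`, deleting a good vertex `v`. A vertex of small degree does not affect
colourability; one of large degree lies in enough solids to pay for the loss of one colour. -/
theorem choose_le_ncard_solids [Finite V] (G : SimpleGraph V) (U : Set V) :
    ∀ m, ¬ ColorableOn G U m → (m + 1).choose 4 ≤ {S ∈ solids G | S ⊆ U}.ncard := by
  classical
  induction U using WellFoundedLT.induction with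
  | ind U ih =>
  intro m hm
  have hne : U.Nonempty := by
    by_contra h
    rw [Set.not_nonempty_iff_eq_empty] at h
    subst h
    exact hm ⟨fun _ => 0, by simp, by simp⟩
  obtain ⟨v, hv⟩ := exists_isGoodVertex G U hne
  have hlt : U \ {v} < U :=
    (Set.ssubset_iff_of_subset Set.sdiff_subset).2 ⟨v, hv.mem, fun h => h.2 rfl⟩
  -- a colour that is free at `v` extends a colouring
  have hext : ∀ f : V → ℕ, ∀ k < m, (∀ u ∈ U \ {v}, f u < m) →
      (∀ u ∈ U \ {v}, ∀ w ∈ U \ {v}, G.Adj u w → f u ≠ f w) →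
      (∀ u ∈ U, G.Adj v u → f u ≠ k) → False := by
    intro f k hk h1 h2 h3
    refine hm ⟨Function.update f v k, ?_, ?_⟩
    · intro u hu
      by_cases huv : u = v
      · simpa [huv] using hk
      · simpa [huv] using h1 u ⟨hu, huv⟩
    · intro u hu w hw huw
      by_cases huv : u = v
      · subst huv
        have hwu : w ≠ u := huw.ne'
        simpa [hwu] using (h3 w hw huw).symm
      · by_cases hwv : w = v
        · subst hwv
          simpa [huv] using h3 u hu huw.symm
        · simpa [huv, hwv] using h2 u ⟨hu, huv⟩ w ⟨hw, hwv⟩ huw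
  by_cases hdeg : {w ∈ U | G.Adj v w}.ncard < m
  · refine (ih _ hlt m ?_).trans
      (Set.ncard_le_ncard (fun S hS => ⟨hS.1, hS.2.trans Set.sdiff_subset⟩) (Set.toFinite _))
    -- Fewer than `m` colours occur around `v`, so one is free for it.
    rintro ⟨f, h1, h2⟩
    have : (f '' {w ∈ U | G.Adj v w}).ncard < (Finset.range m : Set ℕ).ncard := by
      rw [Set.ncard_coe_finset, Finset.card_range]
      exact (Set.ncard_image_le (Set.toFinite _)).trans_lt hdeg
    obtain ⟨k, hk, hk'⟩ := Set.exists_mem_notMem_of_ncard_lt_ncard this (Set.toFinite _)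
    exact hext f k (by simpa using hk) h1 h2 fun u hu huv h => hk' ⟨u, ⟨hu, huv⟩, h⟩
  · obtain _ | m := m
    -- Here `m` is zero, and a one-element set has no four-element subset.
    · exact Nat.zero_le _
    have h1 : (m + 1).choose 3 ≤ {S ∈ solids G | S ⊆ U ∧ v ∈ S}.ncard :=
      (Nat.choose_le_choose 3 (not_lt.1 hdeg)).trans hv.choose_le_ncard
    have h2 : (m + 1).choose 4 ≤ {S ∈ solids G | S ⊆ U \ {v}}.ncard := by
      refine ih _ hlt m ?_
      rintro ⟨f, h1, h2⟩
      -- The colour `m` is not used on the rest of `U` and can be given to `v`.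
      exact hext f m (by omega) (fun u hu => (h1 u hu).trans (by omega)) h2
        fun u hu huv => (h1 u ⟨hu, huv.ne'⟩).ne
    -- Pascal's rule separates the solids through `v` from those avoiding it.
    rw [Nat.choose_succ_succ]
    refine (add_le_add h1 h2).trans ?_
    rw [← Set.ncard_union_eq _ (Set.toFinite _) (Set.toFinite _)]
    · refine Set.ncard_le_ncard ?_ (Set.toFinite _)
      rintro S (hS | hS)
      · exact ⟨hS.1, hS.2.1⟩
      · exact ⟨hS.1, hS.2.trans Set.sdiff_subset⟩
    · rw [Set.disjoint_left]
      rintro S hS hS'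
      exact (hS'.2 hS.2.2).2 rfl

theorem ColorableOn.colorable {m : ℕ} (h : ColorableOn G Set.univ m) : G.Colorable m := by
  obtain ⟨f, h1, h2⟩ := h
  exact ⟨SimpleGraph.Coloring.mk (fun v => ⟨f v, h1 v trivial⟩)
    fun {u v} huv h => h2 u trivial v trivial huv (Fin.mk.inj h)⟩

end

/-! ### The theorem. -/

theorem theorem5p1p2 {V : Type*} [Finite V] (G : SimpleGraph V) (hG : G.Connected) (n : ℕ)
    (hn : (solids G).encard < (n.choose 4 : ℕ∞)) :
    max G.chromaticNumber (hadwigerNumber G) < (n : ℕ∞) := by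
  obtain _ | m := n
  -- For `n = 0` the binomial coefficient is zero, so the hypothesis fails.
  · simp at hn
  refine max_lt ?_ ?_
  -- With `n = m + 1`, failure to be `m`-colourable gives exactly the excluded number $\binom{m+1}4$
  -- of solids.
  · have hcol : G.Colorable m := by
      by_contra h
      have := choose_le_ncard_solids G Set.univ m fun h' => h h'.colorable
      simp only [Set.subset_univ, and_true, Set.ofPred_mem_eq] at this
      rw [← (Set.toFinite (solids G)).cast_ncard_eq, Nat.cast_lt] at hn
      omega
    exact hcol.chromaticNumber_le.trans_lt (by exact_mod_cast Nat.lt_succ_self m)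
  · have : hadwigerNumber G ≤ (m : ℕ∞) := by
      refine iSup₂_le fun t ht => ?_
      by_contra hlt
      have hmt : m + 1 ≤ t := by
        rw [not_le, Nat.cast_lt] at hlt
        exact hlt
      have := ht.choose_le_encard_solids
      have h2 : (((m + 1).choose 4 : ℕ) : ℕ∞) ≤ (t.choose 4 : ℕ) := by
        exact_mod_cast Nat.choose_le_choose 4 hmt
      exact absurd (h2.trans this) (not_le.2 hn)
    exact this.trans_lt (by exact_mod_cast Nat.lt_succ_self m)
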